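/- **Double covers.** Let $W$ be $W_{A_{n-1}}=S_n$ ($n\ge1$), $W_{D_n}$ ($n\ge 4$) or $W_{B_n}$ ($n\ge2$), with simple reflections $s_i$, where $1\le i\le n-1$ in type $A_{n-1}$ and $1\le i\le n$ in types $D_n,B_n$, and Coxeter integers $m_{ij}$ (the diagram of $s_1,\dots,s_{n-1}$ being the path of type $A_{n-1}$, except that in type $B_n$ $m_{n-1,n}=4$ with $s_n$ joined only to $s_{n-1}$; in type $D_n$ $m_{n-2,n}=3$ with $s_n$ joined only to $s_{n-2}$). Let $\widetilde W$ be the group generated by $z$ and the $\tilde t_i$, with the relations: $z$ is central, $z^2=1$, $\tilde t_i^2=1$, and $$\tilde t_i\tilde t_j=z\tilde t_j\tilde t_i\ (m_{ij}=2),\qquad \tilde t_i\tilde t_j\tilde t_i=\tilde t_j\tilde t_i\tilde t_j\ (m_{ij}=3),\qquad (\tilde t_i\tilde t_j)^2=z(\tilde t_j\tilde t_i)^2\ (m_{ij}=4).$$ Put, for $1\le i<j\le n$ (products of $\tilde t$'s with indices running upwards or downwards by steps of $1$, empty products being $1$), $$\{i,j\}=z^{j-i-1}\,\tilde t_{j-1}\cdots\tilde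 t_{i+1}\,\tilde t_i\,\tilde t_{i+1}\cdots\tilde t_{j-1},\qquad \{j,i\}=z\{i,j\},$$ $$\overline{\{i,j\}}=\overline{\{j,i\}}=\begin{cases} z^{j-i-1}(\tilde t_j\cdots\tilde t_{n-1})(\tilde t_i\cdots\tilde t_{n-2})\,\tilde t_n\,(\tilde t_{n-2}\cdots\tilde t_i)(\tilde t_{n-1}\cdots\tilde t_j)&\text{in type }D_n,\\ z^{j-i}(\tilde t_j\cdots\tilde t_{n-1})(\tilde t_i\cdots\tilde t_{n-2})\,\tilde t_n\tilde t_{n-1}\tilde t_n\,(\tilde t_{n-2}\cdots\tilde t_i)(\tilde t_{n-1}\cdots\tilde t_j)&\text{in type }B_n,\end{cases}$$ and, in type $B_n$, $\{i\}=z^{n-i}\,\tilde t_i\cdots\tilde t_{n-1}\tilde t_n\tilde t_{n-1}\cdots\tilde t_i$ for $1\le i\le n$. **Algebras.** Let $u,v\in\mathbb C$. The rational covering double affine Hecke algebra $\mathfrak H_W$ is the unital associative $\mathbb C$-algebra generated by $\tilde x_i,\tilde y_i$ $(1\le i\le n)$, $z$ and the $\tilde t_i$, subject to the above relations of $\widetilde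 W$, the centrality of $z$, the relations $$\tilde x_i\tilde x_j=z\tilde x_j\tilde x_i,\quad \tilde y_i\tilde y_j=\tilde y_j\tilde y_i\qquad(i\ne j),$$ $$\tilde t_k\tilde x_j=z\tilde x_j\tilde t_k,\quad \tilde t_k\tilde y_j=\tilde y_j\tilde t_k\quad(j\ne k,k+1),\qquad \tilde t_k\tilde x_{k+1}=z\tilde x_k\tilde t_k,\quad \tilde t_k\tilde y_{k+1}=\tilde y_k\tilde t_k\qquad(1\le k\le n-1),$$ and the following ones, where $[a,b]=ab-ba$. * Type $A_{n-1}$: $[\tilde y_j,\tilde x_i]=uz\{i,j\}$ for $j\ne i$, and $[\tilde y_i,\tilde x_i]=-uz\sum_{k\ne i}\{i,k\}$. * Type $D_n$: $\tilde t_n\tilde x_j=z\tilde x_j\tilde t_n$ and $\tilde t_n\tilde y_j=\tilde y_j\tilde t_n$ for $j\ne n-1,n$; $\tilde t_n\tilde x_n=-\tilde x_{n-1}\tilde t_n$ and $\tilde t_n\tilde y_n=-\tilde y_{n-1}\tilde t_n$; $[\tilde y_j,\tilde x_i]=uz\big(\{i,j\}-\overline{\{i,j\}}\big)$ for $j\ne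 i$; $[\tilde y_i,\tilde x_i]=-uz\sum_{k\ne i}\big(\{i,k\}+\overline{\{i,k\}}\big)$. * Type $B_n$: $\tilde t_n\tilde x_j=z\tilde x_j\tilde t_n$ and $\tilde t_n\tilde y_j=\tilde y_j\tilde t_n$ for $j\ne n$; $\tilde t_n\tilde x_n=-\tilde x_n\tilde t_n$ and $\tilde t_n\tilde y_n=-\tilde y_n\tilde t_n$; $[\tilde y_j,\tilde x_i]=uz\big(\{i,j\}-\overline{\{i,j\}}\big)$ for $j\ne i$; $[\tilde y_i,\tilde x_i]=-uz\sum_{k\ne i}\big(\{i,k\}+\overline{\{i,k\}}\big)-vz\{i\}$. **Theorem.** Let $W=W_{A_{n-1}}$, $W_{D_n}$ or $W_{B_n}$, with any parameters $u,v\in\mathbb C$ ($v$ only in type $B_n$). Then the elements $$\tilde x^{\alpha}\,\tilde w\,\tilde y^{\gamma},\qquad \alpha,\gamma\in\mathbb Z_{\ge0}^n,\ \tilde w\in\widetilde W,$$ where $\tilde x^\alpha=\tilde x_1^{\alpha_1}\cdots\tilde x_n^{\alpha_n}$, $\tilde y^\gamma=\tilde y_1^{\gamma_1}\cdots\tilde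 y_n^{\gamma_n}$, and $\tilde w$ stands for its image under the canonical homomorphism from $\widetilde W$ to $\mathfrak H_W$, form a basis of the complex vector space $\mathfrak H_W$ (the elements with distinct $(\alpha,\tilde w,\gamma)$ being distinct). -/

import Mathlib

namespace CDaHa

/-- The classical types; `A` with parameter `n` below stands for `A_{n-1}`. -/
inductive ClassicalType
  | A | B | D

/-- The number of simple reflections of `W_{A_{n-1}}`, `W_{B_n}`, `W_{D_n}`. -/
def rank : ClassicalType → ℕ → ℕ
  | .A, n => n - 1
  | .B, n => n
  | .D, n => n

/-- The Coxeter integers `m_{ij}`. Nodes are numbered from `0`, so the last node of `B_n` and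
`D_n` is `n - 1`. In type `B` it is joined to `n - 2` by an edge marked `4`; in type `D` it is
joined to `n - 3` only. (Mathlib's `CoxeterMatrix.D` also joins the nodes `n - 2` and `n - 1`,
hence is not the matrix of type `D`.) -/
def coxeterInt : ClassicalType → ℕ → ℕ → ℕ → ℕ
  | .A, _, i, j =>
      if i = j then 1 else if i + 1 = j ∨ j + 1 = i then 3 else 2
  | .B, n, i, j =>
      if i = j then 1
      else if (i + 1 = n ∧ j + 2 = n) ∨ (j + 1 = n ∧ i + 2 = n) then 4
      else if i + 1 = j ∨ j + 1 = i then 3 else 2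
  | .D, n, i, j =>
      if i = j then 1
      else if i + 1 = n ∨ j + 1 = n then (if i + 3 = n ∨ j + 3 = n then 3 else 2)
      else if i + 1 = j ∨ j + 1 = i then 3 else 2

/-- The defining relations of the double cover of `W`, imposed on elements `z`, `t_i` of a
monoid: `z` is central with square `1`, `t_i² = 1`, and for `i`, `j` with `m_{ij} = 2, 3, 4`,
respectively, `t_i t_j = z t_j t_i`, `t_i t_j t_i = t_j t_i t_j`,
`(t_i t_j)² = z (t_j t_i)²`. -/
inductive CoverRel (X : ClassicalType) (n : ℕ) {G : Type*} [Monoid G] (z : G)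
    (t : Fin (rank X n) → G) : G → G → Prop
  | z_sq : CoverRel X n z t (z * z) 1
  | z_central (i : Fin (rank X n)) : CoverRel X n z t (z * t i) (t i * z)
  | t_sq (i : Fin (rank X n)) : CoverRel X n z t (t i * t i) 1
  | two (i j : Fin (rank X n)) (h : coxeterInt X n i j = 2) :
      CoverRel X n z t (t i * t j) (z * (t j * t i))
  | three (i j : Fin (rank X n)) (h : coxeterInt X n i j = 3) :
      CoverRel X n z t (t i * t j * t i) (t j * t i * t j)
  | four (i j : Fin (rank X n)) (h : coxeterInt X n i j = 4) :
      CoverRel X n z t ((t i * t j) ^ 2) (z * (t j * t i) ^ 2)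

/-- The generators of the double cover. -/
inductive CoverGen (X : ClassicalType) (n : ℕ)
  | z : CoverGen X n
  | t (i : Fin (rank X n)) : CoverGen X n

/-- The double cover `W̃` of the Weyl group `W`, by generators and relations. -/
abbrev CoverGroup (X : ClassicalType) (n : ℕ) : Type :=
  PresentedGroup {r : FreeGroup (CoverGen X n) | ∃ a b,
    CoverRel X n (FreeGroup.of CoverGen.z) (fun i => FreeGroup.of (CoverGen.t i)) a b ∧
      r = a * b⁻¹}

theorem CoverRel.map {X : ClassicalType} {n : ℕ} {G H : Type*} [Monoid G] [Monoid H]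
    (f : G →* H) {z : G} {t : Fin (rank X n) → G} {a b : G} (h : CoverRel X n z t a b) :
    CoverRel X n (f z) (fun i => f (t i)) (f a) (f b) := by
  cases h with
  | z_sq => simpa using CoverRel.z_sq (X := X) (n := n) (z := f z) (t := fun i => f (t i))
  | z_central i => simpa using CoverRel.z_central (z := f z) (t := fun i => f (t i)) i
  | t_sq i => simpa using CoverRel.t_sq (z := f z) (t := fun i => f (t i)) i
  | two i j h => simpa using CoverRel.two (z := f z) (t := fun i => f (t i)) i j h
  | three i j h => simpa using CoverRel.three (z := f z) (t := fun i => f (t i)) i j h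
  | four i j h => simpa using CoverRel.four (z := f z) (t := fun i => f (t i)) i j h

/-- The unit given by an element of square `1`. -/
def unitOfSq {H : Type*} [Monoid H] (a : H) (h : a * a = 1) : Hˣ := ⟨a, a, h, h⟩

/-- The images of the generators, as units, under an assignment that respects the relations. -/
def genUnit {X : ClassicalType} {n : ℕ} {H : Type*} [Monoid H] (z : H)
    (t : Fin (rank X n) → H) (h : ∀ a b, CoverRel X n z t a b → a = b) : CoverGen X n → Hˣ
  | .z => unitOfSq z (h _ _ CoverRel.z_sq)
  | .t i => unitOfSq (t i) (h _ _ (CoverRel.t_sq i))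

/-- Elements `z`, `t_i` of a monoid that satisfy the defining relations of `W̃` determine the
homomorphism from `W̃` that sends the generators to them. -/
def CoverGroup.lift {X : ClassicalType} {n : ℕ} {H : Type*} [Monoid H] (z : H)
    (t : Fin (rank X n) → H) (h : ∀ a b, CoverRel X n z t a b → a = b) :
    CoverGroup X n →* H :=
  (Units.coeHom H).comp (PresentedGroup.toGroup (f := genUnit z t h) (by
    rintro r ⟨a, b, hab, rfl⟩
    rw [map_mul, map_inv, mul_inv_eq_one]
    apply Units.ext
    have h1 := hab.map ((Units.coeHom H).comp (FreeGroup.lift (genUnit z t h)))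
    exact h _ _ (by simpa [genUnit, unitOfSq] using h1)))

theorem CoverGroup.lift_z {X : ClassicalType} {n : ℕ} {H : Type*} [Monoid H] (z : H)
    (t : Fin (rank X n) → H) (h : ∀ a b, CoverRel X n z t a b → a = b) :
    CoverGroup.lift z t h (PresentedGroup.of CoverGen.z) = z := by
  simp [CoverGroup.lift, genUnit, unitOfSq]

theorem CoverGroup.lift_t {X : ClassicalType} {n : ℕ} {H : Type*} [Monoid H] (z : H)
    (t : Fin (rank X n) → H) (h : ∀ a b, CoverRel X n z t a b → a = b)
    (i : Fin (rank X n)) :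
    CoverGroup.lift z t h (PresentedGroup.of (CoverGen.t i)) = t i := by
  simp [CoverGroup.lift, genUnit, unitOfSq]

section Reflections

variable {G : Type*} [Monoid G]

/-- `t_a t_{a+1} ⋯ t_{b-1}`, equal to `1` if `b ≤ a`. -/
def asc (t : ℕ → G) (a b : ℕ) : G := ((List.Ico a b).map t).prod

/-- `t_{b-1} ⋯ t_{a+1} t_a`, equal to `1` if `b ≤ a`. -/
def desc (t : ℕ → G) (a b : ℕ) : G := ((List.Ico a b).reverse.map t).prod

/-- `{i,j} = z^{j-i-1} t_{j-1} ⋯ t_{i+1} t_i t_{i+1} ⋯ t_{j-1}` for `i < j`,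
and `{j,i} = z {i,j}`. -/
def refl (z : G) (t : ℕ → G) (i j : ℕ) : G :=
  if i < j then z ^ (j - i - 1) * (desc t (i + 1) j * t i * asc t (i + 1) j)
  else z * (z ^ (i - j - 1) * (desc t (j + 1) i * t j * asc t (j + 1) i))

/-- The overlined element for type `D_n` and `i < j`. In the numbering from `1` it is
`z^{j-i-1} (t_j ⋯ t_{n-1}) (t_i ⋯ t_{n-2}) t_n (t_{n-2} ⋯ t_i) (t_{n-1} ⋯ t_j)`; here all
indices are shifted by one. -/
def barReflDLt (n : ℕ) (z : G) (t : ℕ → G) (i j : ℕ) : G :=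
  z ^ (j - i - 1) * (asc t j (n - 1) * asc t i (n - 2) * t (n - 1)
    * desc t i (n - 2) * desc t j (n - 1))

/-- The overlined element for type `B_n` and `i < j`. In the numbering from `1` it is
`z^{j-i} (t_j ⋯ t_{n-1}) (t_i ⋯ t_{n-2}) t_n t_{n-1} t_n (t_{n-2} ⋯ t_i) (t_{n-1} ⋯ t_j)`;
here all indices are shifted by one. -/
def barReflBLt (n : ℕ) (z : G) (t : ℕ → G) (i j : ℕ) : G :=
  z ^ (j - i) * (asc t j (n - 1) * asc t i (n - 2) * (t (n - 1) * t (n - 2) * t (n - 1))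
    * desc t i (n - 2) * desc t j (n - 1))

/-- The overlined elements for type `D_n`, symmetric in `i`, `j`. -/
def barReflD (n : ℕ) (z : G) (t : ℕ → G) (i j : ℕ) : G :=
  barReflDLt n z t (min i j) (max i j)

/-- The overlined elements for type `B_n`, symmetric in `i`, `j`. -/
def barReflB (n : ℕ) (z : G) (t : ℕ → G) (i j : ℕ) : G :=
  barReflBLt n z t (min i j) (max i j)

/-- `{i} = z^{n-i} t_i ⋯ t_{n-1} t_n t_{n-1} ⋯ t_i` in the numbering from `1`. -/
def signChange (n : ℕ) (z : G) (t : ℕ → G) (i : ℕ) : G :=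
  z ^ (n - 1 - i) * (asc t i (n - 1) * t (n - 1) * desc t i (n - 1))

end Reflections

/-- The generators of the covering double affine Hecke algebra. -/
inductive Gen (X : ClassicalType) (n : ℕ)
  | x (i : Fin n) : Gen X n
  | y (i : Fin n) : Gen X n
  | z : Gen X n
  | t (i : Fin (rank X n)) : Gen X n

/-- The free algebra on the generators. -/
abbrev Free (X : ClassicalType) (n : ℕ) : Type := FreeAlgebra ℂ (Gen X n)

section Relations

variable (X : ClassicalType) (n : ℕ)

/-- The generator `x_i`. -/
def gx (i : Fin n) : Free X n := FreeAlgebra.ι ℂ (Gen.x i)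

/-- The generator `y_i`. -/
def gy (i : Fin n) : Free X n := FreeAlgebra.ι ℂ (Gen.y i)

/-- The generator `z`. -/
def gz : Free X n := FreeAlgebra.ι ℂ Gen.z

/-- The generator `t_i`. -/
def gt (i : Fin (rank X n)) : Free X n := FreeAlgebra.ι ℂ (Gen.t i)

/-- The generators `t_i` indexed by natural numbers, for use in words. The value outside the
range of indices is immaterial: no word below uses it. -/
def gtNat (i : ℕ) : Free X n := if h : i < rank X n then gt X n ⟨i, h⟩ else 1

/-- The relations that the three types have in common: those of the double cover, the
centrality of `z`, the relations among the `x_i`, among the `y_i`, and those of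
`x_j`, `y_j` with the `t_k` that come from the transpositions `(k, k+1)`. -/
inductive CommonRel : Free X n → Free X n → Prop
  | cover {a b : Free X n} (h : CoverRel X n (gz X n) (gt X n) a b) : CommonRel a b
  | z_x (i : Fin n) : CommonRel (gz X n * gx X n i) (gx X n i * gz X n)
  | z_y (i : Fin n) : CommonRel (gz X n * gy X n i) (gy X n i * gz X n)
  | x_x (i j : Fin n) (h : i ≠ j) :
      CommonRel (gx X n i * gx X n j) (gz X n * gx X n j * gx X n i)
  | y_y (i j : Fin n) (h : i ≠ j) :
      CommonRel (gy X n i * gy X n j) (gy X n j * gy X n i)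
  | t_x_far (k : Fin (rank X n)) (hk : (k : ℕ) + 1 < n) (j : Fin n)
      (h : (j : ℕ) ≠ k) (h' : (j : ℕ) ≠ k + 1) :
      CommonRel (gt X n k * gx X n j) (gz X n * gx X n j * gt X n k)
  | t_y_far (k : Fin (rank X n)) (hk : (k : ℕ) + 1 < n) (j : Fin n)
      (h : (j : ℕ) ≠ k) (h' : (j : ℕ) ≠ k + 1) :
      CommonRel (gt X n k * gy X n j) (gy X n j * gt X n k)
  | t_x_near (k : Fin (rank X n)) (i j : Fin n) (hi : (i : ℕ) = k) (hj : (j : ℕ) = k + 1) :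
      CommonRel (gt X n k * gx X n j) (gz X n * gx X n i * gt X n k)
  | t_y_near (k : Fin (rank X n)) (i j : Fin n) (hi : (i : ℕ) = k) (hj : (j : ℕ) = k + 1) :
      CommonRel (gt X n k * gy X n j) (gy X n i * gt X n k)

end Relations

/-- The defining relations in type `A_{n-1}`. -/
inductive RelA (n : ℕ) (u : ℂ) : Free .A n → Free .A n → Prop
  | common {a b : Free .A n} (h : CommonRel .A n a b) : RelA n u a b
  | y_x_ne (i j : Fin n) (h : j ≠ i) :
      RelA n u (gy .A n j * gx .A n i - gx .A n i * gy .A n j)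
        (u • (gz .A n * refl (gz .A n) (gtNat .A n) i j))
  | y_x_eq (i : Fin n) :
      RelA n u (gy .A n i * gx .A n i - gx .A n i * gy .A n i)
        (-(u • (gz .A n * ∑ k ∈ Finset.univ.erase i, refl (gz .A n) (gtNat .A n) i k)))

/-- The defining relations in type `D_n`. -/
inductive RelD (n : ℕ) (u : ℂ) : Free .D n → Free .D n → Prop
  | common {a b : Free .D n} (h : CommonRel .D n a b) : RelD n u a b
  | t_x_far (k : Fin (rank .D n)) (hk : (k : ℕ) + 1 = n) (j : Fin n)
      (h : (j : ℕ) + 1 ≠ n) (h' : (j : ℕ) + 2 ≠ n) :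
      RelD n u (gt .D n k * gx .D n j) (gz .D n * gx .D n j * gt .D n k)
  | t_y_far (k : Fin (rank .D n)) (hk : (k : ℕ) + 1 = n) (j : Fin n)
      (h : (j : ℕ) + 1 ≠ n) (h' : (j : ℕ) + 2 ≠ n) :
      RelD n u (gt .D n k * gy .D n j) (gy .D n j * gt .D n k)
  | t_x_last (k : Fin (rank .D n)) (hk : (k : ℕ) + 1 = n) (i j : Fin n)
      (hi : (i : ℕ) + 2 = n) (hj : (j : ℕ) + 1 = n) :
      RelD n u (gt .D n k * gx .D n j) (-(gx .D n i * gt .D n k))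
  | t_y_last (k : Fin (rank .D n)) (hk : (k : ℕ) + 1 = n) (i j : Fin n)
      (hi : (i : ℕ) + 2 = n) (hj : (j : ℕ) + 1 = n) :
      RelD n u (gt .D n k * gy .D n j) (-(gy .D n i * gt .D n k))
  | y_x_ne (i j : Fin n) (h : j ≠ i) :
      RelD n u (gy .D n j * gx .D n i - gx .D n i * gy .D n j)
        (u • (gz .D n * (refl (gz .D n) (gtNat .D n) i j
          - barReflD n (gz .D n) (gtNat .D n) i j)))
  | y_x_eq (i : Fin n) :
      RelD n u (gy .D n i * gx .D n i - gx .D n i * gy .D n i)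
        (-(u • (gz .D n * ∑ k ∈ Finset.univ.erase i, (refl (gz .D n) (gtNat .D n) i k
          + barReflD n (gz .D n) (gtNat .D n) i k))))

/-- The defining relations in type `B_n`. -/
inductive RelB (n : ℕ) (u v : ℂ) : Free .B n → Free .B n → Prop
  | common {a b : Free .B n} (h : CommonRel .B n a b) : RelB n u v a b
  | t_x_far (k : Fin (rank .B n)) (hk : (k : ℕ) + 1 = n) (j : Fin n)
      (h : (j : ℕ) + 1 ≠ n) :
      RelB n u v (gt .B n k * gx .B n j) (gz .B n * gx .B n j * gt .B n k)
  | t_y_far (k : Fin (rank .B n)) (hk : (k : ℕ) + 1 = n) (j : Fin n)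
      (h : (j : ℕ) + 1 ≠ n) :
      RelB n u v (gt .B n k * gy .B n j) (gy .B n j * gt .B n k)
  | t_x_last (k : Fin (rank .B n)) (hk : (k : ℕ) + 1 = n) (j : Fin n)
      (hj : (j : ℕ) + 1 = n) :
      RelB n u v (gt .B n k * gx .B n j) (-(gx .B n j * gt .B n k))
  | t_y_last (k : Fin (rank .B n)) (hk : (k : ℕ) + 1 = n) (j : Fin n)
      (hj : (j : ℕ) + 1 = n) :
      RelB n u v (gt .B n k * gy .B n j) (-(gy .B n j * gt .B n k))
  | y_x_ne (i j : Fin n) (h : j ≠ i) :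
      RelB n u v (gy .B n j * gx .B n i - gx .B n i * gy .B n j)
        (u • (gz .B n * (refl (gz .B n) (gtNat .B n) i j
          - barReflB n (gz .B n) (gtNat .B n) i j)))
  | y_x_eq (i : Fin n) :
      RelB n u v (gy .B n i * gx .B n i - gx .B n i * gy .B n i)
        (-(u • (gz .B n * ∑ k ∈ Finset.univ.erase i, (refl (gz .B n) (gtNat .B n) i k
          + barReflB n (gz .B n) (gtNat .B n) i k)))
          - v • (gz .B n * signChange n (gz .B n) (gtNat .B n) i))

/-- The rational covering double affine Hecke algebra of type `A_{n-1}`. -/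
abbrev AlgA (n : ℕ) (u : ℂ) : Type := RingQuot (RelA n u)

/-- The rational covering double affine Hecke algebra of type `D_n`. -/
abbrev AlgD (n : ℕ) (u : ℂ) : Type := RingQuot (RelD n u)

/-- The rational covering double affine Hecke algebra of type `B_n`. -/
abbrev AlgB (n : ℕ) (u v : ℂ) : Type := RingQuot (RelB n u v)

section Monomials

variable {X : ClassicalType} {n : ℕ} (r : Free X n → Free X n → Prop)

/-- The canonical homomorphism `W̃ → H`, `z ↦ z`, `t_i ↦ t_i`, to an algebra `H` presented by
relations `r` that include the common ones. -/
noncomputable def ofCover (h : ∀ a b, CommonRel X n a b → r a b) :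
    CoverGroup X n →* RingQuot r :=
  CoverGroup.lift (RingQuot.mkAlgHom ℂ r (gz X n)) (fun i => RingQuot.mkAlgHom ℂ r (gt X n i))
    (by
      have key : ∀ {a b : Free X n}, CoverRel X n (gz X n) (gt X n) a b →
          RingQuot.mkAlgHom ℂ r a = RingQuot.mkAlgHom ℂ r b := fun hab =>
        RingQuot.mkAlgHom_rel ℂ (h _ _ (CommonRel.cover hab))
      intro a b hab
      cases hab with
      | z_sq => simpa using key CoverRel.z_sq
      | z_central i => simpa using key (CoverRel.z_central i)
      | t_sq i => simpa using key (CoverRel.t_sq i)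
      | two i j h => simpa using key (CoverRel.two i j h)
      | three i j h => simpa using key (CoverRel.three i j h)
      | four i j h => simpa using key (CoverRel.four i j h))

/-- `x^α = x_1^{α_1} x_2^{α_2} ⋯ x_n^{α_n}`, in this order, in the algebra presented by `r`. -/
noncomputable def xPow (α : Fin n → ℕ) : RingQuot r :=
  (List.ofFn fun i => RingQuot.mkAlgHom ℂ r (gx X n i) ^ α i).prod

/-- `y^γ = y_1^{γ_1} y_2^{γ_2} ⋯ y_n^{γ_n}` in the algebra presented by `r`. -/
noncomputable def yPow (γ : Fin n → ℕ) : RingQuot r :=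
  (List.ofFn fun i => RingQuot.mkAlgHom ℂ r (gy X n i) ^ γ i).prod

/-- The element `x^α w y^γ`. -/
noncomputable def pbw (h : ∀ a b, CommonRel X n a b → r a b) (α : Fin n → ℕ)
    (w : CoverGroup X n) (γ : Fin n → ℕ) : RingQuot r :=
  xPow r α * ofCover r h w * yPow r γ

end Monomials

/-- The elements `x^α w y^γ` in type `A_{n-1}`. -/
noncomputable def pbwA (n : ℕ) (u : ℂ) (α : Fin n → ℕ) (w : CoverGroup .A n)
    (γ : Fin n → ℕ) : AlgA n u :=
  pbw (RelA n u) (fun _ _ h => .common h) α w γ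

/-- The elements `x^α w y^γ` in type `D_n`. -/
noncomputable def pbwD (n : ℕ) (u : ℂ) (α : Fin n → ℕ) (w : CoverGroup .D n)
    (γ : Fin n → ℕ) : AlgD n u :=
  pbw (RelD n u) (fun _ _ h => .common h) α w γ

/-- The elements `x^α w y^γ` in type `B_n`. -/
noncomputable def pbwB (n : ℕ) (u v : ℂ) (α : Fin n → ℕ) (w : CoverGroup .B n)
    (γ : Fin n → ℕ) : AlgB n u v :=
  pbw (RelB n u v) (fun _ _ h => .common h) α w γ

end CDaHa

/-! This is a Poincaré–Birkhoff–Witt theorem. Write G for the double cover. The monomials span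
because left multiplication by each generator preserves their span: an x_i is moved into place at
the cost of a power of z, a group element passes the x's up to a scalar and a power of z, and a y_i
passes an x_k at the cost of a commutator that is a combination of group elements
(`Model.monomialSpan_eq_top`).

Linear independence needs a representation on which the monomials act independently
(`ReflectionDatum.exists_model`). Start from ℂ[G] ⊗ ℂ[y] with its evident action of G and the y_i,
and induce to ℂ⟨x⟩ ⊗ ℂ[G] ⊗ ℂ[y], where y_i x_k = x_k y_i + [y_i, x_k], with the prescribed value of
the commutator, serves as a recursive definition of y_i. Three identities make the relations hold
and let the action descend modulo x_k x_l - z x_l x_k: the commutators are G-equivariant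
(`conj_comm`), they satisfy the Jacobi identity for y_i, y_j, x_k (`comm_y`), and y_i commutes with
x_k x_l - z x_l x_k (`comm_x`). The quotient maps to skew polynomials in x with coefficients in ℂ[G]
⊗ ℂ[y], and each monomial applied to 1 goes to a different basis vector. The order of G plays no
role: G is a basis of its own group algebra, whatever the relations of the cover imply.

The identities rest on one fact, axiomatised in `ReflectionDatum`: conjugation by g permutes the
lifted reflections {i,j}, overlined {i,j} and {i} as g permutes e_i - e_j, e_i + e_j and e_i, up to
an explicit power of z. By multiplicativity only g = t_k matters, that is, the map h ↦ z t_k h t_k.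
The relations of the double cover make the t_k behave under these maps like simple roots under
simple reflections, with z in the role of -1. The other words arise from the t_k by such maps, so
their behaviour follows formally from the braid relations; `PairFamily`, `ForkFamily` and
`QuartFamily` do this for types A, D and B.

Finally, a homomorphism from the free algebra respects the relations exactly when it yields a model
(`Presents`). Applied to the algebra itself this gives spanning, applied to the endomorphisms of the
constructed module it gives independence. -/

namespace CDaHa

/-! ### Formal root combinatorics of types A and D -/

/-- Maps `f k` and elements `e k`, for `k < N`, which satisfy the relations of the simple
reflections and the simple roots of type `A_N`. -/
structure PathSystem {V : Type*} (neg : V → V) (N : ℕ) (f : ℕ → V → V) (e : ℕ → V) :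
    Prop where
  invol : ∀ k < N, ∀ v, f k (f k v) = v
  comm : ∀ k l, k + 1 < l → l < N → ∀ v, f k (f l v) = f l (f k v)
  braid : ∀ k, k + 1 < N → ∀ v, f k (f (k + 1) (f k v)) = f (k + 1) (f k (f (k + 1) v))
  apply_far : ∀ k l, k + 1 < l → l < N → f k (e l) = e l
  apply_far' : ∀ k l, k + 1 < l → l < N → f l (e k) = e k
  apply_near : ∀ k, k + 1 < N → f k (e (k + 1)) = f (k + 1) (e k)
  apply_self : ∀ k < N, f k (e k) = neg (e k)

/-- A family of elements indexed by pairs `i < j ≤ N`, which the maps `f k` permute as the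
transpositions `(k, k+1)` permute pairs. -/
structure PairFamily {V : Type*} (neg : V → V) (N : ℕ) (f : ℕ → V → V) (r : ℕ → ℕ → V) :
    Prop where
  below : ∀ k i j, k + 1 < i → i < j → j ≤ N → f k (r i j) = r i j
  mid : ∀ k i j, i < k → k + 1 < j → j ≤ N → f k (r i j) = r i j
  above : ∀ k i j, i < j → j < k → k < N → f k (r i j) = r i j
  left : ∀ i j, i + 1 < j → j ≤ N → f i (r i j) = r (i + 1) j
  left' : ∀ i j, i + 1 < j → j ≤ N → f i (r (i + 1) j) = r i j
  right : ∀ i j, i < j → j < N → f j (r i j) = r i (j + 1)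
  right' : ∀ i j, i < j → j < N → f j (r i (j + 1)) = r i j
  self : ∀ i, i < N → f i (r i (i + 1)) = neg (r i (i + 1))

section

variable {V : Type*} {neg : V → V} {N : ℕ} {f : ℕ → V → V} {e : ℕ → V}

/-- The family of the elements `e_i - e_j`. -/
theorem PathSystem.pairFamily (h : PathSystem neg N f e) {r : ℕ → ℕ → V}
    (h0 : ∀ i, i < N → r i (i + 1) = e i)
    (h1 : ∀ i j, i < j → j < N → r i (j + 1) = f j (r i j)) : PairFamily neg N f r := by
  have below : ∀ k i j, k + 1 < i → i < j → j ≤ N → f k (r i j) = r i j := by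
    intro k i j hk hij hj
    induction j, hij using Nat.le_induction with
    | base => rw [h0 _ (by omega), h.apply_far _ _ hk (by omega)]
    | succ j hij ih =>
      have hij : i < j := hij
      rw [h1 _ _ hij (by omega), h.comm _ _ (by omega) (by omega), ih (by omega)]
  have above : ∀ k i j, i < j → j < k → k < N → f k (r i j) = r i j := by
    intro k i j hij hj hk
    induction j, hij using Nat.le_induction with
    | base => rw [h0 _ (by omega), h.apply_far' _ _ (by omega) (by omega)]
    | succ j hij ih =>
      have hij : i < j := hij
      rw [h1 _ _ hij (by omega), ← h.comm _ _ (by omega) (by omega), ih (by omega)]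
  have mid : ∀ k i j, i < k → k + 1 < j → j ≤ N → f k (r i j) = r i j := by
    intro k i j hik hkj hj
    induction j, hkj using Nat.le_induction with
    | base =>
      -- Here `r i (k + 2)` is `f (k + 1) (f k (r i k))`. After the braid relation, the innermost
      -- map is `f (k + 1)`, which fixes `r i k`.
      rw [h1 _ _ (by omega) (by omega), h1 _ _ (by omega) (by omega), h.braid _ (by omega),
        above _ _ _ hik (by omega) (by omega)]
    | succ j hij ih =>
      have hij : k + 1 < j := hij
      rw [h1 _ _ (by omega) (by omega), h.comm _ _ (by omega) (by omega), ih (by omega)]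
  have left : ∀ i j, i + 1 < j → j ≤ N → f i (r i j) = r (i + 1) j := by
    intro i j hij hj
    induction j, hij using Nat.le_induction with
    | base =>
      rw [h1 _ _ (by omega) (by omega), h0 _ (by omega), ← h.apply_near _ (by omega),
        h.invol _ (by omega), h0 _ (by omega)]
    | succ j hij ih =>
      have hij : i + 1 < j := hij
      rw [h1 _ _ (by omega) (by omega), h.comm _ _ (by omega) (by omega), ih (by omega),
        h1 _ _ (by omega) (by omega)]
  refine ⟨below, mid, above, left, ?_, fun i j hij hj => (h1 i j hij hj).symm, ?_, ?_⟩
  · intro i j hij hj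
    rw [← left i j hij hj, h.invol _ (by omega)]
  · intro i j hij hj
    rw [h1 _ _ hij hj, h.invol _ hj]
  · intro i hi
    rw [h0 i hi, h.apply_self i hi]

/-- A pair of systems of type `A_N` which differ in the last member only, with commuting last
members: a system of type `D_{N+1}`. -/
structure ForkSystem (neg : V → V) (N : ℕ) (f f' : ℕ → V → V) (e e' : ℕ → V) : Prop where
  path : PathSystem neg N f e
  path' : PathSystem neg N f' e'
  f_eq : ∀ k, k + 1 < N → f' k = f k
  e_eq : ∀ k, k + 1 < N → e' k = e k
  last_comm : ∀ k, k + 1 = N → ∀ v, f k (f' k v) = f' k (f k v)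
  last_apply : ∀ k, k + 1 = N → f k (e' k) = e' k
  last_apply' : ∀ k, k + 1 = N → f' k (e k) = e k

variable {f' : ℕ → V → V} {e' : ℕ → V} {r r' b : ℕ → ℕ → V}

/-- Elements `e_i - e_j`, their counterparts for the second system, and `e_i + e_j`. -/
structure ForkFamily (N : ℕ) (f f' : ℕ → V → V) (e e' : ℕ → V) (r r' b : ℕ → ℕ → V) :
    Prop where
  r_base : ∀ i, i < N → r i (i + 1) = e i
  r_step : ∀ i j, i < j → j < N → r i (j + 1) = f j (r i j)
  r'_base : ∀ i, i < N → r' i (i + 1) = e' i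
  r'_step : ∀ i j, i < j → j < N → r' i (j + 1) = f' j (r' i j)
  b_last : ∀ i, i + 1 = N → b i N = e' i
  b_left : ∀ i, i + 1 < N → b i N = f i (b (i + 1) N)
  b_right : ∀ i j, i < j → j < N → b i j = f j (b i (j + 1))

namespace ForkFamily

theorem r'_eq (h : ForkSystem neg N f f' e e') (hr : ForkFamily N f f' e e' r r' b)
    (i j : ℕ) (hij : i < j) (hj : j < N) : r' i j = r i j := by
  induction j, hij using Nat.le_induction with
  | base => rw [hr.r_base _ (by omega), hr.r'_base _ (by omega), h.e_eq _ hj]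
  | succ j hij ih =>
    have hij : i < j := hij
    rw [hr.r_step _ _ hij (by omega), hr.r'_step _ _ hij (by omega), ih (by omega), h.f_eq _ hj]

/-- The second path describes the same roots with the sign of the last coordinate reversed, so its
e_i - e_N is e_i + e_N. This anchors the family `b` in a system of type A, from which its other
members are reached by descending induction on the second index. -/
theorem b_eq (h : ForkSystem neg N f f' e e') (hr : ForkFamily N f f' e e' r r' b)
    (i : ℕ) (hi : i < N) : b i N = r' i N := by
  have hp := h.path'.pairFamily hr.r'_base hr.r'_step
  obtain ⟨d, hd⟩ : ∃ d, i + 1 + d = N := ⟨N - (i + 1), by omega⟩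
  induction d generalizing i with
  | zero =>
    rw [hr.b_last i (by omega)]
    obtain rfl : N = i + 1 := by omega
    rw [hr.r'_base i hi]
  | succ d ih =>
    rw [hr.b_left i (by omega), ih (i + 1) (by omega) (by omega),
      ← hp.left' i N (by omega) le_rfl, h.f_eq _ (by omega)]

/-- The family of the elements `e_i + e_j`. -/
theorem pairFamily_b (h : ForkSystem neg N f f' e e') (hr : ForkFamily N f f' e e' r r' b) :
    PairFamily id N f b := by
  have hp := h.path'.pairFamily hr.r'_base hr.r'_step
  have hb := hr.b_eq h
  have below : ∀ k i j, k + 1 < i → i < j → j ≤ N → f k (b i j) = b i j := by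
    intro k i j hk hij hj
    induction hj using Nat.decreasingInduction with
    | self => rw [hb _ hij, ← h.f_eq k (by omega), hp.below _ _ _ hk hij le_rfl]
    | of_succ j hj ih =>
      rw [hr.b_right _ _ hij hj, h.path.comm _ _ (by omega) hj, ih (by omega)]
  have mid : ∀ k i j, i < k → k + 1 < j → j ≤ N → f k (b i j) = b i j := by
    intro k i j hik hkj hj
    induction hj using Nat.decreasingInduction with
    | self => rw [hb _ (by omega), ← h.f_eq k (by omega), hp.mid _ _ _ hik hkj le_rfl]
    | of_succ j hj ih =>
      rw [hr.b_right _ _ (by omega) hj, h.path.comm _ _ (by omega) hj, ih (by omega)]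
  have left : ∀ i j, i + 1 < j → j ≤ N → f i (b i j) = b (i + 1) j := by
    intro i j hij hj
    induction hj using Nat.decreasingInduction with
    | self => rw [hb _ (by omega), ← h.f_eq i (by omega), hp.left _ _ hij le_rfl, hb _ (by omega)]
    | of_succ j hj ih =>
      rw [hr.b_right _ _ (by omega) hj, h.path.comm _ _ (by omega) hj, ih (by omega),
        ← hr.b_right _ _ (by omega) hj]
  have above : ∀ k i j, i < j → j < k → k < N → f k (b i j) = b i j := by
    intro k i j hij hj hk
    obtain ⟨d, rfl⟩ : ∃ d, k = j + 1 + d := ⟨k - (j + 1), by omega⟩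
    induction d generalizing j with
    | zero =>
      -- `b i j` is `f j (f (j + 1) (b i (j + 2)))`; the braid relation brings `f j` next to `b i (j
      -- + 2)`, which it fixes by `mid`.
      rw [hr.b_right i j hij (by omega), hr.b_right i (j + 1) (by omega) (by omega)]
      change f (j + 1) (f j (f (j + 1) _)) = _
      rw [← h.path.braid _ (by omega), mid j i (j + 1 + 1) hij (by omega) (by omega)]
    | succ d ih =>
      rw [hr.b_right i j hij (by omega), ← h.path.comm _ _ (by omega) hk]
      have := ih (j + 1) (by omega) (by omega) (by omega)
      rw [show j + 1 + 1 + d = j + 1 + (d + 1) by omega] at this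
      rw [this]
  refine ⟨below, mid, above, left, ?_, ?_, fun i j hij hj => (hr.b_right i j hij hj).symm, ?_⟩
  · intro i j hij hj
    rw [← left i j hij hj, h.path.invol _ (by omega)]
  · intro i j hij hj
    rw [hr.b_right i j hij hj, h.path.invol _ hj]
  · intro i hi
    obtain ⟨d, hd⟩ : ∃ d, i + 1 + d = N := ⟨N - (i + 1), by omega⟩
    induction d generalizing i with
    | zero =>
      -- The last pair is the second end node of the fork, which is orthogonal to the first.
      obtain rfl : i + 1 = N := hd
      rw [hr.b_last i rfl, h.last_apply _ rfl, id]
    | succ d ih =>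
      -- The braid relation turns the claim for `i` into the claim for `i + 1`.
      have h1 : b i (i + 1) = f (i + 1) (f i (b (i + 1) (i + 1 + 1))) := by
        rw [hr.b_right i (i + 1) (by omega) (by omega), ← left i (i + 1 + 1) (by omega) (by omega),
          h.path.invol _ hi]
      have := ih (i + 1) (by omega) (by omega)
      rw [h1, h.path.braid _ (by omega), this, id, id]

variable {m : ℕ}

/-- This lemma and the seven that follow compute `f' m`, the reflection in e_m + e_{m+1}. It sends
e_m to -e_{m+1} and e_{m+1} to -e_m, hence exchanges the families `r` and `b` on the pairs that
contain exactly one of the two last indices. -/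
theorem last_r_of_lt (h : ForkSystem neg (m + 1) f f' e e')
    (hr : ForkFamily (m + 1) f f' e e' r r' b) (i j : ℕ) (hij : i < j) (hj : j < m) :
    f' m (r i j) = r i j := by
  have hp := h.path'.pairFamily hr.r'_base hr.r'_step
  rw [← hr.r'_eq h i j hij (by omega), hp.above _ _ _ hij hj (by omega)]

theorem last_r_pred (h : ForkSystem neg (m + 1) f f' e e')
    (hr : ForkFamily (m + 1) f f' e e' r r' b) (i : ℕ) (hi : i < m) :
    f' m (r i m) = b i (m + 1) := by
  have hp := h.path'.pairFamily hr.r'_base hr.r'_step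
  rw [hr.b_eq h _ (by omega), ← hr.r'_eq h i m hi (by omega), hp.right _ _ hi (by omega)]

theorem last_r_last (h : ForkSystem neg (m + 1) f f' e e')
    (hr : ForkFamily (m + 1) f f' e e' r r' b) (i : ℕ) (hi : i < m) :
    f' m (r i (m + 1)) = b i m := by
  rw [hr.r_step _ _ hi (by omega), ← h.last_comm _ rfl, hr.last_r_pred h i hi,
    hr.b_right _ _ hi (by omega)]

theorem last_r_self (h : ForkSystem neg (m + 1) f f' e e')
    (hr : ForkFamily (m + 1) f f' e e' r r' b) : f' m (r m (m + 1)) = r m (m + 1) := by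
  rw [hr.r_base _ (by omega), h.last_apply' _ rfl]

theorem last_b_last (h : ForkSystem neg (m + 1) f f' e e')
    (hr : ForkFamily (m + 1) f f' e e' r r' b) (i : ℕ) (hi : i < m) :
    f' m (b i (m + 1)) = r i m := by
  rw [← hr.last_r_pred h i hi, h.path'.invol _ (by omega)]

theorem last_b_pred (h : ForkSystem neg (m + 1) f f' e e')
    (hr : ForkFamily (m + 1) f f' e e' r r' b) (i : ℕ) (hi : i < m) :
    f' m (b i m) = r i (m + 1) := by
  rw [← hr.last_r_last h i hi, h.path'.invol _ (by omega)]

theorem last_b_self (h : ForkSystem neg (m + 1) f f' e e')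
    (hr : ForkFamily (m + 1) f f' e e' r r' b) :
    f' m (b m (m + 1)) = neg (b m (m + 1)) := by
  rw [hr.b_last _ rfl, h.path'.apply_self _ (by omega)]

theorem last_b_of_lt (h : ForkSystem neg (m + 1) f f' e e')
    (hr : ForkFamily (m + 1) f f' e e' r r' b) (i j : ℕ) (hij : i < j) (hj : j < m) :
    f' m (b i j) = b i j := by
  obtain ⟨k, rfl⟩ : ∃ k, m = k + 1 := ⟨m - 1, by omega⟩
  have hp := h.path.pairFamily hr.r_base hr.r_step
  have hj' : j ≤ k := by omega
  induction hj' using Nat.decreasingInduction with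
  | self =>
    -- Once `b i k` is written through `r i k`, the outer `f' (k + 1)` travels through the word: the
    -- braid relation of the second path turns it into `f k`, the one of the first path then yields
    -- `f (k + 1)` at the inner end, and there it fixes `r i k`.
    have e1 : b i k = f k (f' (k + 1) (f (k + 1) (f k (r i k)))) := by
      rw [hr.b_right i k hij (by omega), hp.right i k hij (by omega),
        hp.right i (k + 1) (by omega) (by omega), hr.last_r_last h i (by omega)]
    have hk : f' k = f k := h.f_eq _ (by omega)
    have braid' := h.path'.braid k (by omega)
    rw [hk] at braid'
    rw [e1, ← braid', ← h.last_comm _ rfl, h.path.braid k (by omega),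
      hp.above (k + 1) i k hij (by omega) (by omega), ← h.last_comm _ rfl]
  | of_succ j hj ih =>
    rw [hr.b_right i j hij (by omega)]
    have hk : f' j = f j := h.f_eq _ (by omega)
    have := h.path'.comm j (k + 1) (by omega) (by omega)
    rw [hk] at this
    rw [← this, ih (by omega) (by omega)]

end ForkFamily

end

end CDaHa

/-! ### Formal root combinatorics of type B -/

namespace CDaHa

section

variable {V : Type*} {neg : V → V} {f : ℕ → V → V} {e : ℕ → V} {m : ℕ}

/-- Maps and elements which satisfy the relations of the simple reflections and the simple
roots of type `B_{m+2}`. -/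
structure QuartSystem (neg : V → V) (m : ℕ) (f : ℕ → V → V) (e : ℕ → V) (g : V → V)
    (a : V) : Prop where
  path : PathSystem neg (m + 1) f e
  invol : ∀ v, g (g v) = v
  comm : ∀ k, k < m → ∀ v, f k (g v) = g (f k v)
  map_neg : ∀ v, g (neg v) = neg (g v)
  apply_far : ∀ k, k < m → g (e k) = e k
  quart : ∀ v, f m (g (f m (g v))) = g (f m (g (f m v)))
  quart_apply : f m (g (e m)) = g (e m)
  quart_apply' : g (f m a) = f m a
  far_apply : ∀ k, k < m → f k a = a
  apply_self : g a = neg a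

variable {g : V → V} {a : V}

theorem PathSystem.conj {N : ℕ} (h : PathSystem neg N f e) (hg : ∀ v, g (g v) = v)
    (hn : ∀ v, g (neg v) = neg (g v)) :
    PathSystem neg N (fun k v => g (f k (g v))) (fun k => g (e k)) where
  invol k hk v := by simp only [hg, h.invol k hk]
  comm k l hkl hl v := by simp only [hg, h.comm k l hkl hl]
  braid k hk v := by simp only [hg, h.braid k hk]
  apply_far k l hkl hl := by simp only [hg, h.apply_far k l hkl hl]
  apply_far' k l hkl hl := by simp only [hg, h.apply_far' k l hkl hl]
  apply_near k hk := by simp only [hg, h.apply_near k hk]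
  apply_self k hk := by simp only [hg, h.apply_self k hk, hn]

/-- The long roots of type B form a system of type D: conjugation by the reflection `g` in the short
simple root turns the last long simple reflection into the other end of the fork. The two ends
commute because of the relation of order four. Thus the results of type D carry over to e_i ± e_j.
-/
theorem QuartSystem.forkSystem (h : QuartSystem neg m f e g a) :
    ForkSystem neg (m + 1) f (fun k v => g (f k (g v))) e (fun k => g (e k)) where
  path := h.path
  path' := h.path.conj h.invol h.map_neg
  f_eq k hk := by
    funext v
    rw [h.comm k (by omega), h.invol]
  e_eq k hk := h.apply_far k (by omega)
  last_comm k hk v := by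
    obtain rfl : k = m := by omega
    exact h.quart v
  last_apply k hk := by
    obtain rfl : k = m := by omega
    exact h.quart_apply
  last_apply' k hk := by
    obtain rfl : k = m := by omega
    simp only [h.quart_apply, h.invol]

/-- Elements `e_i - e_j`, `e_i + e_j` and `e_i`. -/
structure QuartFamily (m : ℕ) (f : ℕ → V → V) (e : ℕ → V) (g : V → V)
    (a : V) (r b : ℕ → ℕ → V) (s : ℕ → V) : Prop where
  r_base : ∀ i, i < m + 1 → r i (i + 1) = e i
  r_step : ∀ i j, i < j → j < m + 1 → r i (j + 1) = f j (r i j)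
  b_last : b m (m + 1) = g (e m)
  b_left : ∀ i, i + 1 < m + 1 → b i (m + 1) = f i (b (i + 1) (m + 1))
  b_right : ∀ i j, i < j → j < m + 1 → b i j = f j (b i (j + 1))
  s_last : s (m + 1) = a
  s_step : ∀ i, i < m + 1 → s i = f i (s (i + 1))

variable {r b : ℕ → ℕ → V} {s : ℕ → V}

namespace QuartFamily

theorem forkFamily (h : QuartSystem neg m f e g a) (hr : QuartFamily m f e g a r b s) :
    ForkFamily (m + 1) f (fun k v => g (f k (g v))) e (fun k => g (e k)) r
      (fun i j => g (r i j)) b where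
  r_base := hr.r_base
  r_step := hr.r_step
  r'_base i hi := by rw [hr.r_base i hi]
  r'_step i j hij hj := by rw [hr.r_step i j hij hj, h.invol]
  b_last i hi := by
    obtain rfl : i = m := by omega
    exact hr.b_last
  b_left := hr.b_left
  b_right := hr.b_right

theorem apply_r_of_lt (h : QuartSystem neg m f e g a) (hr : QuartFamily m f e g a r b s)
    (i j : ℕ) (hij : i < j) (hj : j < m + 1) : g (r i j) = r i j :=
  (hr.forkFamily h).r'_eq h.forkSystem i j hij hj

theorem apply_r_last (h : QuartSystem neg m f e g a) (hr : QuartFamily m f e g a r b s)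
    (i : ℕ) (hi : i < m + 1) : g (r i (m + 1)) = b i (m + 1) :=
  ((hr.forkFamily h).b_eq h.forkSystem i hi).symm

theorem apply_b_last (h : QuartSystem neg m f e g a) (hr : QuartFamily m f e g a r b s)
    (i : ℕ) (hi : i < m + 1) : g (b i (m + 1)) = r i (m + 1) := by
  rw [← hr.apply_r_last h i hi, h.invol]

theorem apply_b_of_lt (h : QuartSystem neg m f e g a) (hr : QuartFamily m f e g a r b s)
    (i j : ℕ) (hij : i < j) (hj : j < m + 1) : g (b i j) = b i j := by
  have hj' : j ≤ m := by omega
  induction hj' using Nat.decreasingInduction with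
  | self =>
    -- The second end of the fork is `g` conjugating `f m`, so this computation of type D already
    -- has `g` as its outermost map.
    have := (hr.forkFamily h).last_r_last h.forkSystem i hij
    rw [hr.b_right i m hij (by omega), ← hr.apply_r_last h i (by omega), this,
      hr.b_right i m hij (by omega), ← hr.apply_r_last h i (by omega)]
  | of_succ j hjm ih =>
    rw [hr.b_right i j hij (by omega), ← h.comm j hjm, ih (by omega) (by omega)]

theorem s_left (h : QuartSystem neg m f e g a) (hr : QuartFamily m f e g a r b s)
    (i : ℕ) (hi : i < m + 1) : f i (s i) = s (i + 1) := by
  rw [hr.s_step i hi, h.path.invol i hi]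

theorem s_below (h : QuartSystem neg m f e g a) (hr : QuartFamily m f e g a r b s)
    (k i : ℕ) (hk : k + 1 < i) (hi : i ≤ m + 1) : f k (s i) = s i := by
  induction hi using Nat.decreasingInduction with
  | self => rw [hr.s_last, h.far_apply k (by omega)]
  | of_succ j hj ih => rw [hr.s_step j hj, h.path.comm k j hk hj, ih (by omega)]

theorem s_above (h : QuartSystem neg m f e g a) (hr : QuartFamily m f e g a r b s)
    (k i : ℕ) (hi : i < k) (hk : k < m + 1) : f k (s i) = s i := by
  obtain ⟨d, rfl⟩ : ∃ d, k = i + 1 + d := ⟨k - (i + 1), by omega⟩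
  induction d generalizing i with
  | zero =>
    rw [hr.s_step i (by omega), hr.s_step (i + 1) (by omega)]
    change f (i + 1) (f i (f (i + 1) _)) = _
    rw [← h.path.braid _ (by omega), hr.s_below h i (i + 1 + 1) (by omega) (by omega)]
  | succ d ih =>
    have := ih (i + 1) (by omega) (by omega)
    rw [show i + 1 + 1 + d = i + 1 + (d + 1) by omega] at this
    rw [hr.s_step i (by omega), ← h.path.comm _ _ (by omega) hk, this]

theorem apply_s_last (h : QuartSystem neg m f e g a) (hr : QuartFamily m f e g a r b s) :
    g (s (m + 1)) = neg (s (m + 1)) := by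
  rw [hr.s_last, h.apply_self]

theorem apply_s_of_lt (h : QuartSystem neg m f e g a) (hr : QuartFamily m f e g a r b s)
    (i : ℕ) (hi : i < m + 1) : g (s i) = s i := by
  have hi' : i ≤ m := by omega
  induction hi' using Nat.decreasingInduction with
  | self => rw [hr.s_step _ hi, hr.s_last, h.quart_apply']
  | of_succ j hj ih => rw [hr.s_step _ hi, ← h.comm _ hj, ih (by omega)]

end QuartFamily

end

end CDaHa

/-! ### Signed permutations -/

namespace CDaHa

/-- Signed permutations of `n` letters: `e_i ↦ sgn i • e_{perm i}`. -/
@[ext]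
structure SPerm (n : ℕ) where
  perm : Equiv.Perm (Fin n)
  sgn : Fin n → ℤˣ

namespace SPerm

variable {n : ℕ}

instance : Mul (SPerm n) := ⟨fun g h => ⟨g.perm * h.perm, fun i => g.sgn (h.perm i) * h.sgn i⟩⟩
instance : One (SPerm n) := ⟨⟨1, fun _ => 1⟩⟩
instance : Inv (SPerm n) := ⟨fun g => ⟨g.perm⁻¹, fun i => g.sgn (g.perm⁻¹ i)⟩⟩

@[simp] theorem mul_perm (g h : SPerm n) : (g * h).perm = g.perm * h.perm := rfl
@[simp] theorem mul_sgn (g h : SPerm n) (i : Fin n) :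
    (g * h).sgn i = g.sgn (h.perm i) * h.sgn i := rfl
@[simp] theorem one_perm : (1 : SPerm n).perm = 1 := rfl
@[simp] theorem one_sgn (i : Fin n) : (1 : SPerm n).sgn i = 1 := rfl

instance : Group (SPerm n) :=
  Group.ofLeftAxioms
    (fun a b c => by ext i <;> simp [mul_assoc])
    (fun a => by ext i <;> simp)
    (fun a => by
      ext i
      · change ((a.perm⁻¹ * a.perm) i : ℕ) = _
        simp
      · change ((a.sgn (a.perm⁻¹ (a.perm i)) * a.sgn i : ℤˣ) : ℤ) = _
        simp)

/-- The reflection in `e_i - ε e_j`. -/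
def pair (i j : Fin n) (ε : ℤˣ) : SPerm n :=
  ⟨Equiv.swap i j, fun l => if l = i ∨ l = j then ε else 1⟩

/-- The reflection in `e_i`. -/
def flip (i : Fin n) : SPerm n := ⟨1, fun l => if l = i then -1 else 1⟩

theorem pair_comm (i j : Fin n) (ε : ℤˣ) : pair j i ε = pair i j ε := by
  simp only [pair, Equiv.swap_comm j i, or_comm]

/-- Since g e_i = sgn i · e_{g i} and signs are their own inverses, g maps e_i - ε e_j to a multiple
of e_{g i} - (ε sgn i sgn j) e_{g j}; conjugating a reflection moves its root. -/
theorem mul_pair (g : SPerm n) (i j : Fin n) (ε : ℤˣ) :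
    g * pair i j ε = pair (g.perm i) (g.perm j) (ε * g.sgn i * g.sgn j) * g := by
  have hs (a : ℤˣ) : a * a = 1 := Int.units_mul_self a
  have hp : (g * pair i j ε).perm =
      (pair (g.perm i) (g.perm j) (ε * g.sgn i * g.sgn j) * g).perm := by
    simp only [mul_perm, pair]
    rw [Equiv.mul_swap_eq_swap_mul]
  have hq : (g * pair i j ε).sgn =
      (pair (g.perm i) (g.perm j) (ε * g.sgn i * g.sgn j) * g).sgn := by
    funext l
    simp only [mul_sgn, pair, EmbeddingLike.apply_eq_iff_eq]
    by_cases hi : l = i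
    · subst hi
      simp only [Equiv.swap_apply_left, true_or, if_true]
      calc g.sgn j * ε = (g.sgn l * g.sgn l) * (g.sgn j * ε) := by rw [hs, one_mul]
        _ = _ := by ac_rfl
    · by_cases hj : l = j
      · subst hj
        simp only [Equiv.swap_apply_right, or_true, if_true]
        calc g.sgn i * ε = (g.sgn l * g.sgn l) * (g.sgn i * ε) := by rw [hs, one_mul]
          _ = _ := by ac_rfl
      · simp [hi, hj, Equiv.swap_apply_of_ne_of_ne hi hj]
  exact SPerm.ext hp hq

theorem mul_flip (g : SPerm n) (i : Fin n) : g * flip i = flip (g.perm i) * g := by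
  have hp : (g * flip i).perm = (flip (g.perm i) * g).perm := by simp [flip]
  have hq : (g * flip i).sgn = (flip (g.perm i) * g).sgn := by
    funext l
    simp only [mul_sgn, flip, EmbeddingLike.apply_eq_iff_eq, Equiv.Perm.one_apply, mul_comm]
  exact SPerm.ext hp hq

end SPerm

/-- The sign `±1` as a complex number. -/
def sc : ℤˣ →* ℂ := (Int.castRingHom ℂ : ℤ →* ℂ).comp (Units.coeHom ℤ)

@[simp] theorem sc_neg_one : sc (-1) = -1 := by simp [sc]

theorem sc_mul_self (e : ℤˣ) : sc e * sc e = 1 := by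
  rw [← map_mul, Int.units_mul_self, map_one]

/-! ### Reflection data and the identities between commutators -/

/-- A group with a central involution `zp (-1)`, a parity, an action by signed permutations, and
lifts `R i j ε`, `S i` of the reflections in `e_i - ε e_j` and `e_i` of which the group permutes
those with non-zero parameter, up to the central involution. -/
structure ReflectionDatum (G : Type*) [Group G] (n : ℕ) where
  zp : ℤˣ →* G
  act : G →* SPerm n
  par : G →* ℤˣ
  c : ℤˣ → ℂ
  d : ℂ
  R : Fin n → Fin n → ℤˣ → G
  S : Fin n → G
  zp_comm : ∀ e g, zp e * g = g * zp e
  act_zp : ∀ e, act (zp e) = 1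
  par_zp : ∀ e, par (zp e) = 1
  c_inv : ∀ g i j ε, c (ε * (act g).sgn i * (act g).sgn j) = c ε
  -- Type A has no lifts for e_i + e_j, and types A and D none for e_i. All axioms on lifts
  -- therefore assume a non-zero parameter. The factor is z for e_i - e_j, which changes sign with
  -- the order of i and j, and 1 for e_i + e_j.
  R_symm : ∀ i j ε, i ≠ j → c ε ≠ 0 → R j i ε = zp (-ε) * R i j ε
  R_conj : ∀ g i j ε, i ≠ j → c ε ≠ 0 →
    g * R i j ε = zp (par g * (act g).sgn i) *
      R ((act g).perm i) ((act g).perm j) (ε * (act g).sgn i * (act g).sgn j) * g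
  act_R : ∀ i j ε, i ≠ j → c ε ≠ 0 → act (R i j ε) = SPerm.pair i j ε
  par_R : ∀ i j ε, i ≠ j → c ε ≠ 0 → par (R i j ε) = -1
  S_conj : ∀ g i, d ≠ 0 →
    g * S i = zp (par g * (act g).sgn i) * S ((act g).perm i) * g
  act_S : ∀ i, d ≠ 0 → act (S i) = SPerm.flip i
  par_S : ∀ i, d ≠ 0 → par (S i) = -1

namespace ReflectionDatum

variable {G : Type*} [Group G] {n : ℕ} (D : ReflectionDatum G n)

theorem zp_mul_self (e : ℤˣ) : D.zp e * D.zp e = 1 := by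
  rw [← map_mul, Int.units_mul_self, map_one]

section Algebra

variable {E : Type*} [Ring E] (ρ : G →* E)

/-- The image of `z R i j ε`. -/
def T (i j : Fin n) (ε : ℤˣ) : E := ρ (D.zp (-1) * D.R i j ε)

/-- The image of `z S i`. -/
def U (i : Fin n) : E := ρ (D.zp (-1) * D.S i)

theorem zp_comm' (e : ℤˣ) (g : G) : ρ (D.zp e) * ρ g = ρ g * ρ (D.zp e) := by
  rw [← map_mul, D.zp_comm, map_mul]

theorem T_conj (g : G) {i j : Fin n} (h : i ≠ j) (ε : ℤˣ) (hc : D.c ε ≠ 0) :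
    ρ g * D.T ρ i j ε = ρ (D.zp (D.par g * (D.act g).sgn i)) *
      D.T ρ ((D.act g).perm i) ((D.act g).perm j)
        (ε * (D.act g).sgn i * (D.act g).sgn j) * ρ g := by
  simp only [T, ← map_mul]
  congr 1
  rw [← mul_assoc, ← D.zp_comm, mul_assoc, D.R_conj g i j ε h hc]
  simp only [← mul_assoc]
  rw [D.zp_comm (-1) (D.zp _)]

theorem U_conj (g : G) (i : Fin n) (hd : D.d ≠ 0) :
    ρ g * D.U ρ i = ρ (D.zp (D.par g * (D.act g).sgn i)) *
      D.U ρ ((D.act g).perm i) * ρ g := by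
  simp only [U, ← map_mul]
  congr 1
  rw [← mul_assoc, ← D.zp_comm, mul_assoc, D.S_conj g i hd]
  simp only [← mul_assoc]
  rw [D.zp_comm (-1) (D.zp _)]

theorem T_symm {i j : Fin n} (h : i ≠ j) (ε : ℤˣ) (hc : D.c ε ≠ 0) :
    D.T ρ j i ε = ρ (D.zp (-ε)) * D.T ρ i j ε := by
  simp only [T, ← map_mul]
  congr 1
  rw [D.R_symm i j ε h hc, ← mul_assoc, ← mul_assoc, D.zp_comm (-1)]

variable [Algebra ℂ E]

/-- The value of the commutator `[y_i, x_k]`. -/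
noncomputable def comm (i k : Fin n) : E :=
  if i = k then
    -(∑ m ∈ Finset.univ.erase k, ∑ ε, D.c ε • D.T ρ k m ε) - D.d • D.U ρ k
  else ∑ ε, (sc ε * D.c ε) • D.T ρ k i ε

theorem comm_self (k : Fin n) : D.comm ρ k k =
    -(∑ m ∈ Finset.univ.erase k, ∑ ε, D.c ε • D.T ρ k m ε) - D.d • D.U ρ k := if_pos rfl

theorem comm_of_ne {i k : Fin n} (h : i ≠ k) :
    D.comm ρ i k = ∑ ε, (sc ε * D.c ε) • D.T ρ k i ε := if_neg h

/-- Equivariance of the commutators. -/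
theorem conj_comm (g : G) (i k : Fin n) :
    ρ g * D.comm ρ i k = (sc ((D.act g).sgn i * (D.act g).sgn k)) •
      (ρ (D.zp (D.par g * (D.act g).sgn k)) *
        D.comm ρ ((D.act g).perm i) ((D.act g).perm k) * ρ g) := by
  -- Conjugation replaces ε by ε sgn k sgn j, so the sum over ε is reindexed. Two coefficient
  -- functions are needed because off the diagonal the coefficient sc ε · c ε changes by the sign
  -- sgn i sgn k, while on the diagonal c ε is invariant.
  have smul_T : ∀ (a b : ℤˣ → ℂ) (j : Fin n), k ≠ j → (∀ ε, D.c ε = 0 → a ε = 0) →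
      (∀ ε, b (ε * ((D.act g).sgn k * (D.act g).sgn j)) = a ε) →
      ρ g * ∑ ε, a ε • D.T ρ k j ε = ρ (D.zp (D.par g * (D.act g).sgn k)) *
        (∑ ε, b ε • D.T ρ ((D.act g).perm k) ((D.act g).perm j) ε) * ρ g := by
    intro a b j hj ha hb
    rw [← Equiv.sum_comp (Equiv.mulRight ((D.act g).sgn k * (D.act g).sgn j))
      fun ε => b ε • D.T ρ ((D.act g).perm k) ((D.act g).perm j) ε, Finset.mul_sum,
      Finset.mul_sum, Finset.sum_mul]
    refine Finset.sum_congr rfl fun ε _ => ?_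
    simp only [Equiv.coe_mulRight, hb]
    by_cases hc : D.c ε = 0
    · simp [ha ε hc]
    · rw [mul_smul_comm, D.T_conj ρ g hj ε hc, mul_smul_comm, smul_mul_assoc, mul_assoc ε]
  by_cases h : i = k
  · subst h
    rw [Int.units_mul_self, map_one, one_smul, comm_self, comm_self, mul_sub, mul_sub, sub_mul,
      mul_neg, mul_neg, neg_mul]
    congr 1
    · congr 1
      rw [Finset.mul_sum, Finset.mul_sum, Finset.sum_mul]
      refine Finset.sum_bij (fun m _ => (D.act g).perm m) ?_ ?_ ?_ ?_
      · intro m hm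
        simpa using hm
      · intro m _ m' _ h
        simpa using h
      · intro m hm
        exact ⟨(D.act g).perm.symm m, by simpa [Equiv.symm_apply_eq] using hm, by simp⟩
      · intro m hm
        refine smul_T _ _ m (by simpa [eq_comm] using hm) (fun _ h => h) fun ε => ?_
        rw [← mul_assoc, D.c_inv]
    · by_cases hd : D.d = 0
      · simp [hd]
      · rw [mul_smul_comm, D.U_conj ρ g i hd, mul_smul_comm, smul_mul_assoc]
  · rw [D.comm_of_ne ρ h, D.comm_of_ne ρ (by simpa using h), smul_T _
      (fun ε => sc ((D.act g).sgn i * (D.act g).sgn k) * (sc ε * D.c ε)) i (Ne.symm h),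
      ← smul_mul_assoc, ← mul_smul_comm, Finset.smul_sum]
    · simp only [smul_smul]
    · intro ε h
      simp [h]
    · intro ε
      rw [← mul_assoc ε, D.c_inv, ← mul_assoc, ← map_mul]
      congr 2
      calc (D.act g).sgn i * (D.act g).sgn k * (ε * (D.act g).sgn k * (D.act g).sgn i)
          = ((D.act g).sgn i * (D.act g).sgn i) * ((D.act g).sgn k * (D.act g).sgn k) * ε := by
            ac_rfl
        _ = ε := by simp [Int.units_mul_self]

/-- The relations of `x_i` and `y_i` with the group. -/
structure Equivariant (x y : Fin n → E) : Prop where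
  mul_x : ∀ g i, ρ g * x i = sc ((D.act g).sgn i) •
    (ρ (D.zp (D.par g * (D.act g).sgn i)) * x ((D.act g).perm i) * ρ g)
  mul_y : ∀ g i, ρ g * y i = sc ((D.act g).sgn i) • (y ((D.act g).perm i) * ρ g)

namespace Equivariant

variable {D ρ} {x y : Fin n → E} (h : D.Equivariant ρ x y)
include h

theorem zp_x (e : ℤˣ) (i : Fin n) : ρ (D.zp e) * x i = x i * ρ (D.zp e) := by
  have := h.mul_x (D.zp e) i
  simpa [D.act_zp, D.par_zp] using this

theorem zp_y (e : ℤˣ) (i : Fin n) : ρ (D.zp e) * y i = y i * ρ (D.zp e) := by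
  have := h.mul_y (D.zp e) i
  simpa [D.act_zp] using this

theorem T_x_far {i j l : Fin n} (hij : i ≠ j) {ε : ℤˣ} (hc : D.c ε ≠ 0) (hi : l ≠ i)
    (hj : l ≠ j) : D.T ρ i j ε * x l = ρ (D.zp (-1)) * x l * D.T ρ i j ε := by
  have := h.mul_x (D.zp (-1) * D.R i j ε) l
  simpa [T, D.act_zp, D.par_zp, D.act_R i j ε hij hc, D.par_R i j ε hij hc, SPerm.pair, hi, hj,
    Equiv.swap_apply_of_ne_of_ne hi hj] using this

theorem T_x_right {i j : Fin n} (hij : i ≠ j) {ε : ℤˣ} (hc : D.c ε ≠ 0) :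
    D.T ρ i j ε * x j = sc ε • (ρ (D.zp (-ε)) * x i * D.T ρ i j ε) := by
  have := h.mul_x (D.zp (-1) * D.R i j ε) j
  simpa [T, D.act_zp, D.par_zp, D.act_R i j ε hij hc, D.par_R i j ε hij hc, SPerm.pair] using this

theorem T_y_far {i j l : Fin n} (hij : i ≠ j) {ε : ℤˣ} (hc : D.c ε ≠ 0) (hi : l ≠ i)
    (hj : l ≠ j) : D.T ρ i j ε * y l = y l * D.T ρ i j ε := by
  have := h.mul_y (D.zp (-1) * D.R i j ε) l
  simpa [T, D.act_zp, D.act_R i j ε hij hc, SPerm.pair, hi, hj,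
    Equiv.swap_apply_of_ne_of_ne hi hj] using this

theorem T_y_left {i j : Fin n} (hij : i ≠ j) {ε : ℤˣ} (hc : D.c ε ≠ 0) :
    D.T ρ i j ε * y i = sc ε • (y j * D.T ρ i j ε) := by
  have := h.mul_y (D.zp (-1) * D.R i j ε) i
  simpa [T, D.act_zp, D.act_R i j ε hij hc, SPerm.pair] using this

theorem T_y_right {i j : Fin n} (hij : i ≠ j) {ε : ℤˣ} (hc : D.c ε ≠ 0) :
    D.T ρ i j ε * y j = sc ε • (y i * D.T ρ i j ε) := by
  have := h.mul_y (D.zp (-1) * D.R i j ε) j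
  simpa [T, D.act_zp, D.act_R i j ε hij hc, SPerm.pair] using this

theorem U_x_far {i l : Fin n} (hd : D.d ≠ 0) (hi : l ≠ i) :
    D.U ρ i * x l = ρ (D.zp (-1)) * x l * D.U ρ i := by
  have := h.mul_x (D.zp (-1) * D.S i) l
  simpa [U, D.act_zp, D.par_zp, D.act_S i hd, D.par_S i hd, SPerm.flip, hi] using this

theorem U_y_far {i l : Fin n} (hd : D.d ≠ 0) (hi : l ≠ i) :
    D.U ρ i * y l = y l * D.U ρ i := by
  have := h.mul_y (D.zp (-1) * D.S i) l
  simpa [U, D.act_zp, D.act_S i hd, SPerm.flip, hi] using this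

theorem comm_x_far {i k l : Fin n} (hik : i ≠ k) (hi : l ≠ i) (hk : l ≠ k) :
    D.comm ρ i k * x l = ρ (D.zp (-1)) * x l * D.comm ρ i k := by
  rw [D.comm_of_ne ρ hik, Finset.sum_mul, Finset.mul_sum]
  refine Finset.sum_congr rfl fun ε _ => ?_
  by_cases hc : D.c ε = 0
  · simp [hc]
  · rw [smul_mul_assoc, mul_smul_comm, h.T_x_far hik.symm hc hk hi]

theorem comm_y_far {i k l : Fin n} (hik : i ≠ k) (hi : l ≠ i) (hk : l ≠ k) :
    D.comm ρ i k * y l = y l * D.comm ρ i k := by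
  rw [D.comm_of_ne ρ hik, Finset.sum_mul, Finset.mul_sum]
  refine Finset.sum_congr rfl fun ε _ => ?_
  by_cases hc : D.c ε = 0
  · simp [hc]
  · rw [smul_mul_assoc, mul_smul_comm, h.T_y_far hik.symm hc hk hi]

/-- Every term of [y_k, x_k] passes x_l with a factor z, except the reflections in e_k ± e_l. These
exchange x_k and x_l up to signs and powers of z, and so reproduce the terms of [y_k, x_l] next to
x_k. This is the only non-trivial case of `comm_x`. -/
theorem comm_self_x {k l : Fin n} (hkl : k ≠ l) :
    D.comm ρ k k * x l - ρ (D.zp (-1)) * x l * D.comm ρ k k =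
      ρ (D.zp (-1)) * (D.comm ρ k l * x k) - x k * D.comm ρ k l := by
  have hl : l ∈ Finset.univ.erase k := by simpa using hkl.symm
  have h1 : ∀ m ∈ (Finset.univ.erase k).erase l, (∑ ε, D.c ε • D.T ρ k m ε) * x l =
      ρ (D.zp (-1)) * x l * ∑ ε, D.c ε • D.T ρ k m ε := by
    intro m hm
    simp only [Finset.mem_erase, Finset.mem_univ, and_true] at hm
    rw [Finset.sum_mul, Finset.mul_sum]
    refine Finset.sum_congr rfl fun ε _ => ?_
    by_cases hc : D.c ε = 0
    · simp [hc]
    · rw [smul_mul_assoc, mul_smul_comm, h.T_x_far hm.2.symm hc hkl.symm hm.1.symm]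
  have h2 : (D.d • D.U ρ k) * x l = ρ (D.zp (-1)) * x l * (D.d • D.U ρ k) := by
    by_cases hd : D.d = 0
    · simp [hd]
    · rw [smul_mul_assoc, mul_smul_comm, h.U_x_far hd hkl.symm]
  have h3 : (∑ ε, D.c ε • D.T ρ k l ε) * x l = x k * D.comm ρ k l := by
    rw [D.comm_of_ne ρ hkl, Finset.sum_mul, Finset.mul_sum]
    refine Finset.sum_congr rfl fun ε _ => ?_
    by_cases hc : D.c ε = 0
    · simp [hc]
    · rw [smul_mul_assoc, mul_smul_comm, h.T_x_right hkl hc, D.T_symm ρ hkl ε hc, smul_smul,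
        h.zp_x, mul_assoc, mul_comm (D.c ε)]
  have h4 : ρ (D.zp (-1)) * x l * ∑ ε, D.c ε • D.T ρ k l ε =
      ρ (D.zp (-1)) * (D.comm ρ k l * x k) := by
    rw [D.comm_of_ne ρ hkl, Finset.sum_mul, Finset.mul_sum, Finset.mul_sum]
    refine Finset.sum_congr rfl fun ε _ => ?_
    by_cases hc : D.c ε = 0
    · simp [hc]
    · rw [smul_mul_assoc, mul_smul_comm, mul_smul_comm, h.T_x_right hkl.symm hc,
        D.T_symm ρ hkl ε hc, mul_smul_comm, smul_smul, mul_right_comm, sc_mul_self, one_mul,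
        mul_assoc, h.zp_x, mul_assoc (x l), ← mul_assoc (ρ _) (ρ _) (D.T ρ k l ε), ← map_mul,
        D.zp_mul_self, map_one, one_mul]
  have h5 := Finset.add_sum_erase _ (fun m => ∑ ε, D.c ε • D.T ρ k m ε) hl
  have h6 : (∑ m ∈ (Finset.univ.erase k).erase l, ∑ ε, D.c ε • D.T ρ k m ε) * x l =
      ρ (D.zp (-1)) * x l * ∑ m ∈ (Finset.univ.erase k).erase l, ∑ ε, D.c ε • D.T ρ k m ε := by
    rw [Finset.sum_mul, Finset.mul_sum]
    exact Finset.sum_congr rfl h1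
  rw [comm_self, ← h5, ← h4, ← h3]
  simp only [sub_mul, mul_sub, neg_mul, mul_neg, add_mul, mul_add, h6, h2]
  abel

/-- The compatibility of the commutators with the relations of the `x_i`. -/
theorem comm_x (i : Fin n) {k l : Fin n} (hkl : k ≠ l) :
    D.comm ρ i k * x l + x k * D.comm ρ i l =
      ρ (D.zp (-1)) * (D.comm ρ i l * x k + x l * D.comm ρ i k) := by
  have hz : ρ (D.zp (-1)) * ρ (D.zp (-1)) = 1 := by rw [← map_mul, D.zp_mul_self, map_one]
  by_cases hik : i = k
  · subst hik
    have := h.comm_self_x hkl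
    rw [mul_add, ← mul_assoc _ (x l), add_comm (ρ _ * _) _]
    exact sub_eq_sub_iff_add_eq_add.mp this |>.trans (add_comm _ _)
  · by_cases hil : i = l
    · subst hil
      have := sub_eq_sub_iff_add_eq_add.mp (h.comm_self_x hkl.symm)
      apply_fun (ρ (D.zp (-1)) * ·) at this
      simp only [mul_add, ← mul_assoc, hz, one_mul] at this ⊢
      rw [← this, add_comm]
    · rw [h.comm_x_far hik (Ne.symm hil) hkl.symm, h.comm_x_far hil (Ne.symm hik) hkl, mul_add,
        ← mul_assoc (ρ _) (ρ _ * _), ← mul_assoc (ρ _) (ρ _), hz, one_mul, mul_assoc (ρ _) (x l),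
        add_comm]

/-- All terms of [y_j, x_j] commute with y_i except the reflections in e_j ± e_i, which trade y_i
for ± y_j. The sign is the factor sc ε by which [y_i, x_j] differs from that part of [y_j, x_j]. -/
theorem comm_self_y {i j : Fin n} (hij : i ≠ j) :
    y i * D.comm ρ j j - D.comm ρ j j * y i = y j * D.comm ρ i j - D.comm ρ i j * y j := by
  have hl : i ∈ Finset.univ.erase j := by simpa using hij
  have h1 : ∀ m ∈ (Finset.univ.erase j).erase i, (∑ ε, D.c ε • D.T ρ j m ε) * y i =
      y i * ∑ ε, D.c ε • D.T ρ j m ε := by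
    intro m hm
    simp only [Finset.mem_erase, Finset.mem_univ, and_true] at hm
    rw [Finset.sum_mul, Finset.mul_sum]
    refine Finset.sum_congr rfl fun ε _ => ?_
    by_cases hc : D.c ε = 0
    · simp [hc]
    · rw [smul_mul_assoc, mul_smul_comm, h.T_y_far hm.2.symm hc hij hm.1.symm]
  have h2 : (D.d • D.U ρ j) * y i = y i * (D.d • D.U ρ j) := by
    by_cases hd : D.d = 0
    · simp [hd]
    · rw [smul_mul_assoc, mul_smul_comm, h.U_y_far hd hij]
  have h3 : (∑ ε, D.c ε • D.T ρ j i ε) * y i = y j * D.comm ρ i j := by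
    rw [D.comm_of_ne ρ hij, Finset.sum_mul, Finset.mul_sum]
    refine Finset.sum_congr rfl fun ε _ => ?_
    by_cases hc : D.c ε = 0
    · simp [hc]
    · rw [smul_mul_assoc, mul_smul_comm, h.T_y_right hij.symm hc, smul_smul, mul_comm (D.c ε)]
  have h4 : y i * ∑ ε, D.c ε • D.T ρ j i ε = D.comm ρ i j * y j := by
    rw [D.comm_of_ne ρ hij, Finset.sum_mul, Finset.mul_sum]
    refine Finset.sum_congr rfl fun ε _ => ?_
    by_cases hc : D.c ε = 0
    · simp [hc]
    · rw [smul_mul_assoc, mul_smul_comm, h.T_y_left hij.symm hc, smul_smul, mul_right_comm,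
        sc_mul_self, one_mul]
  have h5 := Finset.add_sum_erase _ (fun m => ∑ ε, D.c ε • D.T ρ j m ε) hl
  have h6 : (∑ m ∈ (Finset.univ.erase j).erase i, ∑ ε, D.c ε • D.T ρ j m ε) * y i =
      y i * ∑ m ∈ (Finset.univ.erase j).erase i, ∑ ε, D.c ε • D.T ρ j m ε := by
    rw [Finset.sum_mul, Finset.mul_sum]
    exact Finset.sum_congr rfl h1
  rw [comm_self, ← h5, ← h4, ← h3]
  simp only [sub_mul, mul_sub, neg_mul, mul_neg, add_mul, mul_add, h6, h2]
  abel

/-- The compatibility of the commutators with the relations of the `y_i`. -/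
theorem comm_y {i j : Fin n} (hij : i ≠ j) (k : Fin n) :
    y i * D.comm ρ j k - D.comm ρ j k * y i = y j * D.comm ρ i k - D.comm ρ i k * y j := by
  by_cases hjk : j = k
  · subst hjk
    exact h.comm_self_y hij
  · by_cases hik : i = k
    · subst hik
      exact (h.comm_self_y hij.symm).symm
    · rw [h.comm_y_far hjk hij hik, h.comm_y_far hik hij.symm hjk, sub_self, sub_self]

end Equivariant

end Algebra
end ReflectionDatum
end CDaHa

/-! ### Words in the x_k with coefficients in a module -/

namespace CDaHa

section FreeMod

variable (n : ℕ) (M : Type*) [AddCommGroup M] [Module ℂ M]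

/-- The tensor product of the free algebra on `x_1, …, x_n` with `M`. -/
abbrev FreeMod : Type _ := List (Fin n) →₀ M

variable {n M}

/-- The embedding of `M`. -/
noncomputable def emb : M →ₗ[ℂ] FreeMod n M := Finsupp.lsingle []

/-- Left multiplication by `x_k`. -/
noncomputable def cons (k : Fin n) : Module.End ℂ (FreeMod n M) :=
  Finsupp.lmapDomain M ℂ (List.cons k)

theorem cons_single (k : Fin n) (L : List (Fin n)) (m : M) :
    cons k (Finsupp.single L m) = Finsupp.single (k :: L) m := by
  simp [cons, Finsupp.mapDomain_single]

/-- Induction on the length of words. The second hypothesis supplies equality at `v`, so both maps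
only need to obey the same recursion for multiplication by x_k. -/
theorem FreeMod.hom_ext {N' : Type*} [AddCommGroup N'] [Module ℂ N']
    {f g : FreeMod n M →ₗ[ℂ] N'} (h0 : ∀ m, f (emb m) = g (emb m))
    (h1 : ∀ k v, f v = g v → f (cons k v) = g (cons k v)) : f = g := by
  refine Finsupp.lhom_ext fun L => ?_
  induction L with
  | nil => exact h0
  | cons k L ih =>
    intro m
    rw [← cons_single]
    exact h1 k _ (ih m)

variable {N' : Type*} [AddCommGroup N'] [Module ℂ N']

/-- The components of the map `FreeMod.rec`. -/
noncomputable def FreeMod.recAux (f : M →ₗ[ℂ] N') (F : Fin n → Module.End ℂ N')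
    (A : Fin n → FreeMod n M →ₗ[ℂ] N') : List (Fin n) → M →ₗ[ℂ] N'
  | [] => f
  | k :: L => F k ∘ₗ FreeMod.recAux f F A L + A k ∘ₗ Finsupp.lsingle L

/-- The linear map with given values on `M` and a prescribed recursion for multiplication
by the `x_k`. -/
noncomputable def FreeMod.recMap (f : M →ₗ[ℂ] N') (F : Fin n → Module.End ℂ N')
    (A : Fin n → FreeMod n M →ₗ[ℂ] N') : FreeMod n M →ₗ[ℂ] N' :=
  Finsupp.lsum ℂ (FreeMod.recAux f F A)

variable (f : M →ₗ[ℂ] N') (F : Fin n → Module.End ℂ N') (A : Fin n → FreeMod n M →ₗ[ℂ] N')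

theorem FreeMod.recMap_emb (m : M) : FreeMod.recMap f F A (emb m) = f m := by
  simp [FreeMod.recMap, emb, FreeMod.recAux]

theorem FreeMod.recMap_cons (k : Fin n) (v : FreeMod n M) :
    FreeMod.recMap f F A (cons k v) = F k (FreeMod.recMap f F A v) + A k v := by
  suffices h : FreeMod.recMap f F A ∘ₗ cons k = F k ∘ₗ FreeMod.recMap f F A + A k from
    LinearMap.congr_fun h v
  refine Finsupp.lhom_ext fun L m => ?_
  simp [FreeMod.recMap, cons_single, FreeMod.recAux]

end FreeMod

/-! ### The induced module -/

namespace ReflectionDatum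

variable {G : Type*} [Group G] {n : ℕ} (D : ReflectionDatum G n)

section Induced

variable {M : Type*} [AddCommGroup M] [Module ℂ M] (ρ : G →* Module.End ℂ M)

/-- The action of the central elements on the induced module. -/
noncomputable def indZp (e : ℤˣ) : Module.End ℂ (FreeMod n M) :=
  FreeMod.recMap (emb ∘ₗ ρ (D.zp e)) cons 0

/-- The action of a group element on the induced module. -/
noncomputable def indFun (g : G) : Module.End ℂ (FreeMod n M) :=
  FreeMod.recMap (emb ∘ₗ ρ g) (fun k => sc ((D.act g).sgn k) •
    (D.indZp ρ (D.par g * (D.act g).sgn k) * cons ((D.act g).perm k))) 0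

theorem indZp_emb (e : ℤˣ) (m : M) :
    D.indZp ρ e (emb m) = (emb (ρ (D.zp e) m) : FreeMod n M) := by
  simp [indZp, FreeMod.recMap_emb]

theorem indZp_cons (e : ℤˣ) (k : Fin n) (v : FreeMod n M) :
    D.indZp ρ e (cons k v) = cons k (D.indZp ρ e v) := by
  simp [indZp, FreeMod.recMap_cons]

theorem indFun_emb (g : G) (m : M) :
    D.indFun ρ g (emb m) = (emb (ρ g m) : FreeMod n M) := by
  simp [indFun, FreeMod.recMap_emb]

theorem indFun_cons (g : G) (k : Fin n) (v : FreeMod n M) :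
    D.indFun ρ g (cons k v) = sc ((D.act g).sgn k) •
      D.indZp ρ (D.par g * (D.act g).sgn k) (cons ((D.act g).perm k) (D.indFun ρ g v)) := by
  simp [indFun, FreeMod.recMap_cons]

theorem indZp_one : D.indZp ρ 1 = 1 := by
  refine FreeMod.hom_ext (fun m => ?_) fun k v h => ?_
  · simp [indZp_emb]
  · rw [indZp_cons, h]
    rfl

theorem indZp_mul (e e' : ℤˣ) : D.indZp ρ (e * e') = D.indZp ρ e * D.indZp ρ e' := by
  refine FreeMod.hom_ext (fun m => ?_) fun k v h => ?_
  · simp [indZp_emb]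
  · simp only [Module.End.mul_apply, indZp_cons] at h ⊢
    rw [h]

/-- The formula for moving g past x_k contains powers of z, so the action of z had to be defined
beforehand; it is now seen to be the action of z as a group element. -/
theorem indFun_zp (e : ℤˣ) : D.indFun ρ (D.zp e) = D.indZp ρ e := by
  refine FreeMod.hom_ext (fun m => ?_) fun k v h => ?_
  · simp [indZp_emb, indFun_emb]
  · rw [indFun_cons, indZp_cons, h]
    simp [D.act_zp, D.par_zp, indZp_one, indZp_cons]

theorem indZp_comm (e e' : ℤˣ) (w : FreeMod n M) :
    D.indZp ρ e (D.indZp ρ e' w) = D.indZp ρ e' (D.indZp ρ e w) := by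
  rw [← Module.End.mul_apply, ← Module.End.mul_apply, ← indZp_mul, ← indZp_mul, mul_comm]

theorem indFun_indZp (g : G) (e : ℤˣ) :
    D.indFun ρ g * D.indZp ρ e = D.indZp ρ e * D.indFun ρ g := by
  refine FreeMod.hom_ext (fun m => ?_) fun k v h => ?_
  · simp only [Module.End.mul_apply, indZp_emb, indFun_emb]
    rw [← Module.End.mul_apply, ← Module.End.mul_apply, zp_comm']
  · simp only [Module.End.mul_apply, indZp_cons, indFun_cons, map_smul] at h ⊢
    rw [h, indZp_comm]

/-- The sign and the power of z that g picks up at x_k form a cocycle: sgn of g g' at k is sgn of g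
at g' k times sgn of g' at k, and the parity is multiplicative. -/
theorem indFun_mul (g g' : G) : D.indFun ρ (g * g') = D.indFun ρ g * D.indFun ρ g' := by
  refine FreeMod.hom_ext (fun m => ?_) fun k v h => ?_
  · simp [indFun_emb]
  · have hz : ∀ e w, D.indFun ρ g (D.indZp ρ e w) = D.indZp ρ e (D.indFun ρ g w) :=
      fun e w => LinearMap.congr_fun (D.indFun_indZp ρ g e) w
    simp only [Module.End.mul_apply] at h ⊢
    simp only [indFun_cons, h, hz, map_smul, smul_smul, map_mul, SPerm.mul_sgn, SPerm.mul_perm,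
      indZp_mul, Equiv.Perm.mul_apply, Module.End.mul_apply]
    rw [mul_comm (sc _) (sc _)]
    congr 1
    rw [indZp_comm D ρ (D.par g') ((D.act g).sgn _), indZp_comm D ρ (D.par g'),
      indZp_comm D ρ ((D.act g').sgn k), indZp_comm D ρ ((D.act g').sgn k)]
    simp only [indZp_comm]

/-- The induced representation of the group. -/
noncomputable def ind : G →* Module.End ℂ (FreeMod n M) where
  toFun := D.indFun ρ
  map_one' := by rw [← map_one D.zp, indFun_zp, indZp_one]
  map_mul' := D.indFun_mul ρ

variable (Y : Fin n → Module.End ℂ M)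

/-- The action of `y_i` on the induced module. -/
noncomputable def indY (i : Fin n) : Module.End ℂ (FreeMod n M) :=
  FreeMod.recMap (emb ∘ₗ Y i) cons (fun k => D.comm (D.ind ρ) i k)

theorem indY_emb (i : Fin n) (m : M) :
    D.indY ρ Y i (emb m) = (emb (Y i m) : FreeMod n M) := by
  simp [indY, FreeMod.recMap_emb]

theorem indY_cons (i k : Fin n) (v : FreeMod n M) :
    D.indY ρ Y i (cons k v) = cons k (D.indY ρ Y i v) + D.comm (D.ind ρ) i k v := by
  simp [indY, FreeMod.recMap_cons]

theorem ind_emb (g : G) (m : M) : D.ind ρ g (emb m) = (emb (ρ g m) : FreeMod n M) :=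
  D.indFun_emb ρ g m

theorem ind_zp (e : ℤˣ) : D.ind ρ (D.zp e) = D.indZp ρ e := D.indFun_zp ρ e

theorem ind_cons (g : G) (k : Fin n) (v : FreeMod n M) :
    D.ind ρ g (cons k v) = sc ((D.act g).sgn k) •
      D.ind ρ (D.zp (D.par g * (D.act g).sgn k)) (cons ((D.act g).perm k) (D.ind ρ g v)) := by
  rw [ind_zp]
  exact D.indFun_cons ρ g k v

/-- For the y_i the recursion leaves a commutator term on each side, and the two agree by
`conj_comm`. -/
theorem ind_equivariant
    (hY : ∀ g i, ρ g * Y i = sc ((D.act g).sgn i) • (Y ((D.act g).perm i) * ρ g)) :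
    D.Equivariant (D.ind ρ) cons (D.indY ρ Y) := by
  refine ⟨fun g i => LinearMap.ext fun v => ?_, ?_⟩
  · simp only [Module.End.mul_apply, LinearMap.smul_apply]
    exact D.ind_cons ρ g i v
  · have main : ∀ g i, (∀ e j v, D.ind ρ (D.zp e) (D.indY ρ Y j v) =
        D.indY ρ Y j (D.ind ρ (D.zp e) v)) → D.ind ρ g * D.indY ρ Y i =
        sc ((D.act g).sgn i) • (D.indY ρ Y ((D.act g).perm i) * D.ind ρ g) := by
      intro g i hz
      refine FreeMod.hom_ext (fun m => ?_) fun k v h => ?_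
      · have := LinearMap.congr_fun (hY g i) m
        simp only [Module.End.mul_apply, LinearMap.smul_apply] at this
        simp [indY_emb, ind_emb, this]
      · have hc := LinearMap.congr_fun (D.conj_comm (D.ind ρ) g i k) v
        simp only [Module.End.mul_apply, LinearMap.smul_apply] at h hc ⊢
        rw [indY_cons, map_add, D.ind_cons ρ g k (D.indY ρ Y i v), h, hc, D.ind_cons ρ g k v]
        simp only [map_smul]
        rw [← hz, indY_cons]
        simp only [map_add, smul_add, smul_smul]
        rw [mul_comm (sc _) (sc _), ← map_mul]
    intro g i
    refine main g i fun e j v => LinearMap.congr_fun (FreeMod.hom_ext (n := n) (M := M)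
      (f := D.ind ρ (D.zp e) * D.indY ρ Y j) (g := D.indY ρ Y j * D.ind ρ (D.zp e)) ?_ ?_) v
    · intro m
      have := LinearMap.congr_fun (hY (D.zp e) j) m
      simp only [Module.End.mul_apply, D.act_zp, SPerm.one_sgn, SPerm.one_perm, map_one, one_smul,
        Equiv.Perm.one_apply] at this
      simp only [Module.End.mul_apply, indY_emb, ind_emb, this]
    · intro k v h
      simp only [Module.End.mul_apply] at h ⊢
      have h1 : ∀ v, D.ind ρ (D.zp e) (cons k v) = cons k (D.ind ρ (D.zp e) v) := fun v => by
        rw [ind_zp, indZp_cons]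
      have h2 := LinearMap.congr_fun (D.conj_comm (D.ind ρ) (D.zp e) j k) v
      simp only [D.act_zp, D.par_zp, SPerm.one_sgn, SPerm.one_perm, mul_one, map_one,
        one_smul, one_mul, Equiv.Perm.one_apply, Module.End.mul_apply] at h2
      rw [indY_cons, map_add, h1, h1, indY_cons, h, h2]

/-- Expanding y_i y_j and y_j y_i on x_k v, the discrepancy beyond x_k times the previous one
consists of y_i [y_j, x_k] + [y_i, x_k] y_j against the same with i and j exchanged; `comm_y` makes
it vanish. -/
theorem indY_comm
    (hY : ∀ g i, ρ g * Y i = sc ((D.act g).sgn i) • (Y ((D.act g).perm i) * ρ g))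
    (hYY : ∀ i j, Y i * Y j = Y j * Y i) (i j : Fin n) :
    D.indY ρ Y i * D.indY ρ Y j = D.indY ρ Y j * D.indY ρ Y i := by
  by_cases hij : i = j
  · rw [hij]
  refine FreeMod.hom_ext (fun m => ?_) fun k v h => ?_
  · have := LinearMap.congr_fun (hYY i j) m
    simp only [Module.End.mul_apply] at this
    simp [indY_emb, this]
  · have := LinearMap.congr_fun ((D.ind_equivariant ρ Y hY).comm_y hij k) v
    simp only [Module.End.mul_apply, LinearMap.sub_apply] at h this ⊢
    simp only [indY_cons, map_add, h]
    rw [sub_eq_sub_iff_add_eq_add] at this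
    rw [add_assoc, add_assoc, add_comm _ (D.indY ρ Y i _), this, add_comm (D.indY ρ Y j _)]

end Induced

end ReflectionDatum
end CDaHa

/-! ### The quotient by the relations of the x_k -/

namespace CDaHa
namespace ReflectionDatum

variable {G : Type*} [Group G] {n : ℕ} (D : ReflectionDatum G n)

section Algebra

variable {E : Type*} [Ring E] [Algebra ℂ E] {ρ : G →* E} {x y : Fin n → E}

variable (ρ x) in
/-- The element `x_k x_l - z x_l x_k`. -/
def relator (k l : Fin n) : E := x k * x l - ρ (D.zp (-1)) * x l * x k

variable {D}

theorem Equivariant.mul_x_x (h : D.Equivariant ρ x y) (g : G) (k l : Fin n) :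
    ρ g * (x k * x l) = sc ((D.act g).sgn k * (D.act g).sgn l) •
      (ρ (D.zp ((D.act g).sgn k * (D.act g).sgn l)) *
        (x ((D.act g).perm k) * x ((D.act g).perm l)) * ρ g) := by
  rw [← mul_assoc, h.mul_x g k, smul_mul_assoc, mul_assoc _ (ρ g), h.mul_x g l, mul_smul_comm,
    smul_smul, ← map_mul]
  congr 1
  simp only [mul_assoc]
  rw [← mul_assoc (x _) (ρ (D.zp _)), ← h.zp_x, mul_assoc, ← mul_assoc (ρ (D.zp _)) (ρ (D.zp _)),
    ← map_mul, ← map_mul]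
  congr 3
  calc D.par g * (D.act g).sgn k * (D.par g * (D.act g).sgn l)
      = (D.par g * D.par g) * ((D.act g).sgn k * (D.act g).sgn l) := by ac_rfl
    _ = _ := by rw [Int.units_mul_self, one_mul]

theorem Equivariant.mul_relator (h : D.Equivariant ρ x y) (g : G) (k l : Fin n) :
    ρ g * D.relator ρ x k l = sc ((D.act g).sgn k * (D.act g).sgn l) •
      (ρ (D.zp ((D.act g).sgn k * (D.act g).sgn l)) *
        D.relator ρ x ((D.act g).perm k) ((D.act g).perm l) * ρ g) := by
  simp only [relator, mul_assoc (ρ (D.zp (-1)))]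
  rw [mul_sub, h.mul_x_x, ← mul_assoc (ρ g), ← D.zp_comm', mul_assoc (ρ _) (ρ g) (x l * x k),
    h.mul_x_x g l k, mul_sub, sub_mul, smul_sub, mul_comm ((D.act g).sgn l), mul_smul_comm]
  congr 2
  simp only [← mul_assoc, D.zp_comm' ρ (-1)]

/-- Moving y_i through x_k x_l and through z x_l x_k leaves two correction terms, which `comm_x`
equates. -/
theorem Equivariant.y_mul_relator (h : D.Equivariant ρ x y)
    (hyx : ∀ i k, y i * x k = x k * y i + D.comm ρ i k) (i : Fin n) {k l : Fin n}
    (hkl : k ≠ l) : y i * D.relator ρ x k l = D.relator ρ x k l * y i := by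
  have e : ∀ k l, y i * (x k * x l) =
      x k * x l * y i + (D.comm ρ i k * x l + x k * D.comm ρ i l) := by
    intro k l
    rw [← mul_assoc, hyx, add_mul, mul_assoc, hyx, mul_add, mul_assoc]
    abel
  rw [relator, mul_sub, e, mul_assoc (ρ _), ← mul_assoc (y i) (ρ _), ← h.zp_y, mul_assoc (ρ _), e,
    h.comm_x i hkl, sub_mul, mul_assoc (ρ _) (x l * x k) (y i)]
  simp only [mul_add]
  abel

variable (D ρ x y) in
/-- The defining relations of the covering double affine Hecke algebra of the datum. -/
structure Model : Prop extends D.Equivariant ρ x y where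
  x_x : ∀ i j, i ≠ j → x i * x j = ρ (D.zp (-1)) * x j * x i
  y_y : ∀ i j, y i * y j = y j * y i
  y_x : ∀ i k, y i * x k = x k * y i + D.comm ρ i k

end Algebra

theorem comm_intertwine {N Q : Type*} [AddCommGroup N] [Module ℂ N] [AddCommGroup Q] [Module ℂ Q]
    {ρ : G →* Module.End ℂ N} {ρ' : G →* Module.End ℂ Q} {π : N →ₗ[ℂ] Q}
    (h : ∀ g v, ρ' g (π v) = π (ρ g v)) (i k : Fin n) (v : N) :
    D.comm ρ' i k (π v) = π (D.comm ρ i k v) := by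
  unfold comm
  split_ifs <;> simp [T, U, LinearMap.sum_apply, h]

section Quotient

variable {M : Type*} [AddCommGroup M] [Module ℂ M] (ρ : G →* Module.End ℂ M)
  (Y : Fin n → Module.End ℂ M)

/-- The submodule generated by the relations of the `x_i`. -/
noncomputable def relSub : Submodule ℂ (FreeMod n M) :=
  sInf {S | (∀ k l, k ≠ l → ∀ v, D.relator (D.ind ρ) cons k l v ∈ S) ∧
    ∀ k, ∀ v ∈ S, cons k v ∈ S}

variable {ρ}

theorem relator_mem {k l : Fin n} (h : k ≠ l) (v : FreeMod n M) :
    D.relator (D.ind ρ) cons k l v ∈ D.relSub ρ :=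
  Submodule.mem_sInf.mpr fun _ hS => hS.1 k l h v

theorem cons_mem (k : Fin n) {v : FreeMod n M} (h : v ∈ D.relSub ρ) :
    cons k v ∈ D.relSub ρ :=
  Submodule.mem_sInf.mpr fun S hS => hS.2 k v (Submodule.mem_sInf.mp h S hS)

theorem relSub_le {S : Submodule ℂ (FreeMod n M)}
    (h1 : ∀ k l, k ≠ l → ∀ v, D.relator (D.ind ρ) cons k l v ∈ S)
    (h2 : ∀ k, ∀ v ∈ S, cons k v ∈ S) : D.relSub ρ ≤ S :=
  sInf_le ⟨h1, h2⟩

variable {Y} (hE : D.Equivariant (D.ind ρ) cons (D.indY ρ Y))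
include hE

theorem zp_mem (e : ℤˣ) {v : FreeMod n M} (h : v ∈ D.relSub ρ) :
    D.ind ρ (D.zp e) v ∈ D.relSub ρ := by
  suffices h : D.relSub ρ ≤ (D.relSub ρ).comap (D.ind ρ (D.zp e)) from h ‹_›
  refine D.relSub_le (fun k l hkl v => ?_) fun k v hv => ?_
  · have := LinearMap.congr_fun (hE.mul_relator (D.zp e) k l) v
    simp only [D.act_zp, SPerm.one_sgn, SPerm.one_perm, mul_one, map_one, one_smul, one_mul,
      Equiv.Perm.one_apply, Module.End.mul_apply] at this
    rw [Submodule.mem_comap, this]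
    exact D.relator_mem hkl _
  · have := LinearMap.congr_fun (hE.zp_x e k) v
    simp only [Module.End.mul_apply] at this
    rw [Submodule.mem_comap, this]
    exact D.cons_mem k hv

theorem ind_mem (g : G) {v : FreeMod n M} (h : v ∈ D.relSub ρ) :
    D.ind ρ g v ∈ D.relSub ρ := by
  suffices h : D.relSub ρ ≤ (D.relSub ρ).comap (D.ind ρ g) from h ‹_›
  refine D.relSub_le (fun k l hkl v => ?_) fun k v hv => ?_
  · have := LinearMap.congr_fun (hE.mul_relator g k l) v
    simp only [LinearMap.smul_apply, Module.End.mul_apply] at this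
    rw [Submodule.mem_comap, this]
    exact Submodule.smul_mem _ _ (D.zp_mem hE _ (D.relator_mem (by simpa using hkl) _))
  · have := LinearMap.congr_fun (hE.mul_x g k) v
    simp only [LinearMap.smul_apply, Module.End.mul_apply] at this
    rw [Submodule.mem_comap, this]
    exact Submodule.smul_mem _ _ (D.zp_mem hE _ (D.cons_mem _ hv))

theorem comm_mem (i k : Fin n) {v : FreeMod n M} (h : v ∈ D.relSub ρ) :
    D.comm (D.ind ρ) i k v ∈ D.relSub ρ := by
  unfold comm
  split_ifs
  · simp only [LinearMap.sub_apply, LinearMap.neg_apply, LinearMap.sum_apply, LinearMap.smul_apply]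
    refine sub_mem (neg_mem (sum_mem fun _ _ => sum_mem fun _ _ => ?_)) ?_
    all_goals exact Submodule.smul_mem _ _ (D.ind_mem hE _ h)
  · simp only [LinearMap.sum_apply, LinearMap.smul_apply]
    exact sum_mem fun _ _ => Submodule.smul_mem _ _ (D.ind_mem hE _ h)

omit hE in
theorem indY_mul_cons (i k : Fin n) : D.indY ρ Y i * cons k =
    (cons k * D.indY ρ Y i + D.comm (D.ind ρ) i k : Module.End ℂ (FreeMod n M)) :=
  LinearMap.ext fun v => D.indY_cons ρ Y i k v

theorem indY_mem (i : Fin n) {v : FreeMod n M} (h : v ∈ D.relSub ρ) :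
    D.indY ρ Y i v ∈ D.relSub ρ := by
  -- Passing y_i over x_k leaves [y_i, x_k] v, which lies in the submodule only because `v` does;
  -- the intersection keeps that information through the induction.
  suffices h : D.relSub ρ ≤ D.relSub ρ ⊓ (D.relSub ρ).comap (D.indY ρ Y i) from
    (h ‹_›).2
  refine D.relSub_le (fun k l hkl v => ⟨D.relator_mem hkl v, ?_⟩) fun k v hv =>
    ⟨D.cons_mem k hv.1, ?_⟩
  · have := LinearMap.congr_fun (hE.y_mul_relator (D.indY_mul_cons) i hkl) v
    simp only [Module.End.mul_apply] at this
    rw [SetLike.mem_coe, Submodule.mem_comap, this]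
    exact D.relator_mem hkl _
  · rw [SetLike.mem_coe, Submodule.mem_comap, indY_cons]
    exact add_mem (D.cons_mem k hv.2) (D.comm_mem hE i k hv.1)

/-- The action of the group on the quotient module. -/
noncomputable def quotRep : G →* Module.End ℂ (FreeMod n M ⧸ D.relSub ρ) where
  toFun g := (D.relSub ρ).mapQ _ (D.ind ρ g) fun _ h => D.ind_mem hE g h
  map_one' := Submodule.linearMap_qext _ (LinearMap.ext fun v => by simp)
  map_mul' g g' := Submodule.linearMap_qext _ (LinearMap.ext fun v => by simp)

theorem quot_model (hYY : ∀ i j, D.indY ρ Y i * D.indY ρ Y j = D.indY ρ Y j * D.indY ρ Y i) :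
    D.Model (D.quotRep hE)
      (fun k => (D.relSub ρ).mapQ _ (cons k) fun _ h => D.cons_mem k h)
      (fun k => (D.relSub ρ).mapQ _ (D.indY ρ Y k) fun _ h => D.indY_mem hE k h) := by
  have hq : ∀ g v, D.quotRep hE g ((D.relSub ρ).mkQ v) = (D.relSub ρ).mkQ (D.ind ρ g v) :=
    fun _ _ => rfl
  refine ⟨⟨fun g i => ?_, fun g i => ?_⟩, fun i j hij => ?_, fun i j => ?_, fun i j => ?_⟩ <;>
    refine Submodule.linearMap_qext _ (LinearMap.ext fun v => ?_)
  · exact congrArg (D.relSub ρ).mkQ (LinearMap.congr_fun (hE.mul_x g i) v)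
  · exact congrArg (D.relSub ρ).mkQ (LinearMap.congr_fun (hE.mul_y g i) v)
  · exact (Submodule.Quotient.eq _).mpr (D.relator_mem hij v)
  · exact congrArg (D.relSub ρ).mkQ (LinearMap.congr_fun (hYY i j) v)
  · have := congrArg (D.relSub ρ).mkQ (D.indY_cons ρ Y i j v)
    rw [map_add, ← D.comm_intertwine hq] at this
    exact this

end Quotient

end ReflectionDatum
end CDaHa

/-! ### Skew polynomials and linear independence -/

namespace CDaHa

/-- The ordered product `a_1^{α_1} ⋯ a_n^{α_n}`. -/
def powProd {E : Type*} [Monoid E] {n : ℕ} (a : Fin n → E) (α : Fin n → ℕ) : E :=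
  (List.ofFn fun i => a i ^ α i).prod

theorem powProd_eq {E : Type*} [Monoid E] {n : ℕ} (a : Fin n → E) (α : Fin n → ℕ) :
    powProd a α = ((List.finRange n).map fun i => a i ^ α i).prod := by
  rw [powProd, List.ofFn_eq_map]

theorem list_pow_intertwine {Q Q' : Type*} [AddCommGroup Q] [Module ℂ Q] [AddCommGroup Q']
    [Module ℂ Q'] {n : ℕ} {a : Fin n → Module.End ℂ Q} {a' : Fin n → Module.End ℂ Q'}
    {π : Q → Q'} (h : ∀ i v, π (a i v) = a' i (π v)) (α : Fin n → ℕ) (l : List (Fin n)) (v : Q) :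
    π ((l.map fun i => a i ^ α i).prod v) = (l.map fun i => a' i ^ α i).prod (π v) := by
  have hpow : ∀ i k v, π ((a i ^ k) v) = (a' i ^ k) (π v) := by
    intro i k
    induction k with
    | zero => simp
    | succ k ih => intro v; simp only [pow_succ, Module.End.mul_apply, ih, h]
  induction l generalizing v with
  | nil => simp
  | cons i l ih => simp only [List.map_cons, List.prod_cons, Module.End.mul_apply, hpow, ih]

theorem powProd_intertwine {Q Q' : Type*} [AddCommGroup Q] [Module ℂ Q] [AddCommGroup Q']
    [Module ℂ Q'] {n : ℕ} {a : Fin n → Module.End ℂ Q} {a' : Fin n → Module.End ℂ Q'}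
    {π : Q → Q'} (h : ∀ i v, π (a i v) = a' i (π v)) (α : Fin n → ℕ) (v : Q) :
    π (powProd a α v) = powProd a' α (π v) := by
  simp only [powProd_eq]
  exact list_pow_intertwine h α _ v

namespace ReflectionDatum

universe u

variable {G : Type*} [Group G] {n : ℕ} (D : ReflectionDatum G n)

section Skew

variable {M : Type*} [AddCommGroup M] [Module ℂ M] (ρ : G →* Module.End ℂ M)

/-- The sign produced by moving `x_i` past `x_1^{α_1} ⋯ x_{i-1}^{α_{i-1}}`. -/
def skewSign (i : Fin n) (α : Fin n → ℕ) : ℤˣ := ∏ j ∈ Finset.univ.filter (· < i), (-1) ^ α j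

theorem skewSign_add (i k : Fin n) (α : Fin n → ℕ) :
    skewSign i (α + Pi.single k 1) = (if k < i then -1 else 1) * skewSign i α := by
  simp only [skewSign, Pi.add_apply, pow_add, Finset.prod_mul_distrib, Pi.single_apply, pow_ite,
    pow_one, pow_zero, Finset.prod_ite_eq', Finset.mem_filter, Finset.mem_univ, true_and]
  rw [mul_comm]

/-- Left multiplication by `x_i` on the skew polynomials with coefficients in `M`. -/
noncomputable def skewX (i : Fin n) : Module.End ℂ ((Fin n → ℕ) →₀ M) :=
  Finsupp.lsum ℂ fun α => Finsupp.lsingle (α + Pi.single i 1) ∘ₗ ρ (D.zp (skewSign i α))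

theorem skewX_single (i : Fin n) (α : Fin n → ℕ) (m : M) :
    D.skewX ρ i (Finsupp.single α m) =
      Finsupp.single (α + Pi.single i 1) (ρ (D.zp (skewSign i α)) m) := by
  simp [skewX]

/-- Of the two orders, exactly the one in which the smaller variable is multiplied first produces an
additional factor z. -/
theorem skewX_comm {k l : Fin n} (h : k ≠ l) (w : (Fin n → ℕ) →₀ M) :
    D.skewX ρ k (D.skewX ρ l w) =
      Finsupp.mapRange.linearMap (ρ (D.zp (-1))) (D.skewX ρ l (D.skewX ρ k w)) := by
  induction w using Finsupp.induction_linear with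
  | zero => simp
  | add f g hf hg => simp only [map_add, hf, hg]
  | single α m =>
    simp only [skewX_single, Finsupp.mapRange.linearMap_apply, Finsupp.mapRange_single,
      skewSign_add]
    rw [add_right_comm]
    congr 1
    simp only [← Module.End.mul_apply, ← map_mul]
    congr 3
    rcases lt_or_gt_of_ne h with h | h
    · simp [h, h.not_gt, mul_comm]
    · simp [h, h.not_gt, mul_comm]

theorem skewX_pow_single (i : Fin n) (k : ℕ) (β : Fin n → ℕ) (hβ : ∀ j < i, β j = 0) (m : M) :
    (D.skewX ρ i ^ k) (Finsupp.single β m) = Finsupp.single (β + Pi.single i k) m := by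
  induction k with
  | zero => simp
  | succ k ih =>
    have h1 : skewSign i (β + Pi.single i k) = 1 := by
      refine Finset.prod_eq_one fun j hj => ?_
      simp only [Finset.mem_filter, Finset.mem_univ, true_and] at hj
      simp [hβ j hj, hj.ne]
    rw [pow_succ', Module.End.mul_apply, ih, skewX_single, h1, map_one, map_one, add_assoc,
      ← Pi.single_add]
    rfl

/-- The ordered product acts with its largest index first, so each variable meets only larger ones
and no power of z appears. -/
theorem powProd_skewX (α : Fin n → ℕ) (m : M) :
    powProd (D.skewX ρ) α (Finsupp.single 0 m) = Finsupp.single α m := by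
  have key : ∀ l : List (Fin n), l.Pairwise (· < ·) →
      (l.map fun i => D.skewX ρ i ^ α i).prod (Finsupp.single 0 m) =
        Finsupp.single (fun j => if j ∈ l then α j else 0) m := by
    intro l
    induction l with
    | nil => intro _; simp; rfl
    | cons i l ih =>
      intro hl
      rw [List.pairwise_cons] at hl
      rw [List.map_cons, List.prod_cons, Module.End.mul_apply, ih hl.2, skewX_pow_single]
      · congr 1
        funext j
        by_cases hj : j = i
        · subst hj
          have : j ∉ l := fun h => lt_irrefl _ (hl.1 j h)
          simp [this]
        · simp [hj]
      · intro j hj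
        have : j ∉ l := fun h => lt_asymm hj (hl.1 j h)
        simp [this]
  rw [powProd_eq, key _ (List.pairwise_lt_finRange n)]
  simp

/-- The map from the induced module to skew polynomials. -/
noncomputable def toSkew : FreeMod n M →ₗ[ℂ] ((Fin n → ℕ) →₀ M) :=
  FreeMod.recMap (Finsupp.lsingle 0) (D.skewX ρ) 0

theorem toSkew_emb (m : M) : D.toSkew ρ (emb m) = Finsupp.single 0 m := by
  simp [toSkew, FreeMod.recMap_emb]

theorem toSkew_cons (k : Fin n) (v : FreeMod n M) :
    D.toSkew ρ (cons k v) = D.skewX ρ k (D.toSkew ρ v) := by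
  simp [toSkew, FreeMod.recMap_cons]

theorem skewX_zp (e : ℤˣ) (k : Fin n) (w : (Fin n → ℕ) →₀ M) :
    D.skewX ρ k (Finsupp.mapRange.linearMap (ρ (D.zp e)) w) =
      Finsupp.mapRange.linearMap (ρ (D.zp e)) (D.skewX ρ k w) := by
  induction w using Finsupp.induction_linear with
  | zero => simp
  | add f g hf hg => simp only [map_add, hf, hg]
  | single α m =>
    simp only [skewX_single, Finsupp.mapRange.linearMap_apply, Finsupp.mapRange_single]
    rw [← Module.End.mul_apply, ← Module.End.mul_apply, D.zp_comm']

theorem toSkew_zp (e : ℤˣ) (v : FreeMod n M) :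
    D.toSkew ρ (D.ind ρ (D.zp e) v) =
      Finsupp.mapRange.linearMap (ρ (D.zp e)) (D.toSkew ρ v) := by
  suffices h : D.toSkew ρ ∘ₗ D.ind ρ (D.zp e) =
      Finsupp.mapRange.linearMap (ρ (D.zp e)) ∘ₗ D.toSkew ρ from LinearMap.congr_fun h v
  refine FreeMod.hom_ext (fun m => ?_) fun k v h => ?_
  · simp [ind_emb, toSkew_emb]
  · simp only [LinearMap.comp_apply] at h ⊢
    rw [ind_zp] at h ⊢
    rw [indZp_cons, toSkew_cons, h, toSkew_cons, skewX_zp]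

/-- This bounds the quotient from below: nothing collapses beyond the skew commutation of the x_k.
Compatibility with the x_k and z suffices; skew polynomials are given no action of the y_i. -/
theorem relSub_le_ker : D.relSub ρ ≤ LinearMap.ker (D.toSkew ρ) := by
  refine D.relSub_le (fun k l hkl v => ?_) fun k v hv => ?_
  · rw [LinearMap.mem_ker, relator, LinearMap.sub_apply, map_sub, sub_eq_zero, mul_assoc]
    simp only [Module.End.mul_apply]
    rw [toSkew_zp, toSkew_cons, toSkew_cons, toSkew_cons, toSkew_cons, D.skewX_comm ρ hkl]
  · rw [LinearMap.mem_ker] at hv ⊢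
    rw [toSkew_cons, hv, map_zero]

end Skew

section Base

/-- The module `ℂ[G] ⊗ ℂ[y_1, …, y_n]`. -/
abbrev Base (G : Type*) (n : ℕ) : Type _ := G →₀ MvPolynomial (Fin n) ℂ

variable (n) in
/-- Left translation. -/
noncomputable def baseRep : G →* Module.End ℂ (Base G n) where
  toFun g := Finsupp.lmapDomain _ ℂ (g * ·)
  map_one' := by
    refine Finsupp.lhom_ext fun h f => ?_
    simp
  map_mul' g g' := by
    refine Finsupp.lhom_ext fun h f => ?_
    simp [mul_assoc]

theorem baseRep_single (g h : G) (f : MvPolynomial (Fin n) ℂ) :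
    baseRep n g (Finsupp.single h f) = Finsupp.single (g * h) f := by
  simp [baseRep]

/-- The action of `y_i`. -/
noncomputable def baseY (i : Fin n) : Module.End ℂ (Base G n) :=
  Finsupp.lsum ℂ fun g => Finsupp.lsingle g ∘ₗ LinearMap.mulLeft ℂ
    (sc ((D.act g⁻¹).sgn i) • MvPolynomial.X ((D.act g⁻¹).perm i))

theorem baseY_single (i : Fin n) (g : G) (f : MvPolynomial (Fin n) ℂ) :
    D.baseY i (Finsupp.single g f) = Finsupp.single g
      (sc ((D.act g⁻¹).sgn i) • MvPolynomial.X ((D.act g⁻¹).perm i) * f) := by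
  simp only [baseY, Finsupp.lsum_single, LinearMap.comp_apply, LinearMap.mulLeft_apply,
    Finsupp.lsingle_apply]

theorem baseY_comm (i j : Fin n) : D.baseY i * D.baseY j = D.baseY j * D.baseY i := by
  refine Finsupp.lhom_ext fun g f => ?_
  simp only [Module.End.mul_apply, baseY_single]
  rw [mul_left_comm]

/-- In ℂ[G] ⊗ ℂ[y] one has y_i h = h (h⁻¹ y_i), which is why `baseY` multiplies by the variable
moved by `h⁻¹`; the claim is then (h⁻¹ g⁻¹) g = h⁻¹ on indices and signs. -/
theorem baseRep_mul_baseY (g : G) (i : Fin n) : baseRep n g * D.baseY i =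
    sc ((D.act g).sgn i) • (D.baseY ((D.act g).perm i) * baseRep n g) := by
  refine Finsupp.lhom_ext fun h f => ?_
  have h1 : D.act h⁻¹ = D.act (g * h)⁻¹ * D.act g := by
    rw [← map_mul]
    congr 1
    group
  simp only [Module.End.mul_apply, baseY_single, baseRep_single, LinearMap.smul_apply,
    Finsupp.smul_single]
  rw [h1, SPerm.mul_sgn, SPerm.mul_perm, Equiv.Perm.mul_apply, map_mul, ← smul_mul_assoc,
    smul_smul, mul_comm (sc _)]

theorem powProd_baseY (γ : Fin n → ℕ) :
    powProd D.baseY γ (Finsupp.single 1 1) =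
      Finsupp.single 1 (MvPolynomial.monomial (Finsupp.equivFunOnFinite.symm γ) 1) := by
  have h := powProd_intertwine (Q := MvPolynomial (Fin n) ℂ) (Q' := Base G n)
    (a := fun i => LinearMap.mulLeft ℂ (MvPolynomial.X i)) (a' := D.baseY)
    (π := Finsupp.single 1) (fun i v => by simp [baseY_single]) γ 1
  rw [← h]
  congr 1
  have h2 : powProd (fun i => LinearMap.mulLeft ℂ (MvPolynomial.X i : MvPolynomial (Fin n) ℂ)) γ =
      LinearMap.mulLeft ℂ (powProd MvPolynomial.X γ) := by
    simp only [powProd]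
    change _ = Algebra.lmul ℂ (MvPolynomial (Fin n) ℂ) _
    rw [map_list_prod, List.map_ofFn]
    simp only [Function.comp_def, map_pow]
    rfl
  rw [h2, LinearMap.mulLeft_apply, mul_one, powProd, List.prod_ofFn, MvPolynomial.monomial_eq,
    Finsupp.prod_fintype _ _ (by simp)]
  simp

end Base

/-- There is a representation of the defining relations on which the ordered monomials act
linearly independently. -/
theorem exists_model {G : Type u} [Group G] (D : ReflectionDatum G n) : ∃ (Q : Type u) (_ : AddCommGroup Q) (_ : Module ℂ Q)
    (ρ : G →* Module.End ℂ Q) (x y : Fin n → Module.End ℂ Q) (v : Q), D.Model ρ x y ∧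
      LinearIndependent ℂ fun t : (Fin n → ℕ) × G × (Fin n → ℕ) =>
        (powProd x t.1 * ρ t.2.1 * powProd y t.2.2) v := by
  have hE := D.ind_equivariant (baseRep n) D.baseY D.baseRep_mul_baseY
  refine ⟨_, inferInstance, inferInstance, D.quotRep hE, _, _,
    (D.relSub (baseRep n)).mkQ (emb (Finsupp.single 1 1)),
    D.quot_model hE (D.indY_comm (baseRep n) D.baseY D.baseRep_mul_baseY D.baseY_comm), ?_⟩
  let Ψ := (D.relSub (baseRep n)).liftQ (D.toSkew (baseRep n)) (D.relSub_le_ker (baseRep n))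
  -- `Λ` reads off all coefficients of a skew polynomial. The images of the monomials will be the
  -- standard unit functions, which are independent.
  let Λ : ((Fin n → ℕ) →₀ Base G n) →ₗ[ℂ] ((Fin n → ℕ) × G × (Fin n → ℕ) → ℂ) :=
    LinearMap.pi fun t => MvPolynomial.lcoeff ℂ (Finsupp.equivFunOnFinite.symm t.2.2) ∘ₗ
      Finsupp.lapply t.2.1 ∘ₗ Finsupp.lapply t.1
  refine LinearIndependent.of_comp (Λ ∘ₗ Ψ) ?_
  classical
  convert Pi.linearIndependent_single_one ((Fin n → ℕ) × G × (Fin n → ℕ)) ℂ using 1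
  funext t
  obtain ⟨α, w, γ⟩ := t
  simp only [Function.comp_apply, LinearMap.comp_apply, Module.End.mul_apply]
  -- The y's and the group element act first, on 1 ⊗ 1 ⊗ 1, and so stay inside the copy of the base
  -- module. Only x's remain when `Ψ` is reached, and these it respects.
  rw [← powProd_intertwine (π := (D.relSub (baseRep n)).mkQ) (a := D.indY (baseRep n) D.baseY)
    (fun i v => rfl), ← powProd_intertwine (π := emb) (a := D.baseY)
    (fun i v => (D.indY_emb (baseRep n) D.baseY i v).symm), powProd_baseY]
  have h1 : ∀ m, D.quotRep hE w ((D.relSub (baseRep n)).mkQ (emb m)) =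
      (D.relSub (baseRep n)).mkQ (emb (baseRep n w m)) := fun m =>
    congrArg (D.relSub (baseRep n)).mkQ (D.ind_emb (baseRep n) w m)
  rw [h1, baseRep_single, mul_one, ← powProd_intertwine (π := (D.relSub (baseRep n)).mkQ) (a := cons)
    (fun i v => rfl)]
  have h2 : ∀ v, Ψ ((D.relSub (baseRep n)).mkQ v) = D.toSkew (baseRep n) v := fun v => rfl
  rw [h2, powProd_intertwine (π := D.toSkew (baseRep n)) (a' := D.skewX (baseRep n))
    (D.toSkew_cons (baseRep n)), toSkew_emb, powProd_skewX]
  funext t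
  obtain ⟨α', w', γ'⟩ := t
  simp only [Λ, LinearMap.pi_apply, LinearMap.comp_apply, Finsupp.lapply_apply,
    Finsupp.single_apply, Pi.single_apply, Prod.mk.injEq]
  by_cases hα : α = α'
  · by_cases hw : w = w'
    · by_cases hγ : γ = γ'
      · simp [hα, hw, hγ]
      · simp [hα, hw, hγ, MvPolynomial.coeff_monomial, Ne.symm hγ]
    · simp [hα, Ne.symm hw]
  · simp [hα, Ne.symm hα]

end ReflectionDatum
end CDaHa

/-! ### Spanning by ordered monomials -/

namespace CDaHa

section PowProd

variable {E : Type*} [Monoid E] {n : ℕ} {a : Fin n → E} {ζ : E}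

/-- The new factor moves right to its place, collecting ζ at each letter it passes. With ζ = z this
serves the x_i, with ζ = 1 the y_i. -/
theorem exists_mul_powProd (hζ : ∀ i, ζ * a i = a i * ζ)
    (ha : ∀ i j, i ≠ j → a i * a j = ζ * a j * a i) (i : Fin n) (α : Fin n → ℕ) :
    ∃ e : ℕ, a i * powProd a α = ζ ^ e * powProd a (α + Pi.single i 1) := by
  have hpow : ∀ j, i ≠ j → ∀ k : ℕ, a i * a j ^ k = ζ ^ k * a j ^ k * a i := by
    intro j hij k
    induction k with
    | zero => simp
    | succ k ih =>
      have hc : Commute (a j) (ζ ^ k) := (show Commute (a j) ζ from (hζ j).symm).pow_right k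
      rw [pow_succ' (a j), ← mul_assoc, ha i j hij, mul_assoc _ (a i), ih, mul_assoc ζ,
        ← mul_assoc (a j), ← mul_assoc (a j), hc.eq, pow_succ']
      simp only [mul_assoc]
  have key : ∀ l : List (Fin n), l.Nodup → i ∈ l →
      ∃ e : ℕ, a i * (l.map fun j => a j ^ α j).prod =
        ζ ^ e * (l.map fun j => a j ^ (α + Pi.single i 1 : Fin n → ℕ) j).prod := by
    intro l
    induction l with
    | nil => simp
    | cons j l ih =>
      intro hl hi
      rw [List.nodup_cons] at hl
      by_cases hij : i = j
      · subst hij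
        refine ⟨0, ?_⟩
        have : (l.map fun j => a j ^ (α + Pi.single i 1 : Fin n → ℕ) j) =
            l.map fun j => a j ^ α j := by
          refine List.map_congr_left fun k hk => ?_
          have : k ≠ i := fun h => hl.1 (h ▸ hk)
          simp [this]
        rw [List.map_cons, List.map_cons, this]
        simp only [List.prod_cons, pow_zero, one_mul, Pi.add_apply, Pi.single_eq_same,
          pow_succ', mul_assoc]
      · obtain ⟨e, he⟩ := ih hl.2 (by simpa [hij] using hi)
        refine ⟨α j + e, ?_⟩
        have hc : Commute (a j ^ α j) (ζ ^ e) :=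
          (show Commute (a j) ζ from (hζ j).symm).pow_pow _ _
        rw [List.map_cons, List.map_cons, List.prod_cons, List.prod_cons, ← mul_assoc,
          hpow j hij, mul_assoc _ (a i), he, mul_assoc, ← mul_assoc (a j ^ _), hc.eq, pow_add]
        simp [Ne.symm hij, mul_assoc]
  simp only [powProd_eq]
  exact key _ (List.nodup_finRange n) (List.mem_finRange i)

theorem commute_powProd (hζ : ∀ i, ζ * a i = a i * ζ) (α : Fin n → ℕ) :
    Commute ζ (powProd a α) := by
  rw [powProd_eq]
  refine Commute.list_prod_right _ _ fun b hb => ?_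
  obtain ⟨i, -, rfl⟩ := List.mem_map.mp hb
  exact (show Commute ζ (a i) from hζ i).pow_right _

end PowProd

theorem powProd_mul_mem {E : Type*} [Ring E] [Algebra ℂ E] {n : ℕ} {a : Fin n → E}
    {S : Submodule ℂ E} (h : ∀ i, ∀ v ∈ S, a i * v ∈ S) (α : Fin n → ℕ) {v : E} (hv : v ∈ S) :
    powProd a α * v ∈ S := by
  have hpow : ∀ i (k : ℕ), ∀ v ∈ S, a i ^ k * v ∈ S := by
    intro i k
    induction k with
    | zero => intro v hv; simpa using hv
    | succ k ih => intro v hv; rw [pow_succ, mul_assoc]; exact ih _ (h i v hv)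
  rw [powProd_eq]
  generalize List.finRange n = l
  induction l with
  | nil => simpa using hv
  | cons i l ih => rw [List.map_cons, List.prod_cons, mul_assoc]; exact hpow i _ _ ih

namespace ReflectionDatum

variable {G : Type*} [Group G] {n : ℕ} (D : ReflectionDatum G n)
  {E : Type*} [Ring E] [Algebra ℂ E] (ρ : G →* E) (x y : Fin n → E)

/-- The span of the ordered monomials. -/
def monomialSpan : Submodule ℂ E :=
  Submodule.span ℂ (Set.range fun t : (Fin n → ℕ) × G × (Fin n → ℕ) =>
    powProd x t.1 * ρ t.2.1 * powProd y t.2.2)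

variable {ρ x y}

theorem monomial_mem (α : Fin n → ℕ) (w : G) (γ : Fin n → ℕ) :
    powProd x α * ρ w * powProd y γ ∈ monomialSpan ρ x y :=
  Submodule.subset_span ⟨(α, w, γ), rfl⟩

theorem base_mem (w : G) (γ : Fin n → ℕ) : ρ w * powProd y γ ∈ monomialSpan ρ x y := by
  have := monomial_mem (ρ := ρ) (x := x) (y := y) 0 w γ
  simpa [powProd] using this

/-- This is the induction principle behind stability of the span under the group and the y_i: take
for `S` the elements that a given left multiplication sends into the span. -/
theorem monomialSpan_le {S : Submodule ℂ E} (h0 : ∀ w γ, ρ w * powProd y γ ∈ S)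
    (h1 : ∀ i, ∀ v ∈ S, x i * v ∈ S) : monomialSpan ρ x y ≤ S := by
  refine Submodule.span_le.mpr ?_
  rintro _ ⟨⟨α, w, γ⟩, rfl⟩
  change powProd x α * ρ w * powProd y γ ∈ S
  rw [mul_assoc]
  exact powProd_mul_mem h1 α (h0 w γ)

variable {D}

namespace Model

variable (h : D.Model ρ x y)
include h

theorem zp_mul_mem (e : ℤˣ) {v : E} (hv : v ∈ monomialSpan ρ x y) :
    ρ (D.zp e) * v ∈ monomialSpan ρ x y := by
  suffices hs : monomialSpan ρ x y ≤
      (monomialSpan ρ x y).comap (LinearMap.mulLeft ℂ (ρ (D.zp e))) from hs hv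
  refine Submodule.span_le.mpr ?_
  rintro _ ⟨⟨α, w, γ⟩, rfl⟩
  change ρ (D.zp e) * (powProd x α * ρ w * powProd y γ) ∈ monomialSpan ρ x y
  rw [← mul_assoc, ← mul_assoc, (commute_powProd (h.zp_x e) α).eq, mul_assoc (powProd x α),
    ← map_mul]
  exact monomial_mem _ _ _

theorem x_mul_mem (i : Fin n) {v : E} (hv : v ∈ monomialSpan ρ x y) :
    x i * v ∈ monomialSpan ρ x y := by
  suffices hs : monomialSpan ρ x y ≤
      (monomialSpan ρ x y).comap (LinearMap.mulLeft ℂ (x i)) from hs hv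
  refine Submodule.span_le.mpr ?_
  rintro _ ⟨⟨α, w, γ⟩, rfl⟩
  change x i * (powProd x α * ρ w * powProd y γ) ∈ monomialSpan ρ x y
  obtain ⟨e, he⟩ := exists_mul_powProd (h.zp_x (-1)) h.x_x i α
  rw [← mul_assoc, ← mul_assoc, he, ← map_pow, ← map_pow, mul_assoc, mul_assoc,
    ← mul_assoc (powProd x _)]
  exact h.zp_mul_mem _ (monomial_mem _ _ _)

theorem group_mul_mem (g : G) {v : E} (hv : v ∈ monomialSpan ρ x y) :
    ρ g * v ∈ monomialSpan ρ x y := by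
  suffices hs : monomialSpan ρ x y ≤
      (monomialSpan ρ x y).comap (LinearMap.mulLeft ℂ (ρ g)) from hs hv
  refine monomialSpan_le (fun w γ => ?_) fun i v hv => ?_
  · change ρ g * (ρ w * powProd y γ) ∈ monomialSpan ρ x y
    rw [← mul_assoc, ← map_mul]
    exact base_mem _ _
  · change ρ g * (x i * v) ∈ monomialSpan ρ x y
    rw [← mul_assoc, h.mul_x g i, smul_mul_assoc, mul_assoc, mul_assoc]
    exact Submodule.smul_mem _ _ (h.zp_mul_mem _ (h.x_mul_mem _ hv))

theorem comm_mul_mem (i k : Fin n) {v : E} (hv : v ∈ monomialSpan ρ x y) :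
    D.comm ρ i k * v ∈ monomialSpan ρ x y := by
  unfold comm
  split_ifs
  · simp only [sub_mul, neg_mul, Finset.sum_mul, smul_mul_assoc]
    refine sub_mem (neg_mem (sum_mem fun _ _ => sum_mem fun _ _ => ?_)) ?_
    all_goals exact Submodule.smul_mem _ _ (h.group_mul_mem _ hv)
  · simp only [Finset.sum_mul, smul_mul_assoc]
    exact sum_mem fun _ _ => Submodule.smul_mem _ _ (h.group_mul_mem _ hv)

theorem y_mul_mem (i : Fin n) {v : E} (hv : v ∈ monomialSpan ρ x y) :
    y i * v ∈ monomialSpan ρ x y := by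
  -- As in the quotient module, the term [y_i, x_k] v is controlled only if `v` itself is known to
  -- lie in the span.
  suffices hs : monomialSpan ρ x y ≤ monomialSpan ρ x y ⊓
      (monomialSpan ρ x y).comap (LinearMap.mulLeft ℂ (y i)) from (hs hv).2
  refine monomialSpan_le (fun w γ => ⟨base_mem w γ, ?_⟩) fun k v hv =>
    ⟨h.x_mul_mem k hv.1, ?_⟩
  · change y i * (ρ w * powProd y γ) ∈ monomialSpan ρ x y
    -- The relation for w y_j is read backwards, as y_i w = ± w y_j with i = w j.
    obtain ⟨j, hj⟩ := (D.act w).perm.surjective i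
    have h1 := h.mul_y w j
    rw [hj] at h1
    apply_fun (sc ((D.act w).sgn j) • ·) at h1
    simp only [smul_smul, sc_mul_self, one_smul] at h1
    obtain ⟨e, he⟩ := exists_mul_powProd (a := y) (ζ := 1) (by simp)
      (fun i j _ => by rw [one_mul, h.y_y]) j γ
    rw [← mul_assoc, ← h1, smul_mul_assoc, mul_assoc, he, one_pow, one_mul]
    exact Submodule.smul_mem _ _ (base_mem _ _)
  · change y i * (x k * v) ∈ monomialSpan ρ x y
    rw [← mul_assoc, h.y_x, add_mul, mul_assoc]
    exact add_mem (h.x_mul_mem k hv.2) (h.comm_mul_mem i k hv.1)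

/-- The ordered monomials span an algebra generated by the `x_i`, the `y_i` and the group. -/
theorem monomialSpan_eq_top
    (hgen : Algebra.adjoin ℂ (Set.range ρ ∪ Set.range x ∪ Set.range y) = ⊤) :
    monomialSpan ρ x y = ⊤ := by
  have key : ∀ a ∈ Algebra.adjoin ℂ (Set.range ρ ∪ Set.range x ∪ Set.range y),
      ∀ v ∈ monomialSpan ρ x y, a * v ∈ monomialSpan ρ x y := by
    intro a ha
    induction ha using Algebra.adjoin_induction with
    | mem a ha =>
      intro v hv
      rcases ha with (⟨g, rfl⟩ | ⟨i, rfl⟩) | ⟨i, rfl⟩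
      · exact h.group_mul_mem g hv
      · exact h.x_mul_mem i hv
      · exact h.y_mul_mem i hv
    | algebraMap c =>
      intro v hv
      rw [← Algebra.smul_def]
      exact Submodule.smul_mem _ _ hv
    | add a b _ _ ha hb =>
      intro v hv
      rw [add_mul]
      exact add_mem (ha v hv) (hb v hv)
    | mul a b _ _ ha hb =>
      intro v hv
      rw [mul_assoc]
      exact ha _ (hb v hv)
  refine eq_top_iff.mpr fun a _ => ?_
  have h1 : (1 : E) ∈ monomialSpan ρ x y := by
    have := base_mem (ρ := ρ) (x := x) (y := y) 1 0
    simpa [powProd] using this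
  simpa using key a (hgen ▸ Algebra.mem_top) 1 h1

end Model
end ReflectionDatum
end CDaHa

/-! ### Words in the generators and twisted conjugation -/

namespace CDaHa

section Words

variable {G : Type*} [Monoid G] (t : ℕ → G)

theorem asc_self (a : ℕ) : asc t a a = 1 := by simp [asc]

theorem desc_self (a : ℕ) : desc t a a = 1 := by simp [desc]

theorem asc_left {a b : ℕ} (h : a < b) : asc t a b = t a * asc t (a + 1) b := by
  simp [asc, List.Ico.eq_cons h]

theorem desc_left {a b : ℕ} (h : a < b) : desc t a b = desc t (a + 1) b * t a := by
  simp [desc, List.Ico.eq_cons h]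

theorem asc_right {a b : ℕ} (h : a ≤ b) : asc t a (b + 1) = asc t a b * t b := by
  simp [asc, List.Ico.succ_top h]

theorem desc_right {a b : ℕ} (h : a ≤ b) : desc t a (b + 1) = t b * desc t a b := by
  simp [desc, List.Ico.succ_top h]

end Words

section Twist

variable {G : Type*} [Monoid G] (z : G)

/-- Conjugation by an element of order two, followed by multiplication by `z`. -/
def twist (t h : G) : G := z * (t * h * t)

variable {z} (hz : ∀ g, z * g = g * z) (hz2 : z * z = 1)
include hz hz2

theorem pull_two (a b c d e : G) : z * (a * (z * (b * c * d)) * e) = a * b * c * (d * e) := by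
  rw [← mul_assoc a z, ← hz a, mul_assoc z a, mul_assoc z, ← mul_assoc z z, hz2, one_mul]
  simp only [mul_assoc]

theorem twist_twist {t : G} (ht : t * t = 1) (h : G) : twist z t (twist z t h) = h := by
  rw [twist, twist, pull_two hz hz2, ht, one_mul, mul_one]

omit hz in
theorem eq_mul_of_anticomm {s t : G} (h : t * s = z * (s * t)) : s * t = z * (t * s) := by
  rw [h, ← mul_assoc, hz2, one_mul]

theorem twist_comm {s t : G} (h : t * s = z * (s * t)) (g : G) :
    twist z t (twist z s g) = twist z s (twist z t g) := by
  simp only [twist]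
  rw [pull_two hz hz2, pull_two hz hz2, h, mul_assoc z, mul_assoc z, hz, mul_assoc, ← hz]

/-- Three twists contribute z³ = z on either side, and the remaining conjugations are by equal
elements. -/
theorem twist_braid {s t : G} (h : t * s * t = s * t * s) (g : G) :
    twist z t (twist z s (twist z t g)) = twist z s (twist z t (twist z s g)) := by
  have e : ∀ s t : G, twist z t (twist z s (twist z t g)) =
      z * (t * s * t * g * (t * s * t)) := by
    intro s t
    simp only [twist]
    rw [pull_two hz hz2, ← mul_assoc (t * s) z, ← hz (t * s)]
    simp only [mul_assoc]
  rw [e, e, h]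

/-- Four twists contribute z⁴ = 1. The relation is used on both sides of `g`, so its two factors z
cancel. -/
theorem twist_quart {s t : G} (h : (t * s) ^ 2 = z * (s * t) ^ 2) (g : G) :
    twist z t (twist z s (twist z t (twist z s g))) =
      twist z s (twist z t (twist z s (twist z t g))) := by
  have e : ∀ s t : G, twist z t (twist z s (twist z t (twist z s g))) =
      (t * s) ^ 2 * g * (s * t) ^ 2 := by
    intro s t
    simp only [twist]
    rw [pull_two hz hz2, pull_two hz hz2, pow_two, pow_two]
    simp only [mul_assoc]
  have h' : (s * t) ^ 2 = z * (t * s) ^ 2 := by rw [h, ← mul_assoc, hz2, one_mul]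
  rw [e, e, h', ← mul_assoc, ← hz]
  simp only [mul_assoc]

omit hz in
-- The z of the twist cancels the z of the anticommutation: a reflection fixes an orthogonal root.
-- This is the reason for putting z into `twist`.
theorem twist_apply_anticomm {s t : G} (ht : t * t = 1) (h : t * s = z * (s * t)) :
    twist z t s = s := by
  rw [twist, h, mul_assoc z, ← mul_assoc z z, hz2, one_mul, mul_assoc, ht, mul_one]

omit hz hz2 in
theorem twist_apply_self {t : G} (ht : t * t = 1) : twist z t t = z * t := by
  rw [twist, ht, one_mul]

theorem twist_apply_quart {s t : G} (ht : t * t = 1) (h : (t * s) ^ 2 = z * (s * t) ^ 2) :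
    twist z t (twist z s t) = twist z s t := by
  rw [twist, twist, pull_two hz hz2]
  calc t * s * t * (s * t) = (t * s) ^ 2 * t := by simp only [pow_two, mul_assoc]
    _ = z * (s * t * s * (t * t)) := by rw [h]; simp only [pow_two, mul_assoc]
    _ = z * (s * t * s) := by rw [ht, mul_one]

omit hz2 in
theorem twist_mul (t h : G) : twist z t (z * h) = z * twist z t h := by
  rw [twist, twist, ← mul_assoc t z, ← hz t]
  simp only [mul_assoc]

/-- The generators play both roles, that of the simple reflections through `twist` and that of the
simple roots, with multiplication by z as negation. Each axiom is one defining relation of the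
cover. -/
theorem pathSystem_twist {t : ℕ → G} {N : ℕ} (sq : ∀ k < N, t k * t k = 1)
    (far : ∀ k l, k + 1 < l → l < N → t k * t l = z * (t l * t k))
    (near : ∀ k, k + 1 < N → t k * t (k + 1) * t k = t (k + 1) * t k * t (k + 1)) :
    PathSystem (z * ·) N (fun k => twist z (t k)) t where
  invol k hk v := twist_twist hz hz2 (sq k hk) v
  comm k l hkl hl v := twist_comm hz hz2 (far k l hkl hl) v
  braid k hk v := twist_braid hz hz2 (near k hk) v
  apply_far k l hkl hl := twist_apply_anticomm hz2 (sq k (by omega)) (far k l hkl hl)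
  apply_far' k l hkl hl := twist_apply_anticomm hz2 (sq l hl)
    (eq_mul_of_anticomm hz2 (far k l hkl hl))
  apply_near k hk := by
    change z * _ = z * _
    rw [near k hk]
  apply_self k hk := twist_apply_self (sq k hk)

theorem forkSystem_twist {t : ℕ → G} {N : ℕ} {b : G} (sq : ∀ k < N, t k * t k = 1)
    (far : ∀ k l, k + 1 < l → l < N → t k * t l = z * (t l * t k))
    (near : ∀ k, k + 1 < N → t k * t (k + 1) * t k = t (k + 1) * t k * t (k + 1))
    (sq_b : b * b = 1) (far_b : ∀ k, k + 2 < N → t k * b = z * (b * t k))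
    (near_b : ∀ k, k + 2 = N → t k * b * t k = b * t k * b)
    (last_b : ∀ k, k + 1 = N → t k * b = z * (b * t k)) :
    ForkSystem (z * ·) N (fun k => twist z (t k))
      (fun k => twist z (Function.update t (N - 1) b k)) t (Function.update t (N - 1) b) where
  path := pathSystem_twist hz hz2 sq far near
  path' := by
    refine pathSystem_twist hz hz2 (fun k hk => ?_) (fun k l hkl hl => ?_) (fun k hk => ?_)
    · by_cases h : k = N - 1
      · simp [h, sq_b]
      · simp [h, sq k hk]
    · by_cases h : l = N - 1
      · simp [h, show k ≠ N - 1 by omega, far_b k (by omega)]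
      · simp [h, show k ≠ N - 1 by omega, far k l hkl hl]
    · by_cases h : k + 1 = N - 1
      · simp [h, show k ≠ N - 1 by omega, near_b k (by omega)]
      · simp [h, show k ≠ N - 1 by omega, near k hk]
  f_eq k hk := by
    funext v
    simp [show k ≠ N - 1 by omega]
  e_eq k hk := by simp [show k ≠ N - 1 by omega]
  last_comm k hk v := by
    simp only [show k = N - 1 by omega, Function.update_self]
    exact twist_comm hz hz2 (last_b _ (by omega)) v
  last_apply k hk := by
    simp only [show k = N - 1 by omega, Function.update_self]
    exact twist_apply_anticomm hz2 (sq _ (by omega)) (last_b _ (by omega))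
  last_apply' k hk := by
    simp only [show k = N - 1 by omega, Function.update_self]
    exact twist_apply_anticomm hz2 sq_b (eq_mul_of_anticomm hz2 (last_b _ (by omega)))

theorem quartSystem_twist {t : ℕ → G} {m : ℕ} {a : G} (sq : ∀ k < m + 1, t k * t k = 1)
    (far : ∀ k l, k + 1 < l → l < m + 1 → t k * t l = z * (t l * t k))
    (near : ∀ k, k + 1 < m + 1 → t k * t (k + 1) * t k = t (k + 1) * t k * t (k + 1))
    (sq_a : a * a = 1) (far_a : ∀ k < m, t k * a = z * (a * t k))
    (last_a : (t m * a) ^ 2 = z * (a * t m) ^ 2) :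
    QuartSystem (z * ·) m (fun k => twist z (t k)) t (twist z a) a where
  path := pathSystem_twist hz hz2 sq far near
  invol := twist_twist hz hz2 sq_a
  comm k hk v := twist_comm hz hz2 (far_a k hk) v
  map_neg := twist_mul hz a
  apply_far k hk := twist_apply_anticomm hz2 sq_a (eq_mul_of_anticomm hz2 (far_a k hk))
  quart v := twist_quart hz hz2 last_a v
  quart_apply := twist_apply_quart hz hz2 (sq m (by omega)) last_a
  quart_apply' := twist_apply_quart hz hz2 sq_a (by rw [last_a, ← mul_assoc, hz2, one_mul])
  far_apply k hk := twist_apply_anticomm hz2 (sq k (by omega)) (far_a k hk)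
  apply_self := twist_apply_self sq_a

variable (t : ℕ → G)

omit hz hz2 in
theorem refl_base (i : ℕ) : refl z t i (i + 1) = t i := by
  simp [refl, asc_self, desc_self]

omit hz hz2 in
theorem refl_rev {i j : ℕ} (h : i < j) : refl z t j i = z * refl z t i j := by
  simp [refl, h, h.not_gt]

omit hz2 in
theorem pow_comm' (k : ℕ) (g : G) : z ^ k * g = g * z ^ k :=
  ((show Commute z g from hz g).pow_left k).eq

omit hz2 in
theorem twist_pow_mul (s : G) (k : ℕ) (a : G) :
    twist z s (z ^ k * a) = z ^ (k + 1) * (s * a * s) := by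
  rw [twist, ← mul_assoc s, ← pow_comm' hz, pow_succ']
  simp only [mul_assoc]

omit hz2 in
theorem refl_step {i j : ℕ} (h : i < j) :
    refl z t i (j + 1) = twist z (t j) (refl z t i j) := by
  simp only [refl, h, h.trans (Nat.lt_succ_self j), if_true]
  rw [twist_pow_mul hz, desc_right t (by omega), asc_right t (by omega),
    show j + 1 - i - 1 = j - i - 1 + 1 by omega]
  simp only [mul_assoc]

omit hz in
theorem pow_add_two (k : ℕ) : z ^ (k + 2) = z ^ k := by
  rw [pow_add, pow_two, hz2, mul_one]

omit hz hz2 in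
theorem barReflD_base (n : ℕ) : barReflD (n + 2) z t n (n + 1) = t (n + 1) := by
  simp [barReflD, barReflDLt, asc_self, desc_self]

omit hz hz2 in
theorem barReflD_comm (n i j : ℕ) : barReflD n z t j i = barReflD n z t i j := by
  rw [barReflD, barReflD, min_comm, max_comm]

omit hz2 in
theorem barReflD_left {n i : ℕ} (h : i < n) :
    barReflD (n + 2) z t i (n + 1) = twist z (t i) (barReflD (n + 2) z t (i + 1) (n + 1)) := by
  rw [barReflD, barReflD, min_eq_left (by omega), min_eq_left (by omega), max_eq_right (by omega),
    max_eq_right (by omega), barReflDLt, barReflDLt, twist_pow_mul hz]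
  simp only [show n + 2 - 1 = n + 1 by omega, show n + 2 - 2 = n by omega, asc_self, desc_self]
  rw [asc_left t h, desc_left t h, show n + 1 - i - 1 = n + 1 - (i + 1) - 1 + 1 by omega]
  simp only [one_mul, mul_one, mul_assoc]

/-- Lowering j lowers the exponent of z by one, whereas the twist raises it by one; the two agree
because z² = 1. The same happens in type B. -/
theorem barReflD_right {n i j : ℕ} (hij : i < j) (h : j < n + 1) :
    barReflD (n + 2) z t i j = twist z (t j) (barReflD (n + 2) z t i (j + 1)) := by
  rw [barReflD, barReflD, min_eq_left (by omega), min_eq_left (by omega), max_eq_right (by omega),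
    max_eq_right (by omega), barReflDLt, barReflDLt, twist_pow_mul hz]
  simp only [show n + 2 - 1 = n + 1 by omega, show n + 2 - 2 = n by omega]
  rw [asc_left t h, desc_left t h, show j + 1 - i - 1 + 1 = (j - i - 1) + 2 by omega,
    pow_add_two hz2]
  simp only [mul_assoc]

omit hz hz2 in
theorem barReflB_base (n : ℕ) :
    barReflB (n + 2) z t n (n + 1) = twist z (t (n + 1)) (t n) := by
  simp [barReflB, barReflBLt, asc_self, desc_self, twist]

omit hz hz2 in
theorem barReflB_comm (n i j : ℕ) : barReflB n z t j i = barReflB n z t i j := by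
  rw [barReflB, barReflB, min_comm, max_comm]

omit hz2 in
theorem barReflB_left {n i : ℕ} (h : i < n) :
    barReflB (n + 2) z t i (n + 1) = twist z (t i) (barReflB (n + 2) z t (i + 1) (n + 1)) := by
  rw [barReflB, barReflB, min_eq_left (by omega), min_eq_left (by omega), max_eq_right (by omega),
    max_eq_right (by omega), barReflBLt, barReflBLt, twist_pow_mul hz]
  simp only [show n + 2 - 1 = n + 1 by omega, show n + 2 - 2 = n by omega, asc_self, desc_self]
  rw [asc_left t h, desc_left t h, show n + 1 - i = n + 1 - (i + 1) + 1 by omega]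
  simp only [one_mul, mul_one, mul_assoc]

theorem barReflB_right {n i j : ℕ} (hij : i < j) (h : j < n + 1) :
    barReflB (n + 2) z t i j = twist z (t j) (barReflB (n + 2) z t i (j + 1)) := by
  rw [barReflB, barReflB, min_eq_left (by omega), min_eq_left (by omega), max_eq_right (by omega),
    max_eq_right (by omega), barReflBLt, barReflBLt, twist_pow_mul hz]
  simp only [show n + 2 - 1 = n + 1 by omega, show n + 2 - 2 = n by omega]
  rw [asc_left t h, desc_left t h, show j + 1 - i + 1 = (j - i) + 2 by omega,
    pow_add_two hz2]
  simp only [mul_assoc]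

omit hz hz2 in
theorem signChange_last (n : ℕ) : signChange (n + 1) z t n = t n := by
  simp [signChange, asc_self, desc_self]

omit hz2 in
theorem signChange_step {n i : ℕ} (h : i < n) :
    signChange (n + 1) z t i = twist z (t i) (signChange (n + 1) z t (i + 1)) := by
  rw [signChange, signChange, twist_pow_mul hz]
  simp only [show n + 1 - 1 = n by omega]
  rw [asc_left t h, desc_left t h, show n - i = n - (i + 1) + 1 by omega]
  simp only [mul_assoc]

end Twist

end CDaHa

/-! ### The double cover and its action by signed permutations -/

namespace CDaHa

/-- The transposition `(k, k + 1)` of natural numbers. -/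
def sw (k i : ℕ) : ℕ := if i = k then k + 1 else if i = k + 1 then k else i

/-- The cases of a `PairFamily` become one formula once the family is extended to reversed pairs by
`neg`. This handles the sign in the case where the transposition reverses the pair. For {i,j}
negation is multiplication by z, for the overlined elements it is the identity. -/
theorem PairFamily.apply_sw {V : Type*} {neg : V → V} {N : ℕ} {f : ℕ → V → V} {r : ℕ → ℕ → V}
    (h : PairFamily neg N f r) (hneg : ∀ v, neg (neg v) = v)
    (hf : ∀ k < N, ∀ v, f k (neg v) = neg (f k v)) (hr : ∀ i j, i < j → r j i = neg (r i j))
    {k i j : ℕ} (hk : k < N) (hi : i ≤ N) (hj : j ≤ N) (hij : i ≠ j) :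
    f k (r i j) = r (sw k i) (sw k j) := by
  have key : ∀ i j, i < j → j ≤ N → f k (r i j) = r (sw k i) (sw k j) := by
    intro i j hij hj
    unfold sw
    by_cases h1 : i = k
    · subst h1
      by_cases h2 : j = i + 1
      · subst h2
        simp [h.self i hk, hr i (i + 1) hij]
      · simp [h2, hij.ne', h.left i j (by omega) hj]
    · by_cases h2 : i = k + 1
      · subst h2
        simp [hij.ne', show j ≠ k by omega, h.left' k j hij hj]
      · by_cases h3 : j = k
        · subst h3
          simp [h1, h2, h.right i j hij hk]
        · by_cases h4 : j = k + 1
          · subst h4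
            simp [h1, h2, h.right' i k (by omega) hk]
          · simp only [h1, h2, h3, h4, if_false]
            rcases lt_or_gt_of_ne h1 with h5 | h5
            · rcases lt_or_gt_of_ne h3 with h6 | h6
              · exact h.above k i j hij h6 hk
              · exact h.mid k i j h5 (by omega) hj
            · exact h.below k i j (by omega) hij hj
  have hr' : ∀ i j, i ≠ j → r j i = neg (r i j) := by
    intro i j hij
    rcases lt_or_gt_of_ne hij with h | h
    · exact hr i j h
    · rw [hr j i h, hneg]
  have hsw : sw k i ≠ sw k j := by unfold sw; split_ifs <;> omega
  rcases lt_or_gt_of_ne hij with h1 | h1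
  · exact key i j h1 hj
  · rw [hr' j i h1.ne, hf k hk, key j i h1 hi, ← hr' _ _ hsw.symm]

theorem swap_val {n k : ℕ} (hk : k < n) (hk' : k + 1 < n) (i : Fin n) :
    ((Equiv.swap (⟨k, hk⟩ : Fin n) ⟨k + 1, hk'⟩ i : Fin n) : ℕ) = sw k i := by
  unfold sw
  rw [Equiv.swap_apply_def]
  simp only [Fin.ext_iff]
  split_ifs <;> rfl

section Group

variable {X : ClassicalType} {n : ℕ}

/-- The central generator of the double cover. -/
def cz : CoverGroup X n := PresentedGroup.of CoverGen.z

/-- The other generators of the double cover. -/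
def ct (i : Fin (rank X n)) : CoverGroup X n := PresentedGroup.of (CoverGen.t i)

/-- The generators indexed by natural numbers. -/
def ctNat (i : ℕ) : CoverGroup X n := if h : i < rank X n then ct ⟨i, h⟩ else 1

theorem CoverGroup.rel {a b : CoverGroup X n} (hab : CoverRel X n cz ct a b) : a = b := by
  have key : ∀ {a b : FreeGroup (CoverGen X n)}, CoverRel X n (FreeGroup.of CoverGen.z)
      (fun i => FreeGroup.of (CoverGen.t i)) a b →
      PresentedGroup.mk {r : FreeGroup (CoverGen X n) | ∃ a b,
        CoverRel X n (FreeGroup.of CoverGen.z) (fun i => FreeGroup.of (CoverGen.t i)) a b ∧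
          r = a * b⁻¹} a = PresentedGroup.mk _ b := fun {a b} h => by
    rw [← mul_inv_eq_one, ← map_inv, ← map_mul]
    exact PresentedGroup.one_of_mem ⟨a, b, h, rfl⟩
  change CoverRel X n (PresentedGroup.mk _ (FreeGroup.of CoverGen.z))
    (fun i => PresentedGroup.mk _ (FreeGroup.of (CoverGen.t i))) a b at hab
  cases hab with
  | z_sq => simpa only [map_mul, map_pow, map_one] using key CoverRel.z_sq
  | z_central i => simpa only [map_mul, map_pow, map_one] using key (CoverRel.z_central i)
  | t_sq i => simpa only [map_mul, map_pow, map_one] using key (CoverRel.t_sq i)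
  | two i j h => simpa only [map_mul, map_pow, map_one] using key (CoverRel.two i j h)
  | three i j h => simpa only [map_mul, map_pow, map_one] using key (CoverRel.three i j h)
  | four i j h => simpa only [map_mul, map_pow, map_one] using key (CoverRel.four i j h)

theorem cz_mul_self : (cz : CoverGroup X n) * cz = 1 := CoverGroup.rel .z_sq

theorem ct_mul_self (i : Fin (rank X n)) : ct i * ct i = 1 := CoverGroup.rel (.t_sq i)

/-- Inverses need no clause, since all generators are involutions. -/
theorem CoverGroup.induction {p : CoverGroup X n → Prop} (one : p 1) (z : p cz)
    (t : ∀ i, p (ct i)) (mul : ∀ g h, p g → p h → p (g * h)) (g : CoverGroup X n) : p g := by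
  have gen : ∀ a : CoverGen X n, p (PresentedGroup.of a) := by
    rintro (_ | i)
    · exact z
    · exact t i
  induction g using PresentedGroup.induction_on with
  | _ a =>
    induction a using FreeGroup.induction_on with
    | C1 => simpa using one
    | of a => exact gen a
    | inv_of a _ =>
      have : (PresentedGroup.of a : CoverGroup X n)⁻¹ = PresentedGroup.of a := by
        rw [inv_eq_iff_mul_eq_one]
        rcases a with _ | i
        · exact cz_mul_self
        · exact ct_mul_self i
      rw [map_inv]
      exact this ▸ gen a
    | mul a b ha hb =>
      rw [map_mul]
      exact mul _ _ ha hb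

theorem cz_comm (g : CoverGroup X n) : cz * g = g * cz := by
  induction g using CoverGroup.induction with
  | one => simp
  | z => rfl
  | t i => exact CoverGroup.rel (.z_central i)
  | mul g h hg hh => rw [← mul_assoc, hg, mul_assoc, hh, mul_assoc]

/-- The homomorphism `-1 ↦ z`. -/
def czHom : ℤˣ →* CoverGroup X n where
  toFun e := if e = 1 then 1 else cz
  map_one' := if_pos rfl
  map_mul' e e' := by
    rcases Int.units_eq_one_or e with rfl | rfl <;>
      rcases Int.units_eq_one_or e' with rfl | rfl <;> simp [cz_mul_self]

theorem czHom_neg_one : (czHom (-1) : CoverGroup X n) = cz := rfl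

theorem czHom_comm (e : ℤˣ) (g : CoverGroup X n) : czHom e * g = g * czHom e := by
  rcases Int.units_eq_one_or e with rfl | rfl
  · simp
  · exact cz_comm g

theorem lt_rank {k : ℕ} (h : k + 1 < n) : k < rank X n := by
  cases X <;> simp only [rank] <;> omega

theorem coxeterInt_of_lt {i j : ℕ} (hi : i + 1 < n) (hj : j + 1 < n) :
    coxeterInt X n i j = coxeterInt .A n i j := by
  cases X
  · rfl
  · simp only [coxeterInt]
    split_ifs <;> omega
  · simp only [coxeterInt]
    split_ifs <;> omega

theorem ctNat_of_lt {k : ℕ} (h : k < rank X n) : (ctNat k : CoverGroup X n) = ct ⟨k, h⟩ :=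
  dif_pos h

theorem ctNat_mul_self (k : ℕ) : (ctNat k : CoverGroup X n) * ctNat k = 1 := by
  unfold ctNat
  split_ifs
  · exact ct_mul_self _
  · simp

theorem ctNat_two {i j : ℕ} (hi : i < rank X n) (hj : j < rank X n)
    (h : coxeterInt X n i j = 2) :
    (ctNat i : CoverGroup X n) * ctNat j = cz * (ctNat j * ctNat i) := by
  rw [ctNat_of_lt hi, ctNat_of_lt hj]
  exact CoverGroup.rel (.two ⟨i, hi⟩ ⟨j, hj⟩ h)

theorem ctNat_three {i j : ℕ} (hi : i < rank X n) (hj : j < rank X n)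
    (h : coxeterInt X n i j = 3) :
    (ctNat i : CoverGroup X n) * ctNat j * ctNat i = ctNat j * ctNat i * ctNat j := by
  rw [ctNat_of_lt hi, ctNat_of_lt hj]
  exact CoverGroup.rel (.three ⟨i, hi⟩ ⟨j, hj⟩ h)

theorem ctNat_four {i j : ℕ} (hi : i < rank X n) (hj : j < rank X n)
    (h : coxeterInt X n i j = 4) :
    ((ctNat i : CoverGroup X n) * ctNat j) ^ 2 = cz * (ctNat j * ctNat i) ^ 2 := by
  rw [ctNat_of_lt hi, ctNat_of_lt hj]
  exact CoverGroup.rel (.four ⟨i, hi⟩ ⟨j, hj⟩ h)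

theorem ctNat_far {k l : ℕ} (h : k + 1 < l) (hl : l + 1 < n) :
    (ctNat k : CoverGroup X n) * ctNat l = cz * (ctNat l * ctNat k) := by
  refine ctNat_two (lt_rank (by omega)) (lt_rank hl) ?_
  rw [coxeterInt_of_lt (by omega) hl, coxeterInt, if_neg (by omega), if_neg (by omega)]

theorem ctNat_near {k : ℕ} (h : k + 1 + 1 < n) :
    (ctNat k : CoverGroup X n) * ctNat (k + 1) * ctNat k =
      ctNat (k + 1) * ctNat k * ctNat (k + 1) := by
  refine ctNat_three (lt_rank (by omega)) (lt_rank h) ?_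
  rw [coxeterInt_of_lt (by omega) h, coxeterInt, if_neg (by omega), if_pos (by omega)]

/-- The parity of the double cover. -/
def coverPar : CoverGroup X n →* ℤˣ :=
  CoverGroup.lift 1 (fun _ => -1) (by
    intro a b h
    cases h <;> simp)

theorem coverPar_cz : coverPar (cz : CoverGroup X n) = 1 := CoverGroup.lift_z _ _ _

theorem coverPar_ct (i : Fin (rank X n)) : coverPar (ct i) = -1 := CoverGroup.lift_t _ _ _ i

/-- The action of the simple reflections by signed permutations, where the last one may be
special. -/
def simpleAct (last : SPerm n) (k : ℕ) : SPerm n :=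
  if h : k + 1 < n then SPerm.pair ⟨k, by omega⟩ ⟨k + 1, h⟩ 1 else last

theorem simpleAct_of_lt (last : SPerm n) {k : ℕ} (h : k + 1 < n) :
    simpleAct last k = SPerm.pair ⟨k, by omega⟩ ⟨k + 1, h⟩ 1 := dif_pos h

theorem simpleAct_of_not (last : SPerm n) {k : ℕ} (h : ¬ k + 1 < n) :
    simpleAct last k = last := dif_neg h

namespace SPerm

theorem pair_sgn_one (i j l : Fin n) : (pair i j 1).sgn l = 1 := by simp [pair]

theorem pair_mul_self (i j : Fin n) (ε : ℤˣ) : pair i j ε * pair i j ε = 1 := by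
  have hp : (pair i j ε * pair i j ε).perm = (1 : SPerm n).perm := by simp [pair]
  have hq : (pair i j ε * pair i j ε).sgn = (1 : SPerm n).sgn := by
    funext l
    by_cases hi : l = i
    · simp [pair, hi, Int.units_mul_self]
    · by_cases hj : l = j
      · simp [pair, hj, Int.units_mul_self]
      · simp [pair, hi, hj, Equiv.swap_apply_of_ne_of_ne hi hj]
  exact SPerm.ext hp hq

theorem pair_commute {i j k l : Fin n} (h1 : k ≠ i) (h2 : k ≠ j) (h3 : l ≠ i) (h4 : l ≠ j)
    (ε δ : ℤˣ) : pair i j ε * pair k l δ = pair k l δ * pair i j ε := by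
  rw [mul_pair]
  simp [pair, h1, h2, h3, h4, Equiv.swap_apply_of_ne_of_ne]

/-- Both sides are conjugates of a reflection, and both equal `pair i k (ε * δ)`. -/
theorem pair_braid {i j k : Fin n} (hij : i ≠ j) (hjk : j ≠ k) (hik : i ≠ k) (ε δ : ℤˣ) :
    pair i j ε * pair j k δ * pair i j ε = pair j k δ * pair i j ε * pair j k δ := by
  rw [mul_pair (pair i j ε) j k δ, mul_assoc, pair_mul_self, mul_pair (pair j k δ) i j ε,
    mul_assoc _ (pair j k δ), pair_mul_self]
  simp [pair, hij, hik, hjk.symm, hik.symm, Equiv.swap_apply_of_ne_of_ne hij hik,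
    Equiv.swap_apply_of_ne_of_ne hik.symm hjk.symm, mul_comm]

theorem pair_pair_comm (i j : Fin n) (ε δ : ℤˣ) :
    pair i j ε * pair i j δ = pair i j δ * pair i j ε := by
  rw [mul_pair, mul_assoc δ]
  have h1 : (pair i j ε).sgn i * (pair i j ε).sgn j = 1 := by simp [pair, Int.units_mul_self]
  have h2 : (pair i j ε).perm i = j := by simp [pair]
  have h3 : (pair i j ε).perm j = i := by simp [pair]
  rw [h1, h2, h3, mul_one, pair_comm]

theorem flip_mul_self (i : Fin n) : flip i * flip i = 1 := by
  have hq : (flip i * flip i).sgn = (1 : SPerm n).sgn := by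
    funext l
    by_cases hi : l = i <;> simp [flip, hi]
  exact SPerm.ext (by simp [flip]) hq

theorem pair_flip_comm {i j k : Fin n} (hi : k ≠ i) (hj : k ≠ j) (ε : ℤˣ) :
    pair i j ε * flip k = flip k * pair i j ε := by
  rw [mul_flip]
  simp [pair, Equiv.swap_apply_of_ne_of_ne hi hj]

theorem pair_flip_quart (i j : Fin n) (ε : ℤˣ) :
    (pair i j ε * flip j) ^ 2 = (flip j * pair i j ε) ^ 2 := by
  have h1 : pair i j ε * flip j = flip i * pair i j ε := by
    rw [mul_flip]
    simp [pair]
  have h2 : flip j * flip i = flip i * flip j := by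
    have h : (flip j).perm i = i := rfl
    rw [mul_flip, h]
  calc (pair i j ε * flip j) ^ 2 = (flip i * pair i j ε) * (pair i j ε * flip j) := by
        rw [pow_two, ← h1]
    _ = flip i * (pair i j ε * pair i j ε) * flip j := by simp only [mul_assoc]
    _ = flip j * flip i := by rw [pair_mul_self, mul_one, h2]
    _ = flip j * flip i * (pair i j ε * pair i j ε) := by rw [pair_mul_self, mul_one]
    _ = flip j * (flip i * pair i j ε) * pair i j ε := by simp only [mul_assoc]
    _ = _ := by rw [← h1, pow_two]; simp only [mul_assoc]

end SPerm

theorem simpleAct_commute (last : SPerm n) {i j : ℕ} (hi : i + 1 < n) (hj : j + 1 < n)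
    (h : i + 1 < j ∨ j + 1 < i) :
    simpleAct last i * simpleAct last j = simpleAct last j * simpleAct last i := by
  rw [simpleAct_of_lt last hi, simpleAct_of_lt last hj]
  apply SPerm.pair_commute <;> simp only [ne_eq, Fin.mk.injEq] <;> omega

theorem simpleAct_braid (last : SPerm n) {i j : ℕ} (hi : i + 1 < n) (hj : j + 1 < n)
    (h : i + 1 = j ∨ j + 1 = i) :
    simpleAct last i * simpleAct last j * simpleAct last i =
      simpleAct last j * simpleAct last i * simpleAct last j := by
  rw [simpleAct_of_lt last hi, simpleAct_of_lt last hj]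
  rcases h with rfl | rfl
  · apply SPerm.pair_braid <;> simp only [ne_eq, Fin.mk.injEq] <;> omega
  · symm
    apply SPerm.pair_braid <;> simp only [ne_eq, Fin.mk.injEq] <;> omega

end Group

end CDaHa

/-! ### From the generators to a reflection datum -/

namespace CDaHa

section

variable {X : ClassicalType} {n : ℕ}

/-- The action of the double cover by signed permutations. -/
def coverAct (last : SPerm n)
    (h : ∀ a b, CoverRel X n 1 (fun k => simpleAct last k) a b → a = b) :
    CoverGroup X n →* SPerm n :=
  CoverGroup.lift 1 (fun k => simpleAct last k) h

theorem coverAct_cz (last : SPerm n)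
    (h : ∀ a b, CoverRel X n 1 (fun k => simpleAct last k) a b → a = b) :
    coverAct last h cz = 1 := CoverGroup.lift_z _ _ _

theorem coverAct_ct (last : SPerm n)
    (h : ∀ a b, CoverRel X n 1 (fun k => simpleAct last k) a b → a = b) (k : Fin (rank X n)) :
    coverAct last h (ct k) = simpleAct last k := CoverGroup.lift_t _ _ _ k

theorem map_twist {G H : Type*} [Monoid G] [Monoid H] (f : G →* H) (z t h : G) :
    f (twist z t h) = twist (f z) (f t) (f h) := by
  simp [twist]

theorem mul_eq_of_twist {G : Type*} [Group G] {z t h h' : G} (hz : z * z = 1) (ht : t * t = 1)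
    (e : twist z t h = h') : t * h = z * h' * t := by
  rw [← e, twist, ← mul_assoc z z, hz, one_mul, mul_assoc _ t t, ht, mul_one]

theorem twist_one_pair (i j : Fin n) (g : SPerm n) (hg : g * g = 1) (ε : ℤˣ) :
    twist 1 g (SPerm.pair i j ε) = SPerm.pair (g.perm i) (g.perm j) (ε * g.sgn i * g.sgn j) := by
  rw [twist, one_mul, SPerm.mul_pair, mul_assoc, hg, mul_one]

theorem twist_one_flip (i : Fin n) (g : SPerm n) (hg : g * g = 1) :
    twist 1 g (SPerm.flip i) = SPerm.flip (g.perm i) := by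
  rw [twist, one_mul, SPerm.mul_flip, mul_assoc, hg, mul_one]

theorem coverAct_twist_ct (last : SPerm n)
    (h : ∀ a b, CoverRel X n 1 (fun k => simpleAct last k) a b → a = b) {k : ℕ}
    (hk : k + 1 < n) (g : CoverGroup X n) :
    coverAct last h (twist cz (ctNat k) g) =
      twist 1 (SPerm.pair ⟨k, by omega⟩ ⟨k + 1, hk⟩ 1) (coverAct last h g) := by
  rw [map_twist, coverAct_cz, ctNat_of_lt (lt_rank hk), coverAct_ct, simpleAct_of_lt last hk]

theorem coverPar_twist (t g : CoverGroup X n) : coverPar (twist cz t g) = coverPar g := by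
  rw [map_twist, coverPar_cz, twist, one_mul, mul_right_comm, Int.units_mul_self, one_mul]

theorem coverAct_refl (last : SPerm n)
    (h : ∀ a b, CoverRel X n 1 (fun k => simpleAct last k) a b → a = b) {i j : ℕ} (hij : i < j)
    (hj : j < n) :
    coverAct last h (refl cz ctNat i j) = SPerm.pair ⟨i, hij.trans hj⟩ ⟨j, hj⟩ 1 ∧
      coverPar (refl cz ctNat i j : CoverGroup X n) = -1 := by
  induction j, hij using Nat.le_induction with
  | base =>
    rw [refl_base, ctNat_of_lt (lt_rank hj), coverAct_ct, coverPar_ct, simpleAct_of_lt last hj]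
    exact ⟨rfl, rfl⟩
  | succ j hij ih =>
    have hij : i < j := hij
    obtain ⟨h1, h2⟩ := ih (by omega)
    rw [refl_step cz_comm _ hij, coverAct_twist_ct last h hj, coverPar_twist, h1, h2,
      twist_one_pair _ _ _ (SPerm.pair_mul_self _ _ _)]
    have e : (⟨i, hij.trans (by omega)⟩ : Fin n) ≠ ⟨j, by omega⟩ := by
      simp only [ne_eq, Fin.mk.injEq]; omega
    have e' : (⟨i, hij.trans (by omega)⟩ : Fin n) ≠ ⟨j + 1, hj⟩ := by
      simp only [ne_eq, Fin.mk.injEq]; omega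
    simp [SPerm.pair, Equiv.swap_apply_of_ne_of_ne e e']

/-- The overlined words of types D and B differ in their innermost part but obey the same recursion,
so only the element for the last pair has to be computed in each type. -/
theorem coverAct_bar (last : SPerm (n + 2))
    (h : ∀ a b, CoverRel X (n + 2) 1 (fun k => simpleAct last k) a b → a = b)
    {bar : ℕ → ℕ → CoverGroup X (n + 2)}
    (base : coverAct last h (bar n (n + 1)) =
      SPerm.pair ⟨n, by omega⟩ ⟨n + 1, by omega⟩ (-1) ∧ coverPar (bar n (n + 1)) = -1)
    (left : ∀ i < n, bar i (n + 1) = twist cz (ctNat i) (bar (i + 1) (n + 1)))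
    (right : ∀ i j, i < j → j < n + 1 → bar i j = twist cz (ctNat j) (bar i (j + 1)))
    {i j : ℕ} (hij : i < j) (hj : j < n + 2) :
    coverAct last h (bar i j) = SPerm.pair ⟨i, hij.trans hj⟩ ⟨j, hj⟩ (-1) ∧
      coverPar (bar i j) = -1 := by
  have hi : ∀ i (hi : i ≤ n), coverAct last h (bar i (n + 1)) =
      SPerm.pair ⟨i, by omega⟩ ⟨n + 1, by omega⟩ (-1) ∧ coverPar (bar i (n + 1)) = -1 := by
    intro i hi
    induction hi using Nat.decreasingInduction with
    | self => exact base
    | of_succ i hi ih =>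
      rw [left i hi, coverAct_twist_ct last h (by omega), coverPar_twist, ih.1, ih.2,
        twist_one_pair _ _ _ (SPerm.pair_mul_self _ _ _)]
      have e : (⟨n + 1, by omega⟩ : Fin (n + 2)) ≠ ⟨i, by omega⟩ := by
        simp only [ne_eq, Fin.mk.injEq]; omega
      have e' : (⟨n + 1, by omega⟩ : Fin (n + 2)) ≠ ⟨i + 1, by omega⟩ := by
        simp only [ne_eq, Fin.mk.injEq]; omega
      simp [SPerm.pair, Equiv.swap_apply_of_ne_of_ne e e']
  have hj' : j ≤ n + 1 := by omega
  clear left base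
  induction hj' using Nat.decreasingInduction with
  | self => exact hi i (by omega)
  | of_succ j hj' ih =>
    obtain ⟨h1, h2⟩ := ih (by omega) (by omega) hi
    rw [right i j hij hj', coverAct_twist_ct last h (by omega), coverPar_twist, h1, h2,
      twist_one_pair _ _ _ (SPerm.pair_mul_self _ _ _)]
    have e : (⟨i, by omega⟩ : Fin (n + 2)) ≠ ⟨j, by omega⟩ := by
      simp only [ne_eq, Fin.mk.injEq]; omega
    have e' : (⟨i, by omega⟩ : Fin (n + 2)) ≠ ⟨j + 1, by omega⟩ := by
      simp only [ne_eq, Fin.mk.injEq]; omega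
    simp [SPerm.pair, Equiv.swap_apply_of_ne_of_ne e e']

/-- The lifts of the reflections in `e_i - ε e_j`. -/
def pairLift (bar : ℕ → ℕ → CoverGroup X n) (i j : ℕ) (ε : ℤˣ) : CoverGroup X n :=
  if ε = 1 then refl cz ctNat i j else bar i j

theorem pairLift_one (bar : ℕ → ℕ → CoverGroup X n) (i j : ℕ) :
    pairLift bar i j 1 = refl cz ctNat i j := if_pos rfl

theorem pairLift_neg_one (bar : ℕ → ℕ → CoverGroup X n) (i j : ℕ) :
    pairLift bar i j (-1) = bar i j := if_neg (by decide)

theorem pairLift_symm {bar : ℕ → ℕ → CoverGroup X n} (hb : ∀ i j, bar j i = bar i j) {i j : ℕ}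
    (hij : i ≠ j) (ε : ℤˣ) : pairLift bar j i ε = czHom (-ε) * pairLift bar i j ε := by
  rcases Int.units_eq_one_or ε with rfl | rfl
  · rw [pairLift_one, pairLift_one, czHom_neg_one]
    rcases lt_or_gt_of_ne hij with h | h
    · exact refl_rev _ h
    · rw [refl_rev _ h, ← mul_assoc, cz_mul_self, one_mul]
  · rw [pairLift_neg_one, pairLift_neg_one, neg_neg, map_one, one_mul, hb]

variable (X n) in
/-- The type-dependent part of a reflection datum for a double cover. -/
structure CoverData where
  last : SPerm n
  rel : ∀ a b, CoverRel X n 1 (fun k => simpleAct last k) a b → a = b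
  c : ℤˣ → ℂ
  d : ℂ
  bar : ℕ → ℕ → CoverGroup X n
  S : ℕ → CoverGroup X n
  c_inv : ∀ (k : Fin (rank X n)) i j ε,
    c (ε * (simpleAct last k).sgn i * (simpleAct last k).sgn j) = c ε
  bar_comm : ∀ i j, bar j i = bar i j
  twist_pair : ∀ (k : Fin (rank X n)) (i j : Fin n) ε, i < j → c ε ≠ 0 →
    twist cz (ct k) (pairLift bar i j ε) = czHom ((simpleAct last k).sgn i) *
      pairLift bar ((simpleAct last k).perm i) ((simpleAct last k).perm j)
        (ε * (simpleAct last k).sgn i * (simpleAct last k).sgn j)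
  act_bar : c (-1) ≠ 0 → ∀ i j : Fin n, i < j →
    coverAct last rel (bar i j) = SPerm.pair i j (-1) ∧ coverPar (bar i j) = -1
  twist_S : d ≠ 0 → ∀ (k : Fin (rank X n)) (i : Fin n),
    twist cz (ct k) (S i) = czHom ((simpleAct last k).sgn i) * S ((simpleAct last k).perm i)
  act_S : d ≠ 0 → ∀ i : Fin n,
    coverAct last rel (S i) = SPerm.flip i ∧ coverPar (S i) = -1

namespace CoverData

variable (C : CoverData X n)

theorem c_inv' (g : CoverGroup X n) (i j : Fin n) (ε : ℤˣ) :
    C.c (ε * (coverAct C.last C.rel g).sgn i * (coverAct C.last C.rel g).sgn j) = C.c ε := by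
  induction g using CoverGroup.induction generalizing i j ε with
  | one => simp
  | z => simp [coverAct_cz]
  | t k =>
    rw [coverAct_ct]
    exact C.c_inv k i j ε
  | mul g h hg hh =>
    refine Eq.trans (congrArg C.c ?_) ((hg ((coverAct C.last C.rel h).perm i)
      ((coverAct C.last C.rel h).perm j) _).trans (hh i j ε))
    rw [map_mul, SPerm.mul_sgn, SPerm.mul_sgn]
    ac_rfl

/-- A reversed pair is reordered before and after the twist. The powers of z involved match for
every choice of the three signs. -/
theorem twist_pair' (k : Fin (rank X n)) {i j : Fin n} (hij : i ≠ j) (ε : ℤˣ) (hc : C.c ε ≠ 0) :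
    twist cz (ct k) (pairLift C.bar i j ε) = czHom ((simpleAct C.last k).sgn i) *
      pairLift C.bar ((simpleAct C.last k).perm i) ((simpleAct C.last k).perm j)
        (ε * (simpleAct C.last k).sgn i * (simpleAct C.last k).sgn j) := by
  rcases lt_or_gt_of_ne hij with h | h
  · exact C.twist_pair k i j ε h hc
  · have hs : ∀ (e : ℤˣ) (g : CoverGroup X n), twist cz (ct k) (czHom e * g) =
        czHom e * twist cz (ct k) g := by
      intro e g
      rcases Int.units_eq_one_or e with rfl | rfl
      · simp
      · exact twist_mul cz_comm _ _
    have hne : (((simpleAct C.last k).perm j : Fin n) : ℕ) ≠ (simpleAct C.last k).perm i := by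
      rw [← Fin.ext_iff.ne]
      simpa using hij.symm
    rw [pairLift_symm C.bar_comm (by omega : (j : ℕ) ≠ i), hs, C.twist_pair k j i ε h hc,
      pairLift_symm C.bar_comm hne, mul_right_comm ε, ← mul_assoc, ← mul_assoc, ← map_mul,
      ← map_mul]
    congr 2
    generalize (simpleAct C.last k).sgn i = a
    generalize (simpleAct C.last k).sgn j = b
    rcases Int.units_eq_one_or ε with rfl | rfl <;> rcases Int.units_eq_one_or a with rfl | rfl <;>
      rcases Int.units_eq_one_or b with rfl | rfl <;> rfl

/-- The exponent of z is a cocycle in g, so the formula passes to products. For a generator it is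
the twist formula with z moved to the other side, which accounts for the parity -1. -/
theorem pair_conj (g : CoverGroup X n) {i j : Fin n} (hij : i ≠ j) (ε : ℤˣ) (hc : C.c ε ≠ 0) :
    g * pairLift C.bar i j ε = czHom (coverPar g * (coverAct C.last C.rel g).sgn i) *
      pairLift C.bar ((coverAct C.last C.rel g).perm i) ((coverAct C.last C.rel g).perm j)
        (ε * (coverAct C.last C.rel g).sgn i * (coverAct C.last C.rel g).sgn j) * g := by
  induction g using CoverGroup.induction generalizing i j ε with
  | one => simp
  | z => simp [coverAct_cz, coverPar_cz, cz_comm]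
  | t k =>
    rw [mul_eq_of_twist cz_mul_self (ct_mul_self k) (C.twist_pair' k hij ε hc), coverAct_ct,
      coverPar_ct, map_mul, czHom_neg_one]
    simp only [mul_assoc]
  | mul g h hg hh =>
    rw [mul_assoc, hh hij ε hc, ← mul_assoc, ← mul_assoc, ← czHom_comm, mul_assoc (czHom _) g,
      hg (by simpa using hij) _ (by rwa [C.c_inv'])]
    simp only [map_mul, SPerm.mul_sgn, SPerm.mul_perm, Equiv.Perm.mul_apply, ← mul_assoc]
    rw [← map_mul, ← map_mul, ← map_mul, ← map_mul, ← map_mul, ← map_mul]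
    congr 3
    · congr 1
      ac_rfl
    · ac_rfl

theorem S_conj (hd : C.d ≠ 0) (g : CoverGroup X n) (i : Fin n) :
    g * C.S i = czHom (coverPar g * (coverAct C.last C.rel g).sgn i) *
      C.S ((coverAct C.last C.rel g).perm i) * g := by
  induction g using CoverGroup.induction generalizing i with
  | one => simp
  | z => simp [coverAct_cz, coverPar_cz, cz_comm]
  | t k =>
    rw [mul_eq_of_twist cz_mul_self (ct_mul_self k) (C.twist_S hd k i), coverAct_ct,
      coverPar_ct, map_mul, czHom_neg_one]
    simp only [mul_assoc]
  | mul g h hg hh =>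
    rw [mul_assoc, hh, ← mul_assoc, ← mul_assoc, ← czHom_comm, mul_assoc (czHom _) g, hg]
    simp only [map_mul, SPerm.mul_sgn, SPerm.mul_perm, Equiv.Perm.mul_apply, ← mul_assoc]
    rw [← map_mul, ← map_mul, ← map_mul, ← map_mul, ← map_mul, ← map_mul]
    congr 3
    congr 1
    ac_rfl

theorem act_pair {i j : Fin n} (hij : i ≠ j) (ε : ℤˣ) (hc : C.c ε ≠ 0) :
    coverAct C.last C.rel (pairLift C.bar i j ε) = SPerm.pair i j ε ∧
      coverPar (pairLift C.bar i j ε) = -1 := by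
  have key : ∀ i j : Fin n, i < j → coverAct C.last C.rel (pairLift C.bar i j ε) =
      SPerm.pair i j ε ∧ coverPar (pairLift C.bar i j ε) = -1 := by
    intro i j hij
    rcases Int.units_eq_one_or ε with rfl | rfl
    · rw [pairLift_one]
      exact coverAct_refl C.last C.rel hij j.2
    · rw [pairLift_neg_one]
      exact C.act_bar hc i j hij
  rcases lt_or_gt_of_ne hij with h | h
  · exact key i j h
  · have hz : ∀ e, coverAct C.last C.rel (czHom e) = 1 ∧
        coverPar (czHom e : CoverGroup X n) = 1 := by
      intro e
      rcases Int.units_eq_one_or e with rfl | rfl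
      · simp
      · rw [czHom_neg_one, coverAct_cz, coverPar_cz]
        exact ⟨rfl, rfl⟩
    obtain ⟨h1, h2⟩ := key j i h
    rw [pairLift_symm C.bar_comm (by omega : (j : ℕ) ≠ i), map_mul, map_mul, (hz _).1, (hz _).2,
      one_mul, one_mul, h1, h2, SPerm.pair_comm]
    exact ⟨rfl, rfl⟩

/-- The reflection datum of a double cover. -/
def datum : ReflectionDatum (CoverGroup X n) n where
  zp := czHom
  act := coverAct C.last C.rel
  par := coverPar
  c := C.c
  d := C.d
  R i j ε := pairLift C.bar i j ε
  S i := C.S i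
  zp_comm := czHom_comm
  act_zp e := by
    rcases Int.units_eq_one_or e with rfl | rfl
    · simp
    · rw [czHom_neg_one, coverAct_cz]
  par_zp e := by
    rcases Int.units_eq_one_or e with rfl | rfl
    · simp
    · rw [czHom_neg_one, coverPar_cz]
  c_inv := C.c_inv'
  R_symm i j ε hij _ := pairLift_symm C.bar_comm (by omega) ε
  R_conj g i j ε hij hc := C.pair_conj g hij ε hc
  act_R i j ε hij hc := (C.act_pair hij ε hc).1
  par_R i j ε hij hc := (C.act_pair hij ε hc).2
  S_conj g i hd := C.S_conj hd g i
  act_S i hd := (C.act_S hd i).1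
  par_S i hd := (C.act_S hd i).2

end CoverData

/-- The generators that lift transpositions are treated alike in all types. The family `bar` is
consulted only for ε ≠ 1, so that type A, which lacks it, is covered. -/
theorem twist_pairLift_of_lt {bar : ℕ → ℕ → CoverGroup X n} (last : SPerm n)
    (hb : ∀ i j, bar j i = bar i j) {k : ℕ} (hk : k + 1 < n) {i j : Fin n} (hij : i < j) (ε : ℤˣ)
    (hbar : ε ≠ 1 → PairFamily id (n - 1) (fun k => twist cz (ctNat k)) bar) :
    twist cz (ctNat k) (pairLift bar i j ε) = czHom ((simpleAct last k).sgn i) *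
      pairLift bar ((simpleAct last k).perm i) ((simpleAct last k).perm j)
        (ε * (simpleAct last k).sgn i * (simpleAct last k).sgn j) := by
  rw [simpleAct_of_lt last hk, SPerm.pair_sgn_one, SPerm.pair_sgn_one, map_one, one_mul, mul_one,
    mul_one]
  simp only [SPerm.pair, swap_val (show k < n by omega) hk]
  rcases Int.units_eq_one_or ε with rfl | rfl
  · simp only [pairLift_one]
    refine (((pathSystem_twist (N := n - 1) cz_comm cz_mul_self (fun k _ => ctNat_mul_self k)
      (fun k l hkl hl => ctNat_far hkl (by omega)) (fun k hk => ctNat_near (by omega))).pairFamily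
        (fun i _ => refl_base ctNat i) fun i j hij _ => refl_step cz_comm _ hij).apply_sw
        (fun v => ?_) (fun k _ v => twist_mul cz_comm _ v) (fun i j hij => refl_rev _ hij)
        ?_ ?_ ?_ ?_)
    · rw [← mul_assoc, cz_mul_self, one_mul]
    all_goals omega
  · simp only [pairLift_neg_one]
    refine (hbar (by decide)).apply_sw (fun v => rfl) (fun k _ v => rfl) (fun i j _ => hb i j)
      ?_ ?_ ?_ ?_
    all_goals omega

end

end CDaHa

/-! ### The data of type A -/

namespace CDaHa

/-- The data of type `A_{n-1}`. -/
noncomputable def dataA (n : ℕ) (u : ℂ) : CoverData .A n where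
  -- In type A every generator lifts a transposition (k, k+1), so this value never acts.
  last := 1
  rel := by
    intro a b h
    have hlt : ∀ k : Fin (rank .A n), (k : ℕ) + 1 < n := fun k => by
      have := k.2
      simp only [rank] at this
      omega
    cases h with
    | z_sq => simp
    | z_central i => simp
    | t_sq i => rw [simpleAct_of_lt _ (hlt i), SPerm.pair_mul_self]
    | two i j h =>
      rw [one_mul]
      refine simpleAct_commute _ (hlt i) (hlt j) ?_
      simp only [coxeterInt] at h
      split_ifs at h <;> omega
    | three i j h =>
      refine simpleAct_braid _ (hlt i) (hlt j) ?_
      simp only [coxeterInt] at h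
      split_ifs at h <;> omega
    | four i j h =>
      simp only [coxeterInt] at h
      split_ifs at h <;> omega
  c ε := if ε = 1 then u else 0
  d := 0
  -- Placeholders: the parameters belonging to `bar` and `S` are zero.
  bar _ _ := 1
  S _ := 1
  c_inv k i j ε := by
    have hk : (k : ℕ) + 1 < n := by
      have := k.2
      simp only [rank] at this
      omega
    rw [simpleAct_of_lt _ hk, SPerm.pair_sgn_one, SPerm.pair_sgn_one, mul_one, mul_one]
  bar_comm _ _ := rfl
  twist_pair k i j ε hij hc := by
    have hk : (k : ℕ) + 1 < n := by
      have := k.2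
      simp only [rank] at this
      omega
    have hε : ε = 1 := by
      by_contra h
      exact hc (if_neg h)
    have := twist_pairLift_of_lt (X := .A) (bar := fun _ _ => 1) 1 (fun _ _ => rfl) hk hij ε
      fun h => absurd hε h
    rwa [ctNat_of_lt k.2] at this
  act_bar h := absurd (if_neg (by decide)) h
  twist_S h := absurd rfl h
  act_S h := absurd rfl h

/-! ### The data of type D -/

section TypeD

variable (m : ℕ)

theorem coxeterInt_D_last {m i : ℕ} (hi : i < m + 1) :
    coxeterInt .D (m + 2) i (m + 1) = if i + 1 = m then 3 else 2 := by
  have h1 : ¬ i = m + 1 := by omega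
  have h2 : i + 1 = m + 2 ∨ m + 1 + 1 = m + 2 := Or.inr rfl
  rw [coxeterInt, if_neg h1, if_pos h2]
  exact if_congr (by omega) rfl rfl

theorem relD_act (a b : SPerm (m + 2)) (h : CoverRel .D (m + 2) 1
    (fun k => simpleAct (SPerm.pair ⟨m, by omega⟩ ⟨m + 1, by omega⟩ (-1)) k) a b) : a = b := by
  have hlast : ∀ k : Fin (rank .D (m + 2)), ¬ (k : ℕ) + 1 < m + 2 → (k : ℕ) = m + 1 := fun k => by
    have := k.2
    simp only [rank] at this
    omega
  have two : ∀ i : ℕ, i + 1 < m + 2 → coxeterInt .D (m + 2) i (m + 1) = 2 →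
      simpleAct (SPerm.pair ⟨m, by omega⟩ ⟨m + 1, by omega⟩ (-1) : SPerm (m + 2)) i *
        SPerm.pair ⟨m, by omega⟩ ⟨m + 1, by omega⟩ (-1) =
      SPerm.pair ⟨m, by omega⟩ ⟨m + 1, by omega⟩ (-1) *
        simpleAct (SPerm.pair ⟨m, by omega⟩ ⟨m + 1, by omega⟩ (-1)) i := by
    intro i hi h
    rw [simpleAct_of_lt _ hi]
    by_cases him : i = m
    · subst him
      exact SPerm.pair_pair_comm _ _ _ _
    · have : i + 1 < m := by
        rw [coxeterInt_D_last (by omega)] at h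
        split_ifs at h <;> omega
      apply SPerm.pair_commute <;> simp only [ne_eq, Fin.mk.injEq] <;> omega
  have three : ∀ i : ℕ, i + 1 < m + 2 → coxeterInt .D (m + 2) i (m + 1) = 3 →
      simpleAct (SPerm.pair ⟨m, by omega⟩ ⟨m + 1, by omega⟩ (-1) : SPerm (m + 2)) i *
        SPerm.pair ⟨m, by omega⟩ ⟨m + 1, by omega⟩ (-1) *
        simpleAct (SPerm.pair ⟨m, by omega⟩ ⟨m + 1, by omega⟩ (-1)) i =
      SPerm.pair ⟨m, by omega⟩ ⟨m + 1, by omega⟩ (-1) *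
        simpleAct (SPerm.pair ⟨m, by omega⟩ ⟨m + 1, by omega⟩ (-1)) i *
        SPerm.pair ⟨m, by omega⟩ ⟨m + 1, by omega⟩ (-1) := by
    intro i hi h
    rw [simpleAct_of_lt _ hi]
    obtain rfl : m = i + 1 := by
      rw [coxeterInt_D_last (by omega)] at h
      split_ifs at h <;> omega
    apply SPerm.pair_braid <;> simp only [ne_eq, Fin.mk.injEq] <;> omega
  have symm : ∀ i j, coxeterInt .D (m + 2) i j = coxeterInt .D (m + 2) j i := by
    intro i j
    simp only [coxeterInt]
    split_ifs <;> omega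
  cases h with
  | z_sq => simp
  | z_central i => simp
  | t_sq i =>
    by_cases hi : (i : ℕ) + 1 < m + 2
    · rw [simpleAct_of_lt _ hi, SPerm.pair_mul_self]
    · rw [simpleAct_of_not _ hi, SPerm.pair_mul_self]
  | two i j h =>
    rw [one_mul]
    by_cases hi : (i : ℕ) + 1 < m + 2
    · by_cases hj : (j : ℕ) + 1 < m + 2
      · refine simpleAct_commute _ hi hj ?_
        rw [coxeterInt_of_lt hi hj] at h
        simp only [coxeterInt] at h
        split_ifs at h <;> omega
      · rw [simpleAct_of_not _ hj]
        exact two i hi (hlast j hj ▸ h)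
    · rw [simpleAct_of_not _ hi]
      by_cases hj : (j : ℕ) + 1 < m + 2
      · exact (two j hj (hlast i hi ▸ symm i j ▸ h)).symm
      · rw [simpleAct_of_not _ hj]
  | three i j h =>
    by_cases hi : (i : ℕ) + 1 < m + 2
    · by_cases hj : (j : ℕ) + 1 < m + 2
      · refine simpleAct_braid _ hi hj ?_
        rw [coxeterInt_of_lt hi hj] at h
        simp only [coxeterInt] at h
        split_ifs at h <;> omega
      · rw [simpleAct_of_not _ hj]
        exact three i hi (hlast j hj ▸ h)
    · rw [simpleAct_of_not _ hi]
      by_cases hj : (j : ℕ) + 1 < m + 2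
      · exact (three j hj (hlast i hi ▸ symm i j ▸ h)).symm
      · rw [simpleAct_of_not _ hj]
  | four i j h =>
    simp only [coxeterInt] at h
    split_ifs at h <;> omega

/-- Deleting either end of the fork in the diagram of D_{m+2} leaves a path with m + 1 nodes. The
second path is obtained from the first by putting the generator m + 1 in position m. -/
theorem forkSystemD : ForkSystem ((cz : CoverGroup .D (m + 2)) * ·) (m + 1)
    (fun k => twist cz (ctNat k))
    (fun k => twist cz (Function.update ctNat m (ctNat (m + 1)) k)) ctNat
    (Function.update ctNat m (ctNat (m + 1))) := by
  refine forkSystem_twist cz_comm cz_mul_self (t := ctNat) (N := m + 1) (b := ctNat (m + 1))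
    (fun k _ => ctNat_mul_self k) (fun k l hkl hl => ctNat_far hkl (by omega))
    (fun k hk => ctNat_near (by omega)) (ctNat_mul_self _) (fun k hk => ?_) (fun k hk => ?_)
    (fun k hk => ?_)
  · refine ctNat_two (by simp only [rank]; omega) (by simp only [rank]; omega) ?_
    rw [coxeterInt_D_last (by omega), if_neg (by omega)]
  · refine ctNat_three (by simp only [rank]; omega) (by simp only [rank]; omega) ?_
    rw [coxeterInt_D_last (by omega), if_pos (by omega)]
  · refine ctNat_two (by simp only [rank]; omega) (by simp only [rank]; omega) ?_
    rw [coxeterInt_D_last (by omega), if_neg (by omega)]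

theorem forkFamilyD : ForkFamily (m + 1) (fun k => twist (cz : CoverGroup .D (m + 2)) (ctNat k))
    (fun k => twist cz (Function.update ctNat m (ctNat (m + 1)) k)) ctNat
    (Function.update ctNat m (ctNat (m + 1))) (refl cz ctNat)
    (refl cz (Function.update ctNat m (ctNat (m + 1)))) (barReflD (m + 2) cz ctNat) where
  r_base i _ := refl_base _ i
  r_step i j hij _ := refl_step cz_comm _ hij
  r'_base i _ := refl_base _ i
  r'_step i j hij _ := refl_step cz_comm _ hij
  b_last i hi := by
    obtain rfl : i = m := by omega
    rw [barReflD_base, Function.update_self]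
  b_left i hi := barReflD_left cz_comm _ (by omega)
  b_right i j hij hj := barReflD_right cz_comm cz_mul_self _ hij hj

theorem twist_last_D {i j : Fin (m + 2)} (hij : i < j) (ε : ℤˣ) :
    twist cz (ctNat (m + 1)) (pairLift (barReflD (m + 2) (cz : CoverGroup .D (m + 2)) ctNat) i j ε) =
      czHom ((SPerm.pair ⟨m, by omega⟩ ⟨m + 1, by omega⟩ (-1) : SPerm (m + 2)).sgn i) *
        pairLift (barReflD (m + 2) cz ctNat)
          ((SPerm.pair ⟨m, by omega⟩ ⟨m + 1, by omega⟩ (-1) : SPerm (m + 2)).perm i)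
          ((SPerm.pair ⟨m, by omega⟩ ⟨m + 1, by omega⟩ (-1) : SPerm (m + 2)).perm j)
          (ε * (SPerm.pair ⟨m, by omega⟩ ⟨m + 1, by omega⟩ (-1) : SPerm (m + 2)).sgn i *
            (SPerm.pair ⟨m, by omega⟩ ⟨m + 1, by omega⟩ (-1) : SPerm (m + 2)).sgn j) := by
  have hS := forkSystemD m
  have hF := forkFamilyD m
  have hf : ∀ v, twist cz (ctNat (m + 1)) v =
      (fun k => twist (cz : CoverGroup .D (m + 2))
        (Function.update ctNat m (ctNat (m + 1)) k)) m v := fun v => by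
    simp only [Function.update_self]
  rw [hf]
  have hrev : ∀ v : CoverGroup .D (m + 2), cz * (cz * v) = v := fun v => by
    rw [← mul_assoc, cz_mul_self, one_mul]
  obtain ⟨i, hi⟩ := i
  obtain ⟨j, hj⟩ := j
  have hij : i < j := hij
  simp only [SPerm.pair, swap_val (show m < m + 2 by omega) (show m + 1 < m + 2 by omega),
    Fin.mk.injEq]
  by_cases h1 : j < m
  · have e1 : i ≠ m := by omega
    have e2 : i ≠ m + 1 := by omega
    have e3 : j ≠ m := by omega
    have e4 : j ≠ m + 1 := by omega
    rcases Int.units_eq_one_or ε with rfl | rfl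
    · simpa [sw, e1, e2, e3, e4, pairLift_one] using hF.last_r_of_lt hS i j hij h1
    · simpa [sw, e1, e2, e3, e4, pairLift_neg_one] using hF.last_b_of_lt hS i j hij h1
  · by_cases h2 : j = m
    · subst h2
      have e1 : i ≠ j := by omega
      have e2 : i ≠ j + 1 := by omega
      rcases Int.units_eq_one_or ε with rfl | rfl
      · simpa [sw, e1, e2, pairLift_one, pairLift_neg_one] using hF.last_r_pred hS i hij
      · simpa [sw, e1, e2, pairLift_one, pairLift_neg_one] using hF.last_b_pred hS i hij
    · obtain rfl : j = m + 1 := by omega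
      by_cases h3 : i = m
      · subst h3
        rcases Int.units_eq_one_or ε with rfl | rfl
        -- The last reflection maps the pair (m, m+1) to its reverse. For ε = 1 the z from the sign
        -- and the z from the reversal cancel; for ε = -1 only the former is present.
        · simpa [sw, pairLift_one, pairLift_neg_one, refl_rev (z := cz) ctNat hij, hrev,
            czHom_neg_one] using hF.last_r_self hS
        · simpa [sw, pairLift_one, pairLift_neg_one, barReflD_comm _ _ i (i + 1),
            czHom_neg_one] using hF.last_b_self hS
      · have e2 : i ≠ m + 1 := by omega
        rcases Int.units_eq_one_or ε with rfl | rfl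
        · simpa [sw, h3, e2, pairLift_one, pairLift_neg_one] using
            hF.last_r_last hS i (by omega)
        · simpa [sw, h3, e2, pairLift_one, pairLift_neg_one] using
            hF.last_b_last hS i (by omega)

/-- The data of type `D_n`. -/
noncomputable def dataD (u : ℂ) : CoverData .D (m + 2) where
  last := SPerm.pair ⟨m, by omega⟩ ⟨m + 1, by omega⟩ (-1)
  rel := relD_act m
  c _ := u
  d := 0
  bar := barReflD (m + 2) cz ctNat
  S _ := 1
  c_inv _ _ _ _ := rfl
  bar_comm i j := barReflD_comm _ _ i j
  twist_pair k i j ε hij _ := by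
    by_cases hk : (k : ℕ) + 1 < m + 2
    · have := twist_pairLift_of_lt (X := .D)
        (SPerm.pair ⟨m, by omega⟩ ⟨m + 1, by omega⟩ (-1)) (fun i j => barReflD_comm _ _ i j) hk hij
        ε fun _ => (forkFamilyD m).pairFamily_b (forkSystemD m)
      rwa [ctNat_of_lt k.2] at this
    · have hk' : (k : ℕ) = m + 1 := by
        have := k.2
        simp only [rank] at this
        omega
      have hct : (ct k : CoverGroup _ _) = ctNat (m + 1) := by rw [← ctNat_of_lt k.2, hk']
      rw [simpleAct_of_not _ hk, hct]
      exact twist_last_D m hij ε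
  act_bar _ i j hij := by
    refine coverAct_bar _ (relD_act m) ?_ (fun i hi => barReflD_left cz_comm _ hi)
      (fun i j hij hj => barReflD_right cz_comm cz_mul_self _ hij hj) hij j.2
    rw [barReflD_base, ctNat_of_lt (by simp only [rank]; omega), coverAct_ct, coverPar_ct,
      simpleAct_of_not _ (by simp)]
    exact ⟨rfl, rfl⟩
  twist_S h := absurd rfl h
  act_S h := absurd rfl h

end TypeD

/-! ### The data of type B -/

section TypeB

variable (m : ℕ)

theorem coxeterInt_B_last {m i : ℕ} (hi : i < m + 1) :
    coxeterInt .B (m + 2) i (m + 1) = if i = m then 4 else 2 := by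
  have h1 : ¬ i = m + 1 := by omega
  rw [coxeterInt, if_neg h1]
  by_cases h : i = m
  · rw [if_pos h, if_pos (by omega)]
  · rw [if_neg h, if_neg (by omega), if_neg (by omega)]

theorem relB_act (a b : SPerm (m + 2)) (h : CoverRel .B (m + 2) 1
    (fun k => simpleAct (SPerm.flip ⟨m + 1, by omega⟩) k) a b) : a = b := by
  have hlast : ∀ k : Fin (rank .B (m + 2)), ¬ (k : ℕ) + 1 < m + 2 → (k : ℕ) = m + 1 := fun k => by
    have := k.2
    simp only [rank] at this
    omega
  have two : ∀ i : ℕ, i + 1 < m + 2 → coxeterInt .B (m + 2) i (m + 1) = 2 →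
      simpleAct (SPerm.flip ⟨m + 1, by omega⟩ : SPerm (m + 2)) i *
        SPerm.flip ⟨m + 1, by omega⟩ =
      SPerm.flip ⟨m + 1, by omega⟩ * simpleAct (SPerm.flip ⟨m + 1, by omega⟩) i := by
    intro i hi h
    rw [simpleAct_of_lt _ hi]
    have : i < m := by
      rw [coxeterInt_B_last (by omega)] at h
      split_ifs at h <;> omega
    apply SPerm.pair_flip_comm <;> simp only [ne_eq, Fin.mk.injEq] <;> omega
  have four : ∀ i : ℕ, i + 1 < m + 2 → coxeterInt .B (m + 2) i (m + 1) = 4 →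
      (simpleAct (SPerm.flip ⟨m + 1, by omega⟩ : SPerm (m + 2)) i *
        SPerm.flip ⟨m + 1, by omega⟩) ^ 2 =
      (SPerm.flip ⟨m + 1, by omega⟩ * simpleAct (SPerm.flip ⟨m + 1, by omega⟩) i) ^ 2 := by
    intro i hi h
    rw [simpleAct_of_lt _ hi]
    obtain rfl : i = m := by
      rw [coxeterInt_B_last (by omega)] at h
      split_ifs at h with h'
      · exact h'
      · omega
    exact SPerm.pair_flip_quart _ _ _
  have symm : ∀ i j, coxeterInt .B (m + 2) i j = coxeterInt .B (m + 2) j i := by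
    intro i j
    simp only [coxeterInt]
    split_ifs <;> omega
  cases h with
  | z_sq => simp
  | z_central i => simp
  | t_sq i =>
    by_cases hi : (i : ℕ) + 1 < m + 2
    · rw [simpleAct_of_lt _ hi, SPerm.pair_mul_self]
    · rw [simpleAct_of_not _ hi, SPerm.flip_mul_self]
  | two i j h =>
    rw [one_mul]
    by_cases hi : (i : ℕ) + 1 < m + 2
    · by_cases hj : (j : ℕ) + 1 < m + 2
      · refine simpleAct_commute _ hi hj ?_
        rw [coxeterInt_of_lt hi hj] at h
        simp only [coxeterInt] at h
        split_ifs at h <;> omega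
      · rw [simpleAct_of_not _ hj]
        exact two i hi (hlast j hj ▸ h)
    · rw [simpleAct_of_not _ hi]
      by_cases hj : (j : ℕ) + 1 < m + 2
      · exact (two j hj (hlast i hi ▸ symm i j ▸ h)).symm
      · rw [simpleAct_of_not _ hj]
  | three i j h =>
    have hi : (i : ℕ) + 1 < m + 2 := by
      have := i.2
      have := j.2
      simp only [rank] at *
      simp only [coxeterInt] at h
      split_ifs at h <;> omega
    have hj : (j : ℕ) + 1 < m + 2 := by
      have := i.2
      have := j.2
      simp only [rank] at *
      simp only [coxeterInt] at h
      split_ifs at h <;> omega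
    refine simpleAct_braid _ hi hj ?_
    rw [coxeterInt_of_lt hi hj] at h
    simp only [coxeterInt] at h
    split_ifs at h <;> omega
  | four i j h =>
    rw [one_mul]
    by_cases hi : (i : ℕ) + 1 < m + 2
    · by_cases hj : (j : ℕ) + 1 < m + 2
      · rw [coxeterInt_of_lt hi hj] at h
        simp only [coxeterInt] at h
        split_ifs at h <;> omega
      · rw [simpleAct_of_not _ hj]
        exact four i hi (hlast j hj ▸ h)
    · rw [simpleAct_of_not _ hi]
      by_cases hj : (j : ℕ) + 1 < m + 2
      · exact (four j hj (hlast i hi ▸ symm i j ▸ h)).symm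
      · rw [simpleAct_of_not _ hj]

theorem quartSystemB : QuartSystem ((cz : CoverGroup .B (m + 2)) * ·) m
    (fun k => twist cz (ctNat k)) ctNat (twist cz (ctNat (m + 1))) (ctNat (m + 1)) := by
  refine quartSystem_twist cz_comm cz_mul_self
    (fun k _ => ctNat_mul_self k) (fun k l hkl hl => ctNat_far hkl (by omega))
    (fun k hk => ctNat_near (by omega)) (ctNat_mul_self _) (fun k hk => ?_) ?_
  · refine ctNat_two (by simp only [rank]; omega) (by simp only [rank]; omega) ?_
    rw [coxeterInt_B_last (by omega), if_neg (by omega)]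
  · refine ctNat_four (by simp only [rank]; omega) (by simp only [rank]; omega) ?_
    rw [coxeterInt_B_last (by omega), if_pos (by omega)]

theorem quartFamilyB : QuartFamily m (fun k => twist (cz : CoverGroup .B (m + 2)) (ctNat k))
    ctNat (twist cz (ctNat (m + 1))) (ctNat (m + 1)) (refl cz ctNat)
    (barReflB (m + 2) cz ctNat) (signChange (m + 2) cz ctNat) where
  r_base i _ := refl_base _ i
  r_step i j hij _ := refl_step cz_comm _ hij
  b_last := barReflB_base _ _
  b_left i hi := barReflB_left cz_comm _ (by omega)
  b_right i j hij hj := barReflB_right cz_comm cz_mul_self _ hij hj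
  s_last := signChange_last _ _
  s_step i hi := signChange_step cz_comm _ hi

/-- The last reflection only changes the sign of e_{m+1}: it exchanges e_i - e_j with e_i + e_j when
j is the last index and fixes both otherwise. -/
theorem twist_last_B {i j : Fin (m + 2)} (hij : i < j) (ε : ℤˣ) :
    twist cz (ctNat (m + 1)) (pairLift (barReflB (m + 2) (cz : CoverGroup .B (m + 2)) ctNat) i j ε) =
      czHom ((SPerm.flip ⟨m + 1, by omega⟩ : SPerm (m + 2)).sgn i) *
        pairLift (barReflB (m + 2) cz ctNat) i j
          (ε * (SPerm.flip ⟨m + 1, by omega⟩ : SPerm (m + 2)).sgn i *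
            (SPerm.flip ⟨m + 1, by omega⟩ : SPerm (m + 2)).sgn j) := by
  have hS := quartSystemB m
  have hF := quartFamilyB m
  obtain ⟨i, hi⟩ := i
  obtain ⟨j, hj⟩ := j
  have hij : i < j := hij
  simp only [SPerm.flip, Fin.mk.injEq]
  have e1 : i ≠ m + 1 := by omega
  by_cases h1 : j = m + 1
  · subst h1
    rcases Int.units_eq_one_or ε with rfl | rfl
    · simpa [e1, pairLift_one, pairLift_neg_one] using hF.apply_r_last hS i hij
    · simpa [e1, pairLift_one, pairLift_neg_one] using hF.apply_b_last hS i hij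
  · rcases Int.units_eq_one_or ε with rfl | rfl
    · simpa [e1, h1, pairLift_one] using hF.apply_r_of_lt hS i j hij (by omega)
    · simpa [e1, h1, pairLift_neg_one] using hF.apply_b_of_lt hS i j hij (by omega)

theorem twist_signChange (k : ℕ) (hk : k < m + 2) (i : Fin (m + 2)) :
    twist cz (ctNat k) (signChange (m + 2) (cz : CoverGroup .B (m + 2)) ctNat i) =
      czHom ((simpleAct (SPerm.flip ⟨m + 1, by omega⟩ : SPerm (m + 2)) k).sgn i) *
        signChange (m + 2) cz ctNat
          ((simpleAct (SPerm.flip ⟨m + 1, by omega⟩ : SPerm (m + 2)) k).perm i) := by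
  have hS := quartSystemB m
  have hF := quartFamilyB m
  by_cases h : k + 1 < m + 2
  · rw [simpleAct_of_lt _ h, SPerm.pair_sgn_one, map_one, one_mul]
    simp only [SPerm.pair, swap_val hk h]
    obtain ⟨i, hi⟩ := i
    simp only [sw]
    split_ifs with h1 h2
    · subst h1
      exact hF.s_left hS i (by omega)
    · subst h2
      exact (hF.s_step k (by omega)).symm
    · rcases lt_or_gt_of_ne h1 with h3 | h3
      · exact hF.s_above hS k i h3 (by omega)
      · exact hF.s_below hS k i (by omega) (by omega)
  · obtain rfl : k = m + 1 := by omega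
    rw [simpleAct_of_not _ h]
    obtain ⟨i, hi⟩ := i
    simp only [SPerm.flip, Fin.mk.injEq, Equiv.Perm.one_apply]
    split_ifs with h1
    · subst h1
      exact hF.apply_s_last hS
    · rw [map_one, one_mul]
      exact hF.apply_s_of_lt hS i (by omega)

/-- The data of type `B_n`. -/
noncomputable def dataB (u v : ℂ) : CoverData .B (m + 2) where
  last := SPerm.flip ⟨m + 1, by omega⟩
  rel := relB_act m
  c _ := u
  d := v
  bar := barReflB (m + 2) cz ctNat
  S := signChange (m + 2) cz ctNat
  c_inv _ _ _ _ := rfl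
  bar_comm i j := barReflB_comm _ _ i j
  twist_pair k i j ε hij _ := by
    by_cases hk : (k : ℕ) + 1 < m + 2
    · have := twist_pairLift_of_lt (X := .B)
        (SPerm.flip ⟨m + 1, by omega⟩) (fun i j => barReflB_comm _ _ i j) hk hij
        ε fun _ => ((quartFamilyB m).forkFamily (quartSystemB m)).pairFamily_b
          (quartSystemB m).forkSystem
      rwa [ctNat_of_lt k.2] at this
    · have hk' : (k : ℕ) = m + 1 := by
        have := k.2
        simp only [rank] at this
        omega
      have hct : (ct k : CoverGroup _ _) = ctNat (m + 1) := by rw [← ctNat_of_lt k.2, hk']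
      rw [simpleAct_of_not _ hk, hct]
      exact twist_last_B m hij ε
  act_bar _ i j hij := by
    refine coverAct_bar _ (relB_act m) ?_ (fun i hi => barReflB_left cz_comm _ hi)
      (fun i j hij hj => barReflB_right cz_comm cz_mul_self _ hij hj) hij j.2
    rw [barReflB_base, map_twist, coverPar_twist, ctNat_of_lt (by simp only [rank]; omega),
      ctNat_of_lt (by simp only [rank]; omega), coverAct_ct, coverAct_ct, coverPar_ct,
      simpleAct_of_not _ (by simp), simpleAct_of_lt _ (by simp), coverAct_cz,
      twist_one_pair _ _ _ (SPerm.flip_mul_self _)]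
    simp [SPerm.flip]
  twist_S _ k i := by
    have := twist_signChange m k (by simpa only [rank] using k.2) i
    rwa [ctNat_of_lt k.2] at this
  act_S _ i := by
    obtain ⟨i, hi⟩ := i
    have hi' : i ≤ m + 1 := by omega
    simp only
    induction hi' using Nat.decreasingInduction with
    | self =>
      rw [signChange_last, ctNat_of_lt (by simp only [rank]; omega), coverAct_ct, coverPar_ct,
        simpleAct_of_not _ (by simp)]
      exact ⟨rfl, rfl⟩
    | of_succ i hi' ih =>
      obtain ⟨h1, h2⟩ := ih (by omega)
      rw [signChange_step cz_comm _ hi', coverAct_twist_ct _ _ (by omega), coverPar_twist, h1, h2,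
        twist_one_flip _ _ (SPerm.pair_mul_self _ _ _)]
      simp [SPerm.pair]

end TypeB

end CDaHa

/-! ### Models in terms of the generators -/

namespace CDaHa

section MapWords

variable {G H : Type*} [Monoid G] [Monoid H] (f : G →* H) (z : G) (t : ℕ → G)

theorem map_asc (a b : ℕ) : f (asc t a b) = asc (fun k => f (t k)) a b := by
  simp [asc, map_list_prod, Function.comp_def]

theorem map_desc (a b : ℕ) : f (desc t a b) = desc (fun k => f (t k)) a b := by
  simp [desc, map_list_prod, Function.comp_def]

theorem map_refl (i j : ℕ) : f (refl z t i j) = refl (f z) (fun k => f (t k)) i j := by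
  simp only [refl]
  split_ifs <;> simp only [map_mul, map_pow, map_asc, map_desc]

theorem map_barReflD (n i j : ℕ) :
    f (barReflD n z t i j) = barReflD n (f z) (fun k => f (t k)) i j := by
  simp only [barReflD, barReflDLt, map_mul, map_pow, map_asc, map_desc]

theorem map_barReflB (n i j : ℕ) :
    f (barReflB n z t i j) = barReflB n (f z) (fun k => f (t k)) i j := by
  simp only [barReflB, barReflBLt, map_mul, map_pow, map_asc, map_desc]

theorem map_signChange (n i : ℕ) :
    f (signChange n z t i) = signChange n (f z) (fun k => f (t k)) i := by
  simp only [signChange, map_mul, map_pow, map_asc, map_desc]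

end MapWords

variable {X : ClassicalType} {n : ℕ} {E : Type*} [Ring E] [Algebra ℂ E]

section GenRel

variable (ρ : CoverGroup X n →* E) (x y : Fin n → E)

/-- The relations of `x_i` and `y_i` with `t_k`, when `t_k` acts by `s`. -/
def GenRel (s : SPerm n) (k : Fin (rank X n)) : Prop :=
  (∀ i, ρ (ct k) * x i =
    sc (s.sgn i) • (ρ (czHom (-(s.sgn i))) * x (s.perm i) * ρ (ct k))) ∧
  ∀ i, ρ (ct k) * y i = sc (s.sgn i) • (y (s.perm i) * ρ (ct k))

variable {ρ x y}

/-- The signs and powers of z in the general relation are cocycles, so it follows from the relations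
for z and the t_k, which are those of the presentation. -/
theorem equivariant_iff (C : CoverData X n) : C.datum.Equivariant ρ x y ↔
    (∀ i, ρ cz * x i = x i * ρ cz) ∧ (∀ i, ρ cz * y i = y i * ρ cz) ∧
      ∀ k : Fin (rank X n), GenRel ρ x y (simpleAct C.last k) k := by
  constructor
  · intro h
    have hx := h.zp_x (-1)
    have hy := h.zp_y (-1)
    simp only [CoverData.datum, czHom_neg_one] at hx hy
    refine ⟨hx, hy, fun k => ⟨fun i => ?_, fun i => ?_⟩⟩
    · have := h.mul_x (ct k) i
      simp only [CoverData.datum, coverAct_ct, coverPar_ct, neg_one_mul] at this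
      exact this
    · have := h.mul_y (ct k) i
      simp only [CoverData.datum, coverAct_ct] at this
      exact this
  · rintro ⟨hx, hy, ht⟩
    constructor
    · intro g
      simp only [CoverData.datum]
      induction g using CoverGroup.induction with
      | one => simp
      | z => simp [coverAct_cz, coverPar_cz, hx]
      | t k =>
        intro i
        rw [coverAct_ct, coverPar_ct, neg_one_mul]
        exact (ht k).1 i
      | mul g g' hg hg' =>
        intro i
        have hc : ∀ e, ρ g * ρ (czHom e) = ρ (czHom e) * ρ g := fun e => by
          rw [← map_mul, ← map_mul, czHom_comm]
        simp only [map_mul, SPerm.mul_sgn, SPerm.mul_perm, Equiv.Perm.mul_apply]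
        rw [mul_assoc (ρ g), hg', mul_smul_comm, ← mul_assoc, ← mul_assoc, hc,
          mul_assoc (ρ (czHom _)), hg]
        simp only [map_mul, smul_mul_assoc, mul_smul_comm, smul_smul, ← mul_assoc]
        rw [mul_comm (sc _) (sc _)]
        congr 4
        simp only [← map_mul]
        congr 2
        rw [map_mul coverPar]
        ac_rfl
    · intro g
      simp only [CoverData.datum]
      induction g using CoverGroup.induction with
      | one => simp
      | z => simp [coverAct_cz, hy]
      | t k =>
        intro i
        rw [coverAct_ct]
        exact (ht k).2 i
      | mul g g' hg hg' =>
        intro i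
        simp only [map_mul, SPerm.mul_sgn, SPerm.mul_perm, Equiv.Perm.mul_apply]
        rw [mul_assoc, hg', mul_smul_comm, ← mul_assoc, hg, smul_mul_assoc, smul_smul, mul_assoc,
          mul_comm (sc _) (sc _)]

/-- The presentation states how t_k passes x_{k+1} but not x_k. As t_k is an involution, multiplying
by it on both sides gives the missing relation; the same works for the y's and for the last
generator of type D. -/
theorem swap_relation {t c a b : E} {e : ℂ} (ht : t * t = 1) (hc : c * c = 1)
    (htc : t * c = c * t) (he : e * e = 1) (h : t * a = e • (c * b * t)) :
    t * b = e • (c * a * t) := by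
  have h1 : a * t = e • (c * (t * b)) := by
    calc a * t = t * (t * a) * t := by rw [← mul_assoc, ht, one_mul]
      _ = e • (t * c * b * (t * t)) := by rw [h]; simp only [mul_smul_comm, smul_mul_assoc, mul_assoc]
      _ = e • (c * (t * b)) := by rw [ht, mul_one, htc, mul_assoc]
  rw [mul_assoc, h1, mul_smul_comm, smul_smul, he, one_smul, ← mul_assoc, hc, one_mul]

omit [Algebra ℂ E] in
theorem ct_mul_self' (k : Fin (rank X n)) : ρ (ct k) * ρ (ct k) = 1 := by
  rw [← map_mul, ct_mul_self, map_one]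

/-- The factor in the third clause is z for ε = 1 and the scalar -1 for ε = -1, in accordance with
t_k x_{k+1} = z x_k t_k and, in type D, t_n x_n = -x_{n-1} t_n. -/
theorem genRel_pair_iff {a b : Fin n} (hab : a ≠ b) (ε : ℤˣ) (k : Fin (rank X n)) :
    GenRel ρ x y (SPerm.pair a b ε) k ↔
      (∀ j, j ≠ a → j ≠ b → ρ (ct k) * x j = ρ cz * x j * ρ (ct k)) ∧
      (∀ j, j ≠ a → j ≠ b → ρ (ct k) * y j = y j * ρ (ct k)) ∧
      ρ (ct k) * x b = sc ε • (ρ (czHom (-ε)) * x a * ρ (ct k)) ∧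
      ρ (ct k) * y b = sc ε • (y a * ρ (ct k)) := by
  constructor
  · rintro ⟨hx, hy⟩
    refine ⟨fun j ha hb => ?_, fun j ha hb => ?_, ?_, ?_⟩
    · simpa [SPerm.pair, ha, hb, Equiv.swap_apply_of_ne_of_ne ha hb, czHom_neg_one] using hx j
    · simpa [SPerm.pair, ha, hb, Equiv.swap_apply_of_ne_of_ne ha hb] using hy j
    · simpa [SPerm.pair] using hx b
    · simpa [SPerm.pair] using hy b
  · rintro ⟨hx, hy, hxb, hyb⟩
    have hxa := swap_relation (ct_mul_self' k)
      (by rw [← map_mul, ← map_mul, Int.units_mul_self, map_one, map_one])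
      (by rw [← map_mul, ← map_mul, czHom_comm]) (sc_mul_self ε) hxb
    have hya := swap_relation (c := (1 : E)) (ct_mul_self' (ρ := ρ) k) (one_mul _) (by simp) (sc_mul_self ε)
      (show ρ (ct k) * y b = sc ε • (1 * y a * ρ (ct k)) by rwa [one_mul])
    rw [one_mul (y b)] at hya
    constructor
    · intro i
      by_cases ha : i = a
      · subst ha
        simpa [SPerm.pair] using hxa
      · by_cases hb : i = b
        · subst hb
          simpa [SPerm.pair] using hxb
        · simpa [SPerm.pair, ha, hb, Equiv.swap_apply_of_ne_of_ne ha hb, czHom_neg_one] using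
            hx i ha hb
    · intro i
      by_cases ha : i = a
      · subst ha
        simpa [SPerm.pair] using hya
      · by_cases hb : i = b
        · subst hb
          simpa [SPerm.pair] using hyb
        · simpa [SPerm.pair, ha, hb, Equiv.swap_apply_of_ne_of_ne ha hb] using hy i ha hb

theorem genRel_flip_iff (a : Fin n) (k : Fin (rank X n)) :
    GenRel ρ x y (SPerm.flip a) k ↔
      (∀ j, j ≠ a → ρ (ct k) * x j = ρ cz * x j * ρ (ct k)) ∧
      (∀ j, j ≠ a → ρ (ct k) * y j = y j * ρ (ct k)) ∧
      ρ (ct k) * x a = -(x a * ρ (ct k)) ∧ ρ (ct k) * y a = -(y a * ρ (ct k)) := by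
  constructor
  · rintro ⟨hx, hy⟩
    refine ⟨fun j ha => ?_, fun j ha => ?_, ?_, ?_⟩
    · simpa [SPerm.flip, ha, czHom_neg_one] using hx j
    · simpa [SPerm.flip, ha] using hy j
    · simpa [SPerm.flip, sc_neg_one] using hx a
    · simpa [SPerm.flip, sc_neg_one] using hy a
  · rintro ⟨hx, hy, hxa, hya⟩
    constructor
    · intro i
      by_cases ha : i = a
      · subst ha
        simpa [SPerm.flip, sc_neg_one] using hxa
      · simpa [SPerm.flip, ha, czHom_neg_one] using hx i ha
    · intro i
      by_cases ha : i = a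
      · subst ha
        simpa [SPerm.flip, sc_neg_one] using hya
      · simpa [SPerm.flip, ha] using hy i ha

end GenRel

/-- An algebra homomorphism from the free algebra and a homomorphism from the double cover agree
on the generators of the latter. -/
structure Compatible (φ : Free X n →ₐ[ℂ] E) (ρ : CoverGroup X n →* E) : Prop where
  z : φ (gz X n) = ρ cz
  t : ∀ k, φ (gt X n k) = ρ (ct k)

namespace Compatible

variable {φ : Free X n →ₐ[ℂ] E} {ρ : CoverGroup X n →* E} (h : Compatible φ ρ)
include h

theorem gtNat (k : ℕ) : φ (CDaHa.gtNat X n k) = ρ (ctNat k) := by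
  simp only [CDaHa.gtNat, ctNat]
  split_ifs with hk
  · exact h.t _
  · simp

theorem refl (i j : ℕ) :
    φ (refl (gz X n) (CDaHa.gtNat X n) i j) = ρ (refl cz ctNat i j) := by
  have := map_refl (φ : Free X n →* E) (gz X n) (CDaHa.gtNat X n) i j
  simp only [MonoidHom.coe_coe, h.z, h.gtNat] at this
  rw [this, map_refl]

theorem barReflD (m i j : ℕ) :
    φ (barReflD m (gz X n) (CDaHa.gtNat X n) i j) = ρ (barReflD m cz ctNat i j) := by
  have := map_barReflD (φ : Free X n →* E) (gz X n) (CDaHa.gtNat X n) m i j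
  simp only [MonoidHom.coe_coe, h.z, h.gtNat] at this
  rw [this, map_barReflD]

theorem barReflB (m i j : ℕ) :
    φ (barReflB m (gz X n) (CDaHa.gtNat X n) i j) = ρ (barReflB m cz ctNat i j) := by
  have := map_barReflB (φ : Free X n →* E) (gz X n) (CDaHa.gtNat X n) m i j
  simp only [MonoidHom.coe_coe, h.z, h.gtNat] at this
  rw [this, map_barReflB]

theorem signChange (m i : ℕ) :
    φ (signChange m (gz X n) (CDaHa.gtNat X n) i) = ρ (signChange m cz ctNat i) := by
  have := map_signChange (φ : Free X n →* E) (gz X n) (CDaHa.gtNat X n) m i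
  simp only [MonoidHom.coe_coe, h.z, h.gtNat] at this
  rw [this, map_signChange]

theorem of_coverRel {a b : Free X n} (hab : CoverRel X n (gz X n) (gt X n) a b) : φ a = φ b := by
  have key : ∀ {a b : CoverGroup X n}, CoverRel X n cz ct a b → ρ a = ρ b := fun hab =>
    congrArg ρ (CoverGroup.rel hab)
  cases hab with
  | z_sq => simpa [h.z] using key .z_sq
  | z_central i => simpa [h.z, h.t] using key (.z_central i)
  | t_sq i => simpa [h.t] using key (.t_sq i)
  | two i j hm => simpa [h.z, h.t] using key (.two i j hm)
  | three i j hm => simpa [h.t] using key (.three i j hm)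
  | four i j hm => simpa [h.z, h.t] using key (.four i j hm)

theorem commonRel_iff : (∀ a b, CommonRel X n a b → φ a = φ b) ↔
    (∀ i, ρ cz * φ (gx X n i) = φ (gx X n i) * ρ cz) ∧
    (∀ i, ρ cz * φ (gy X n i) = φ (gy X n i) * ρ cz) ∧
    (∀ i j, i ≠ j → φ (gx X n i) * φ (gx X n j) = ρ cz * φ (gx X n j) * φ (gx X n i)) ∧
    (∀ i j, φ (gy X n i) * φ (gy X n j) = φ (gy X n j) * φ (gy X n i)) ∧
    ∀ (k : Fin (rank X n)) (hk : (k : ℕ) + 1 < n),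
      GenRel ρ (fun i => φ (gx X n i)) (fun i => φ (gy X n i))
        (SPerm.pair ⟨k, by omega⟩ ⟨k + 1, hk⟩ 1) k := by
  constructor
  · intro hr
    refine ⟨fun i => ?_, fun i => ?_, fun i j hij => ?_, fun i j => ?_, fun k hk => ?_⟩
    · simpa [h.z] using hr _ _ (.z_x i)
    · simpa [h.z] using hr _ _ (.z_y i)
    · simpa [h.z] using hr _ _ (.x_x i j hij)
    · by_cases hij : i = j
      · rw [hij]
      · simpa using hr _ _ (.y_y i j hij)
    · rw [genRel_pair_iff (by simp [Fin.ext_iff])]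
      refine ⟨fun j h1 h2 => ?_, fun j h1 h2 => ?_, ?_, ?_⟩
      · simpa [h.z, h.t] using hr _ _
          (.t_x_far k hk j (by simpa [Fin.ext_iff] using h1) (by simpa [Fin.ext_iff] using h2))
      · simpa [h.z, h.t] using hr _ _
          (.t_y_far k hk j (by simpa [Fin.ext_iff] using h1) (by simpa [Fin.ext_iff] using h2))
      · simpa [h.z, h.t, czHom_neg_one] using hr _ _
          (.t_x_near k ⟨k, by omega⟩ ⟨k + 1, hk⟩ rfl rfl)
      · simpa [h.z, h.t] using hr _ _ (.t_y_near k ⟨k, by omega⟩ ⟨k + 1, hk⟩ rfl rfl)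
  · rintro ⟨hzx, hzy, hxx, hyy, ht⟩ a b hab
    have ht' := fun k hk => (genRel_pair_iff (by simp [Fin.ext_iff]) 1 k).1 (ht k hk)
    cases hab with
    | cover hab => exact h.of_coverRel hab
    | z_x i => simpa [h.z] using hzx i
    | z_y i => simpa [h.z] using hzy i
    | x_x i j hij => simpa [h.z] using hxx i j hij
    | y_y i j hij => simpa [h.z] using hyy i j
    | t_x_far k hk j h1 h2 =>
      simpa [h.z, h.t] using (ht' k hk).1 j (by simpa [Fin.ext_iff] using h1)
        (by simpa [Fin.ext_iff] using h2)
    | t_y_far k hk j h1 h2 =>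
      simpa [h.z, h.t] using (ht' k hk).2.1 j (by simpa [Fin.ext_iff] using h1)
        (by simpa [Fin.ext_iff] using h2)
    | t_x_near k i j hi hj =>
      obtain ⟨i, hi'⟩ := i
      obtain ⟨j, hj'⟩ := j
      obtain rfl : i = k := hi
      obtain rfl : j = k + 1 := hj
      simpa [h.z, h.t, czHom_neg_one] using (ht' k hj').2.2.1
    | t_y_near k i j hi hj =>
      obtain ⟨i, hi'⟩ := i
      obtain ⟨j, hj'⟩ := j
      obtain rfl : i = k := hi
      obtain rfl : j = k + 1 := hj
      simpa [h.z, h.t] using (ht' k hj').2.2.2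

/-- The model conditions, in terms of the generators. -/
theorem model_iff (C : CoverData X n) :
    C.datum.Model ρ (fun i => φ (gx X n i)) (fun i => φ (gy X n i)) ↔
      (∀ a b, CommonRel X n a b → φ a = φ b) ∧
      (∀ k : Fin (rank X n), ¬ (k : ℕ) + 1 < n →
        GenRel ρ (fun i => φ (gx X n i)) (fun i => φ (gy X n i)) C.last k) ∧
      (∀ i k, φ (gy X n i) * φ (gx X n k) - φ (gx X n k) * φ (gy X n i) =
        C.datum.comm ρ i k) := by
  rw [h.commonRel_iff]
  constructor
  · intro hM
    obtain ⟨hx, hy, ht⟩ := (equivariant_iff C).1 hM.toEquivariant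
    refine ⟨⟨hx, hy, hM.x_x, hM.y_y, fun k hk => ?_⟩, fun k hk => ?_, fun i k => ?_⟩
    · rw [← simpleAct_of_lt C.last hk]
      exact ht k
    · have := ht k
      rwa [simpleAct_of_not _ hk] at this
    · rw [hM.y_x, add_sub_cancel_left]
  · rintro ⟨⟨hx, hy, hxx, hyy, ht⟩, hl, hyx⟩
    refine ⟨(equivariant_iff C).2 ⟨hx, hy, fun k => ?_⟩, hxx, hyy, fun i k => ?_⟩
    · by_cases hk : (k : ℕ) + 1 < n
      · rw [simpleAct_of_lt C.last hk]
        exact ht k hk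
      · rw [simpleAct_of_not _ hk]
        exact hl k hk
    · rw [← hyx, add_sub_cancel]

end Compatible

end CDaHa

/-! ### From a presentation to the basis -/

namespace CDaHa

section Comm

variable {X : ClassicalType} {n : ℕ} {E : Type*} [Ring E] [Algebra ℂ E]
  (ρ : CoverGroup X n →* E) (C : CoverData X n)

theorem CoverData.comm_of_ne {i k : Fin n} (h : i ≠ k) : C.datum.comm ρ i k =
    C.c 1 • (ρ cz * ρ (refl cz ctNat k i)) - C.c (-1) • (ρ cz * ρ (C.bar k i)) := by
  rw [C.datum.comm_of_ne ρ h, UnitsInt.univ, Finset.sum_pair (by decide)]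
  simp only [ReflectionDatum.T, CoverData.datum, pairLift_one, pairLift_neg_one, czHom_neg_one,
    map_one, sc_neg_one, one_mul, neg_one_mul, neg_smul, map_mul, sub_eq_add_neg]

theorem CoverData.comm_self (i : Fin n) : C.datum.comm ρ i i =
    -(∑ k ∈ Finset.univ.erase i, (C.c 1 • (ρ cz * ρ (refl cz ctNat i k)) +
      C.c (-1) • (ρ cz * ρ (C.bar i k)))) - C.d • (ρ cz * ρ (C.S i)) := by
  rw [C.datum.comm_self ρ]
  simp only [UnitsInt.univ, Finset.sum_pair (show (1 : ℤˣ) ≠ -1 by decide)]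
  simp only [ReflectionDatum.T, ReflectionDatum.U, CoverData.datum, pairLift_one,
    pairLift_neg_one, czHom_neg_one, map_mul]

end Comm

section Basis

variable {X : ClassicalType} {n : ℕ}

/-- The relations `r` present the algebra whose representations are the models of `C`. -/
def Presents (r : Free X n → Free X n → Prop) (C : CoverData X n) : Prop :=
  ∀ (E : Type) [Ring E] [Algebra ℂ E] (φ : Free X n →ₐ[ℂ] E) (ρ : CoverGroup X n →* E),
    Compatible φ ρ → ((∀ a b, r a b → φ a = φ b) ↔
      C.datum.Model ρ (fun i => φ (gx X n i)) (fun i => φ (gy X n i)))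

theorem adjoin_generators (r : Free X n → Free X n → Prop)
    (h : ∀ a b, CommonRel X n a b → r a b) :
    Algebra.adjoin ℂ (Set.range (ofCover r h) ∪
      Set.range (fun i => RingQuot.mkAlgHom ℂ r (gx X n i)) ∪
      Set.range (fun i => RingQuot.mkAlgHom ℂ r (gy X n i))) = ⊤ := by
  rw [eq_top_iff, ← (AlgHom.range_eq_top _).2 (RingQuot.mkAlgHom_surjective ℂ r),
    ← Algebra.map_top, ← FreeAlgebra.adjoin_range_ι, AlgHom.map_adjoin]
  refine Algebra.adjoin_mono ?_
  rintro _ ⟨_, ⟨g, rfl⟩, rfl⟩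
  cases g with
  | x i => exact Or.inl (Or.inr ⟨i, rfl⟩)
  | y i => exact Or.inr ⟨i, rfl⟩
  | z => exact Or.inl (Or.inl ⟨cz, CoverGroup.lift_z _ _ _⟩)
  | t k => exact Or.inl (Or.inl ⟨ct k, CoverGroup.lift_t _ _ _ k⟩)

/-- The homomorphism from the free algebra with prescribed values on generators. -/
noncomputable def freeLift {E : Type*} [Ring E] [Algebra ℂ E] (ρ : CoverGroup X n →* E)
    (x y : Fin n → E) : Free X n →ₐ[ℂ] E :=
  FreeAlgebra.lift ℂ fun
    | .x i => x i
    | .y i => y i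
    | .z => ρ cz
    | .t k => ρ (ct k)

section

variable {E : Type*} [Ring E] [Algebra ℂ E] (ρ : CoverGroup X n →* E) (x y : Fin n → E)

theorem freeLift_gx (i : Fin n) : freeLift ρ x y (gx X n i) = x i :=
  FreeAlgebra.lift_ι_apply _ _

theorem freeLift_gy (i : Fin n) : freeLift ρ x y (gy X n i) = y i :=
  FreeAlgebra.lift_ι_apply _ _

theorem freeLift_compatible : Compatible (freeLift ρ x y) ρ :=
  ⟨FreeAlgebra.lift_ι_apply _ _, fun _ => FreeAlgebra.lift_ι_apply _ _⟩

end

theorem ofCover_compatible (r : Free X n → Free X n → Prop)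
    (h : ∀ a b, CommonRel X n a b → r a b) :
    Compatible (RingQuot.mkAlgHom ℂ r) (ofCover r h) :=
  ⟨(CoverGroup.lift_z _ _ _).symm,
    fun k => (CoverGroup.lift_t _ (fun k => RingQuot.mkAlgHom ℂ r (gt X n k)) _ k).symm⟩

theorem CoverGroup.hom_ext {H : Type*} [Monoid H] {f g : CoverGroup X n →* H} (hz : f cz = g cz)
    (ht : ∀ k, f (ct k) = g (ct k)) : f = g := by
  ext w
  induction w using CoverGroup.induction with
  | one => simp
  | z => exact hz
  | t k => exact ht k
  | mul a b ha hb => rw [map_mul, map_mul, ha, hb]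

theorem map_powProd {E F : Type*} [Ring E] [Ring F] (f : E →+* F) (a : Fin n → E)
    (α : Fin n → ℕ) : f (powProd a α) = powProd (fun i => f (a i)) α := by
  simp [powProd, map_list_prod, List.map_ofFn, Function.comp_def]

/-- An algebra presented by relations that describe the models of `C` has the basis of
monomials. -/
theorem Presents.exists_basis {r : Free X n → Free X n → Prop} {C : CoverData X n}
    (hr : Presents r C) (h : ∀ a b, CommonRel X n a b → r a b) :
    ∃ b : Module.Basis ((Fin n → ℕ) × CoverGroup X n × (Fin n → ℕ)) ℂ (RingQuot r),
      ∀ α w γ, b (α, w, γ) = pbw r h α w γ := by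
  -- The algebra satisfies its own relations, hence is a model, and the spanning argument applies.
  have hspan := ((hr _ _ _ (ofCover_compatible r h)).1
    fun a b hab => RingQuot.mkAlgHom_rel ℂ hab).monomialSpan_eq_top (adjoin_generators r h)
  obtain ⟨Q, _, _, ρ, x, y, v, hM, hli⟩ := C.datum.exists_model
  -- Conversely the constructed model respects the relations, so it is a module over the algebra.
  -- Monomials that are independent after acting on `v` are independent.
  have hφ := (hr _ (freeLift ρ x y) ρ (freeLift_compatible ρ x y)).2
    (by simpa only [freeLift_gx, freeLift_gy] using hM)
  let Φ : RingQuot r →ₐ[ℂ] Module.End ℂ Q :=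
    RingQuot.liftAlgHom ℂ ⟨freeLift ρ x y, fun {a b} hab => hφ a b hab⟩
  have hΦ : ∀ a, Φ (RingQuot.mkAlgHom ℂ r a) = freeLift ρ x y a := fun a =>
    RingQuot.liftAlgHom_mkAlgHom_apply ℂ (freeLift ρ x y) (fun a b hab => hφ a b hab) a
  have hρ : (Φ : RingQuot r →* Module.End ℂ Q).comp (ofCover r h) = ρ := by
    refine CoverGroup.hom_ext ?_ fun k => ?_
    · rw [MonoidHom.comp_apply, ← (ofCover_compatible r h).z]
      exact (hΦ _).trans (freeLift_compatible ρ x y).z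
    · rw [MonoidHom.comp_apply, ← (ofCover_compatible r h).t]
      exact (hΦ _).trans ((freeLift_compatible ρ x y).t k)
  have hmono : ∀ α w γ, Φ (pbw r h α w γ) = powProd x α * ρ w * powProd y γ := by
    intro α w γ
    have h1 := map_powProd (Φ : RingQuot r →+* Module.End ℂ Q)
      (fun i => RingQuot.mkAlgHom ℂ r (gx X n i)) α
    have h2 := map_powProd (Φ : RingQuot r →+* Module.End ℂ Q)
      (fun i => RingQuot.mkAlgHom ℂ r (gy X n i)) γ
    have h3 : Φ (ofCover r h w) = ρ w := DFunLike.congr_fun hρ w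
    simp only [RingHom.coe_coe, hΦ, freeLift_gx, freeLift_gy] at h1 h2
    rw [pbw, map_mul, map_mul, h3]
    exact congrArg₂ (· * ·) (congrArg (· * ρ w) h1) h2
  have hlin : LinearIndependent ℂ fun t : (Fin n → ℕ) × CoverGroup X n × (Fin n → ℕ) =>
      pbw r h t.1 t.2.1 t.2.2 := by
    refine LinearIndependent.of_comp ((LinearMap.applyₗ v).comp Φ.toLinearMap) ?_
    convert hli using 2 with t
    simpa using congrArg (· v) (hmono t.1 t.2.1 t.2.2)
  exact ⟨Module.Basis.mk hlin hspan.ge, fun α w γ => Module.Basis.mk_apply _ _ _⟩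

end Basis

end CDaHa

/-! ### The three presentations -/

namespace CDaHa

theorem presents_A (n : ℕ) (u : ℂ) : Presents (RelA n u) (dataA n u) := by
  intro E _ _ φ ρ h
  rw [h.model_iff]
  constructor
  · intro hr
    refine ⟨fun a b hab => hr a b (.common hab), fun k hk => absurd ?_ hk, fun i k => ?_⟩
    · have := k.2
      simp only [rank] at this
      omega
    · by_cases hik : i = k
      · subst hik
        have := hr _ _ (.y_x_eq i)
        simpa [-Finset.sum_erase_eq_sub, CoverData.comm_self, dataA, h.z, h.refl, Finset.mul_sum, Finset.smul_sum]
          using this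
      -- The indices are reversed: the relation with arguments i, j concerns y_j and x_i, whereas
      -- `comm i k` is the commutator of y_i and x_k.
      · have := hr _ _ (.y_x_ne k i hik)
        simpa [CoverData.comm_of_ne _ _ hik, dataA, h.z, h.refl] using this
  · rintro ⟨hc, -, hyx⟩ a b hab
    cases hab with
    | common hab => exact hc a b hab
    | y_x_ne i j hij =>
      have := hyx j i
      simpa [CoverData.comm_of_ne _ _ hij, dataA, h.z, h.refl] using this
    | y_x_eq i =>
      have := hyx i i
      simpa [-Finset.sum_erase_eq_sub, CoverData.comm_self, dataA, h.z, h.refl, Finset.mul_sum, Finset.smul_sum]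
          using this

theorem presents_D (m : ℕ) (u : ℂ) : Presents (RelD (m + 2) u) (dataD m u) := by
  intro E _ _ φ ρ h
  have hlast : ∀ k : Fin (rank .D (m + 2)), ¬ (k : ℕ) + 1 < m + 2 → (k : ℕ) + 1 = m + 2 := by
    intro k
    have := k.2
    simp only [rank] at this
    omega
  have hne : (⟨m, by omega⟩ : Fin (m + 2)) ≠ ⟨m + 1, by omega⟩ := by simp [Fin.ext_iff]
  rw [h.model_iff]
  constructor
  · intro hr
    refine ⟨fun a b hab => hr a b (.common hab), fun k hk => ?_, fun i k => ?_⟩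
    · have hk' := hlast k hk
      refine (genRel_pair_iff hne _ k).2 ⟨fun j h1 h2 => ?_, fun j h1 h2 => ?_, ?_, ?_⟩
      · simp only [ne_eq, Fin.ext_iff] at h1 h2
        simpa [h.z, h.t] using hr _ _ (.t_x_far k hk' j (by omega) (by omega))
      · simp only [ne_eq, Fin.ext_iff] at h1 h2
        simpa [h.z, h.t] using hr _ _ (.t_y_far k hk' j (by omega) (by omega))
      · simpa [h.t] using hr _ _ (.t_x_last k hk' ⟨m, by omega⟩ ⟨m + 1, by omega⟩ rfl rfl)
      · simpa [h.t] using hr _ _ (.t_y_last k hk' ⟨m, by omega⟩ ⟨m + 1, by omega⟩ rfl rfl)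
    · by_cases hik : i = k
      · subst hik
        have := hr _ _ (.y_x_eq i)
        simpa [-Finset.sum_erase_eq_sub, CoverData.comm_self, dataD, h.z, h.refl, h.barReflD, Finset.mul_sum,
          Finset.smul_sum, mul_add] using this
      · have := hr _ _ (.y_x_ne k i hik)
        simpa [CoverData.comm_of_ne _ _ hik, dataD, h.z, h.refl, h.barReflD, mul_sub, smul_sub]
          using this
  · rintro ⟨hc, hl, hyx⟩ a b hab
    have hl' := fun k hk => (genRel_pair_iff hne (-1) k).1 (hl k hk)
    cases hab with
    | common hab => exact hc a b hab
    | t_x_far k hk j h1 h2 =>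
      simpa [h.z, h.t] using (hl' k (by omega)).1 j (by simp only [ne_eq, Fin.ext_iff]; omega)
        (by simp only [ne_eq, Fin.ext_iff]; omega)
    | t_y_far k hk j h1 h2 =>
      simpa [h.z, h.t] using (hl' k (by omega)).2.1 j (by simp only [ne_eq, Fin.ext_iff]; omega)
        (by simp only [ne_eq, Fin.ext_iff]; omega)
    | t_x_last k hk i j hi hj =>
      rw [show i = ⟨m, by omega⟩ from Fin.ext (by simpa using hi),
        show j = ⟨m + 1, by omega⟩ from Fin.ext (by simpa using hj)]
      simpa [h.t] using (hl' k (by omega)).2.2.1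
    | t_y_last k hk i j hi hj =>
      rw [show i = ⟨m, by omega⟩ from Fin.ext (by simpa using hi),
        show j = ⟨m + 1, by omega⟩ from Fin.ext (by simpa using hj)]
      simpa [h.t] using (hl' k (by omega)).2.2.2
    | y_x_ne i j hij =>
      have := hyx j i
      simpa [CoverData.comm_of_ne _ _ hij, dataD, h.z, h.refl, h.barReflD, mul_sub, smul_sub]
        using this
    | y_x_eq i =>
      have := hyx i i
      simpa [-Finset.sum_erase_eq_sub, CoverData.comm_self, dataD, h.z, h.refl, h.barReflD, Finset.mul_sum,
        Finset.smul_sum, mul_add] using this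

theorem presents_B (m : ℕ) (u v : ℂ) : Presents (RelB (m + 2) u v) (dataB m u v) := by
  intro E _ _ φ ρ h
  have hlast : ∀ k : Fin (rank .B (m + 2)), ¬ (k : ℕ) + 1 < m + 2 → (k : ℕ) + 1 = m + 2 := by
    intro k
    have := k.2
    simp only [rank] at this
    omega
  rw [h.model_iff]
  constructor
  · intro hr
    refine ⟨fun a b hab => hr a b (.common hab), fun k hk => ?_, fun i k => ?_⟩
    · have hk' := hlast k hk
      refine (genRel_flip_iff _ k).2 ⟨fun j h1 => ?_, fun j h1 => ?_, ?_, ?_⟩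
      · simp only [ne_eq, Fin.ext_iff] at h1
        simpa [h.z, h.t] using hr _ _ (.t_x_far k hk' j (by omega))
      · simp only [ne_eq, Fin.ext_iff] at h1
        simpa [h.z, h.t] using hr _ _ (.t_y_far k hk' j (by omega))
      · simpa [h.t] using hr _ _ (.t_x_last k hk' ⟨m + 1, by omega⟩ rfl)
      · simpa [h.t] using hr _ _ (.t_y_last k hk' ⟨m + 1, by omega⟩ rfl)
    · by_cases hik : i = k
      · subst hik
        have := hr _ _ (.y_x_eq i)
        simpa [-Finset.sum_erase_eq_sub, CoverData.comm_self, dataB, h.z, h.refl, h.barReflB, h.signChange, Finset.mul_sum,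
          Finset.smul_sum, mul_add] using this
      · have := hr _ _ (.y_x_ne k i hik)
        simpa [CoverData.comm_of_ne _ _ hik, dataB, h.z, h.refl, h.barReflB, mul_sub, smul_sub]
          using this
  · rintro ⟨hc, hl, hyx⟩ a b hab
    have hl' := fun k hk => (genRel_flip_iff _ k).1 (hl k hk)
    cases hab with
    | common hab => exact hc a b hab
    | t_x_far k hk j h1 =>
      simpa [h.z, h.t] using (hl' k (by omega)).1 j (by simp only [ne_eq, Fin.ext_iff]; omega)
    | t_y_far k hk j h1 =>
      simpa [h.z, h.t] using (hl' k (by omega)).2.1 j (by simp only [ne_eq, Fin.ext_iff]; omega)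
    | t_x_last k hk j hj =>
      rw [show j = ⟨m + 1, by omega⟩ from Fin.ext (by simpa using hj)]
      simpa [h.t] using (hl' k (by omega)).2.2.1
    | t_y_last k hk j hj =>
      rw [show j = ⟨m + 1, by omega⟩ from Fin.ext (by simpa using hj)]
      simpa [h.t] using (hl' k (by omega)).2.2.2
    | y_x_ne i j hij =>
      have := hyx j i
      simpa [CoverData.comm_of_ne _ _ hij, dataB, h.z, h.refl, h.barReflB, mul_sub, smul_sub]
        using this
    | y_x_eq i =>
      have := hyx i i
      simpa [-Finset.sum_erase_eq_sub, CoverData.comm_self, dataB, h.z, h.refl, h.barReflB, h.signChange, Finset.mul_sum,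
        Finset.smul_sum, mul_add] using this

end CDaHa

theorem mainTheorem4 :
    (∀ (n : ℕ), 1 ≤ n → ∀ (u : ℂ),
      ∃ b : Module.Basis ((Fin n → ℕ) × CDaHa.CoverGroup .A n × (Fin n → ℕ)) ℂ
          (CDaHa.AlgA n u),
        ∀ (α : Fin n → ℕ) (w : CDaHa.CoverGroup .A n) (γ : Fin n → ℕ),
          b (α, w, γ) = CDaHa.pbwA n u α w γ) ∧
    (∀ (n : ℕ), 4 ≤ n → ∀ (u : ℂ),
      ∃ b : Module.Basis ((Fin n → ℕ) × CDaHa.CoverGroup .D n × (Fin n → ℕ)) ℂ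
          (CDaHa.AlgD n u),
        ∀ (α : Fin n → ℕ) (w : CDaHa.CoverGroup .D n) (γ : Fin n → ℕ),
          b (α, w, γ) = CDaHa.pbwD n u α w γ) ∧
    (∀ (n : ℕ), 2 ≤ n → ∀ (u v : ℂ),
      ∃ b : Module.Basis ((Fin n → ℕ) × CDaHa.CoverGroup .B n × (Fin n → ℕ)) ℂ
          (CDaHa.AlgB n u v),
        ∀ (α : Fin n → ℕ) (w : CDaHa.CoverGroup .B n) (γ : Fin n → ℕ),
          b (α, w, γ) = CDaHa.pbwB n u v α w γ) := by
  refine ⟨fun n _ u => ?_, fun n hn u => ?_, fun n hn u v => ?_⟩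
  · exact CDaHa.Presents.exists_basis (CDaHa.presents_A n u) fun _ _ h => .common h
  · obtain ⟨m, rfl⟩ := Nat.exists_eq_add_of_le' (show 2 ≤ n by omega)
    exact CDaHa.Presents.exists_basis (CDaHa.presents_D m u) fun _ _ h => .common h
  · obtain ⟨m, rfl⟩ := Nat.exists_eq_add_of_le' hn
    exact CDaHa.Presents.exists_basis (CDaHa.presents_B m u v) fun _ _ h => .common h
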